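/- Let $n\ge 3$ be an integer and $\alpha>-1$. Put $\gamma_n=\frac{(n-1)!}{2}|S^n|$ and $\Lambda_1=2\gamma_n=(n-1)!\,|S^n|$, where $|S^n|$ is the surface measure of the unit sphere in $\mathbb{R}^{n+1}$. For $\Lambda>0$ consider the problem $$(-\Delta)^{\frac n2}u=|x|^{n\alpha}e^{nu}\ \text{ in }\mathbb{R}^n,\qquad \int_{\mathbb{R}^n}|x|^{n\alpha}e^{nu}\,dx=\Lambda<\infty. \tag{P}$$ Here, for a Schwartz function $\varphi\in\mathcal{S}(\mathbb{R}^n)$, $(-\Delta)^{\frac n2}\varphi=\mathcal{F}^{-1}(|\xi|^n\mathcal{F}\varphi)$ with $\mathcal{F}\varphi(\xi)=(2\pi)^{-n/2}\int_{\mathbb{R}^n}\varphi(x)e^{-ix\cdot\xi}\,dx$, and $u:\mathbb{R}^n\to\mathbb{R}$ is a solution of (P) if the integral condition holds and $$\int_{\mathbb{R}^n}u\,(-\Delta)^{\frac n2}\varphi\,dx=\int_{\mathbb{R}^n}|x|^{n\alpha}e^{nu}\varphi\,dx,$$ where for $n$ even $u\in L^1_{\mathrm{loc}}(\mathbb{R}^n)$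 is required and the identity is to hold for every $\varphi\in C_c^\infty(\mathbb{R}^n)$, while for $n$ odd $u\in L^1_{\mathrm{loc}}(\mathbb{R}^n)$ with $\int_{\mathbb{R}^n}\frac{|u(x)|}{1+|x|^{2n}}\,dx<\infty$ is required and the identity is to hold for every $\varphi\in\mathcal{S}(\mathbb{R}^n)$. For a solution $u$ write $$v(x)=\frac1{\gamma_n}\int_{\mathbb{R}^n}\log\left(\frac{1+|y|}{|x-y|}\right)|y|^{n\alpha}e^{nu(y)}\,dy .$$ The solution $u$ is called normal if $u=v+c$ on $\mathbb{R}^n$ for some constant $c\in\mathbb{R}$. **Theorem.** 1. For every $0<\Lambda<\Lambda_1(1+\alpha)$ there is a solution $u$ of (P) that is radially symmetric about the origin and has the form $u(x)=v(x)-|x|^2+c$ for all $x\in\mathbb{R}^n$, for some constant $c\in\mathbb{R}$. 2. For $\Lambda=\Lambda_1(1+\alpha)$ there is a solution of (P) that is radially symmetric about the origin and normal. In both cases the integral defining $v(x)$ converges absolutely for every $x\in\mathbb{R}^n$. -/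

import Mathlib

open scoped FourierTransform SchwartzMap

namespace QCurv

/-- `|S^n|`, the total surface measure of the unit sphere of `ℝ^{n+1}`. -/
noncomputable def sphereArea (n : ℕ) : ℝ :=
  (MeasureTheory.volume : MeasureTheory.Measure (EuclideanSpace ℝ (Fin (n + 1)))).toSphere.real
    Set.univ

/-- `γ_n = (n-1)!/2 · |S^n|`. -/
noncomputable def gammaConst (n : ℕ) : ℝ := ((n - 1).factorial : ℝ) / 2 * sphereArea n

/-- `Λ_1 = (n-1)! |S^n|`. -/
noncomputable def Lambda1 (n : ℕ) : ℝ := ((n - 1).factorial : ℝ) * sphereArea n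

/-- `(-Δ)^{m/2} φ` for a Schwartz function `φ`, i.e. the inverse Fourier transform of
`|ξ|^m` times the Fourier transform of `φ`. Mathlib's Fourier transform has the kernel
`exp (-2πi ⟨x, ξ⟩)`, so that in its frequency variable the symbol is `(2π|ξ|)^m`. -/
noncomputable def negLaplacianHalfPow {n : ℕ} (m : ℕ) (φ : 𝓢(EuclideanSpace ℝ (Fin n), ℂ)) :
    EuclideanSpace ℝ (Fin n) → ℂ :=
  𝓕⁻ (fun ξ : EuclideanSpace ℝ (Fin n) =>
    (((2 * Real.pi * ‖ξ‖) ^ m : ℝ) : ℂ) * 𝓕 (φ : EuclideanSpace ℝ (Fin n) → ℂ) ξ)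

/-- The space `L_s(ℝ^n)`: locally integrable `w` with `∫ |w(x)| / (1 + |x|^{n+2s}) dx < ∞`. -/
def MemL {n : ℕ} (s : ℝ) (w : EuclideanSpace ℝ (Fin n) → ℝ) : Prop :=
  MeasureTheory.LocallyIntegrable w ∧
    MeasureTheory.Integrable (fun x => |w x| / (1 + ‖x‖ ^ ((n : ℝ) + 2 * s)))

/-- `u` is a weak solution of `(-Δ)^{m/2} u = f` in `ℝ^n`, where `f` is an integrable function,
seen as the tempered distribution `φ ↦ ∫ f φ`. If `m` is even, `u` is locally integrable and the
equation is tested with compactly supported smooth functions; if `m` is odd, `u ∈ L_{m/2}(ℝ^n)`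
and it is tested with Schwartz functions. -/
def IsWeakSolution {n : ℕ} (m : ℕ) (f u : EuclideanSpace ℝ (Fin n) → ℝ) : Prop :=
  (Even m → MeasureTheory.LocallyIntegrable u ∧
    ∀ φ : 𝓢(EuclideanSpace ℝ (Fin n), ℂ), HasCompactSupport φ →
      ∫ x, (u x : ℂ) * negLaplacianHalfPow m φ x = ∫ x, (f x : ℂ) * φ x) ∧
  (Odd m → MemL ((m : ℝ) / 2) u ∧
    ∀ φ : 𝓢(EuclideanSpace ℝ (Fin n), ℂ),
      ∫ x, (u x : ℂ) * negLaplacianHalfPow m φ x = ∫ x, (f x : ℂ) * φ x)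

/-- The density `|x|^{nα} e^{n u(x)}`. -/
noncomputable def density {n : ℕ} (α : ℝ) (u : EuclideanSpace ℝ (Fin n) → ℝ)
    (x : EuclideanSpace ℝ (Fin n)) : ℝ :=
  ‖x‖ ^ ((n : ℝ) * α) * Real.exp ((n : ℝ) * u x)

/-- `u` solves `(-Δ)^{n/2} u = |x|^{nα} e^{nu}` in `ℝ^n` with
`∫ |x|^{nα} e^{nu} dx = Λ < ∞`. -/
def IsSolution {n : ℕ} (α Λ : ℝ) (u : EuclideanSpace ℝ (Fin n) → ℝ) : Prop :=
  MeasureTheory.Integrable (density α u) ∧ ∫ x, density α u x = Λ ∧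
    IsWeakSolution n (density α u) u

/-- The integrand `log ((1 + |y|) / |x - y|) |y|^{nα} e^{n u(y)}` of the potential `v` of `u`. -/
noncomputable def potentialIntegrand {n : ℕ} (α : ℝ) (u : EuclideanSpace ℝ (Fin n) → ℝ)
    (x y : EuclideanSpace ℝ (Fin n)) : ℝ :=
  Real.log ((1 + ‖y‖) / ‖x - y‖) * density α u y

/-- `v(x) = γ_n⁻¹ ∫ log ((1 + |y|) / |x - y|) |y|^{nα} e^{n u(y)} dy`. -/
noncomputable def potential {n : ℕ} (α : ℝ) (u : EuclideanSpace ℝ (Fin n) → ℝ)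
    (x : EuclideanSpace ℝ (Fin n)) : ℝ :=
  1 / gammaConst n * ∫ y, potentialIntegrand α u x y

/-- `u = v + p` everywhere, where `v` is the potential of `u` and the integral that defines `v`
converges absolutely at every point. -/
def IsPotentialPlus {n : ℕ} (α : ℝ) (u p : EuclideanSpace ℝ (Fin n) → ℝ) : Prop :=
  ∀ x, MeasureTheory.Integrable (potentialIntegrand α u x) ∧ u x = potential α u x + p x

/-- A solution is normal if `u = v + c` for a constant `c`. -/
def IsNormalSolution {n : ℕ} (α Λ : ℝ) (u : EuclideanSpace ℝ (Fin n) → ℝ) : Prop :=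
  IsSolution α Λ u ∧ ∃ c : ℝ, IsPotentialPlus α u (fun _ => c)

/-- Radial symmetry about the origin. -/
def IsRadial {n : ℕ} (u : EuclideanSpace ℝ (Fin n) → ℝ) : Prop :=
  ∀ x y, ‖x‖ = ‖y‖ → u x = u y

end QCurv

/-!
A radial solution is sought in cylindrical coordinates `t = log |x|`. Let `p` be a probability
density on the line, let `f (x) = Λ |S^{n-1}|⁻¹ |x|^{-n} p (log |x|)` be the corresponding radial
density of mass `Λ` on `ℝ^n`, and let `v` be its logarithmic potential. Averaging `log |x - y|` over
spheres gives `(log |x| + log |y|) / 2 + K (log |x| - log |y|)`, where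
`K τ = ½ log (2 cosh τ) - ∑ j, β j (cosh τ)^{-2(j+1)}` with `β j ≥ 0` summable
(`integral_log_norm_sub_mul_fun_norm`). Hence `u = v - η |x|² + c` satisfies `|x|^{nα} e^{nu} = f`
for a suitable constant `c` when `p` solves the mean-field equation

  `p t = exp (W t - κ (K * p) t - A)`, `κ = n Λ / γ_n`,
  `W t = n (1 + α - Λ / (2 γ_n)) t - n η e^{2t}`.

For `η = 1` and `Λ < Λ_1 (1 + α)` the field `W` tends to `-∞` at both ends. For `η = 0` and
`Λ = Λ_1 (1 + α)` it vanishes, and the problem is even.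

The mean-field equation is solved by iterating the Gibbs map `q ↦ exp (W - κ (K * q)) / Z`
(`exists_gibbs_fixed`). The kernel `K` is conditionally negative semidefinite
(`integral_cylKernel_nonpos`): negative powers of `cosh (t - s)` are mixtures of products
`h t * h s`, and `log (2 cosh τ)` is the limit of `(1 - (2 cosh τ)^{-ε}) / ε` as `ε → 0`. Therefore
a free energy decreases along the iteration by at least the squared Hellinger distance of
consecutive iterates (`hellinger_le`). The energy bounds the first moment, if the field is confining
or if the density is even (`exists_moment_le`), so that all iterates lie below a common exponential
and their potentials are equicontinuous. A subsequence converges, consecutive iterates have the same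
limit, and this limit is a fixed point.

It remains to see that `v` solves `(-Δ)^{n/2} v = f` weakly. By Fubini's theorem this is the
statement that `-log |x| / γ_n` is a fundamental solution
(`integral_neg_log_mul_fourierInv_norm_pow`). Here `log` is written as a Frullani integral of
Gaussians, whose Fourier transforms integrate to a multiple of `|ξ|^{-n}`. The constant comes from
Legendre's duplication formula. All exchanges of integrals rest on the decay of `(-Δ)^{n/2} φ` for a
Schwartz function `φ` (`integrable_weight_mul_fourierInv_norm_pow`): `|ξ|^n` is a multiple of
`∫ (1 - cos (2π ⟨z, ξ⟩))^n |z|^{-2n} dz`, so that `(-Δ)^{n/2} φ` is a superposition of iterated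
second differences of `φ`. In dimension `n ≥ 3` the decay also makes `(-Δ)^{n/2} φ` orthogonal to
`1` and to `|x|²`, which is why `-η |x|² + c` can be added to `v`.
-/

namespace QCurv

open MeasureTheory Set Filter Topology Real

/-! ### Symmetric second differences -/

/-- The symmetric second difference `G(s) - (G(s+1) + G(s-1))/2`. -/
noncomputable def secondDiff (G : ℝ → ℂ) : ℝ → ℂ :=
  fun s => G s - (1 / 2) * (G (s + 1) + G (s - 1))

lemma iteratedDeriv_secondDiff {G : ℝ → ℂ} (hG : ContDiff ℝ (⊤ : ℕ∞) G) (k : ℕ) :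
    iteratedDeriv k (secondDiff G) = secondDiff (iteratedDeriv k G) := by
  have hk : ContDiff ℝ k G := hG.of_le (by exact_mod_cast le_top)
  have h1 : ContDiff ℝ k (fun s => G (s + 1)) := hk.comp (contDiff_id.add contDiff_const)
  have h2 : ContDiff ℝ k (fun s => G (s - 1)) := hk.comp (contDiff_id.sub contDiff_const)
  ext s
  unfold secondDiff
  rw [iteratedDeriv_fun_sub hk.contDiffAt (contDiff_const.mul (h1.add h2)).contDiffAt,
    iteratedDeriv_const_mul_field, iteratedDeriv_fun_add h1.contDiffAt h2.contDiffAt,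
    iteratedDeriv_comp_add_const, iteratedDeriv_comp_sub_const]

lemma contDiff_secondDiff {G : ℝ → ℂ} (hG : ContDiff ℝ (⊤ : ℕ∞) G) :
    ContDiff ℝ (⊤ : ℕ∞) (secondDiff G) :=
  hG.sub (contDiff_const.mul ((hG.comp (contDiff_id.add contDiff_const)).add
    (hG.comp (contDiff_id.sub contDiff_const))))

lemma norm_secondDiff_le {G : ℝ → ℂ} (hG : ContDiff ℝ 2 G) {s B : ℝ}
    (hB : ∀ r, |r - s| ≤ 1 → ‖iteratedDeriv 2 G r‖ ≤ B) : ‖secondDiff G s‖ ≤ B := by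
  have hd : Differentiable ℝ G := hG.differentiable (by norm_num)
  have hd' : Differentiable ℝ (deriv G) := by
    have := hG.differentiable_iteratedDeriv 1 (by norm_num)
    rwa [iteratedDeriv_one] at this
  have h2 : iteratedDeriv 2 G = deriv (deriv G) := by
    rw [iteratedDeriv_succ, iteratedDeriv_one]
  have hB0 : 0 ≤ B := (norm_nonneg _).trans (hB s (by simp))
  have hder : ∀ t ∈ Icc (0 : ℝ) 1, HasDerivWithinAt (fun t => G (s + t) + G (s - t))
      (deriv G (s + t) - deriv G (s - t)) (Icc 0 1) t := by
    intro t _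
    have e1 : HasDerivAt (fun t => G (s + t)) (deriv G (s + t)) t :=
      (hd (s + t)).hasDerivAt.comp_const_add s t
    have e2 : HasDerivAt (fun t => G (s - t)) (-deriv G (s - t)) t :=
      (hd (s - t)).hasDerivAt.comp_const_sub s t
    rw [sub_eq_add_neg]
    exact (e1.fun_add e2).hasDerivWithinAt
  have hbd : ∀ t ∈ Ico (0 : ℝ) 1, ‖deriv G (s + t) - deriv G (s - t)‖ ≤ 2 * B := by
    intro t ht
    have hc : Convex ℝ (Icc (s - 1) (s + 1)) := convex_Icc _ _
    have := hc.norm_image_sub_le_of_norm_deriv_le (f := deriv G) (C := B)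
      (x := s - t) (y := s + t) (fun r _ => hd' r)
      (fun r hr => by
        rw [← h2]; exact hB r (abs_le.2 ⟨by linarith [hr.1], by linarith [hr.2]⟩))
      ⟨by linarith [ht.2], by linarith [ht.1]⟩ ⟨by linarith [ht.1], by linarith [ht.2]⟩
    refine this.trans ?_
    rw [Real.norm_eq_abs, abs_of_nonneg (by linarith [ht.1])]
    nlinarith [ht.2, ht.1]
  have := norm_image_sub_le_of_norm_deriv_le_segment' hder hbd 1 (by simp)
  simp only [add_zero, sub_zero, mul_one] at this
  have e : secondDiff G s = -(1 / 2 : ℂ) * (G (s + 1) + G (s - 1) - (G s + G s)) := by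
    unfold secondDiff; ring
  rw [e, norm_mul, norm_neg]
  have : ‖(1 / 2 : ℂ)‖ = 1 / 2 := by norm_num
  rw [this]; linarith

/-- The `M`-th iterate of the second difference is controlled by the derivative of order `2M`. -/
lemma norm_iterate_secondDiff_le (M : ℕ) {G : ℝ → ℂ} (hG : ContDiff ℝ (⊤ : ℕ∞) G) {s B : ℝ}
    (hB : ∀ r, |r - s| ≤ M → ‖iteratedDeriv (2 * M) G r‖ ≤ B) :
    ‖secondDiff^[M] G s‖ ≤ B := by
  induction M generalizing G with
  | zero => simpa using hB s (by simp)
  | succ M ih =>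
    rw [Function.iterate_succ_apply]
    refine ih (contDiff_secondDiff hG) fun r hr => ?_
    rw [iteratedDeriv_secondDiff hG]
    refine norm_secondDiff_le ?_ fun r' hr' => ?_
    · rw [iteratedDeriv_eq_iterate]
      refine ContDiff.iterate_deriv' 2 (2 * M) (hG.of_le ?_)
      exact WithTop.coe_le_coe.2 le_top
    · have : iteratedDeriv 2 (iteratedDeriv (2 * M) G) = iteratedDeriv (2 * (M + 1)) G := by
        rw [iteratedDeriv_eq_iterate, iteratedDeriv_eq_iterate, iteratedDeriv_eq_iterate,
          ← Function.iterate_add_apply, show 2 * (M + 1) = 2 + 2 * M by ring]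
      rw [this]
      refine hB r' ?_
      push_cast
      calc |r' - s| = |(r' - r) + (r - s)| := by ring_nf
        _ ≤ |r' - r| + |r - s| := abs_add_le _ _
        _ ≤ M + 1 := by linarith

section
variable {V : Type*} [NormedAddCommGroup V] [InnerProductSpace ℝ V] [FiniteDimensional ℝ V]
  [MeasurableSpace V] [BorelSpace V]

lemma continuous_iterate_secondDiff {X : Type*} [TopologicalSpace X] {F : X → ℝ → ℂ}
    (hF : Continuous fun p : X × ℝ => F p.1 p.2) (M : ℕ) :
    Continuous fun p : X × ℝ => secondDiff^[M] (F p.1) p.2 := by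
  induction M generalizing F with
  | zero => simpa using hF
  | succ M ih =>
    simp only [Function.iterate_succ_apply]
    refine ih (F := fun x => secondDiff (F x)) ?_
    unfold secondDiff
    have h1 : Continuous fun p : X × ℝ => F p.1 (p.2 + 1) :=
      hF.comp (continuous_fst.prodMk (continuous_snd.add continuous_const))
    have h2 : Continuous fun p : X × ℝ => F p.1 (p.2 - 1) :=
      hF.comp (continuous_fst.prodMk (continuous_snd.sub continuous_const))
    fun_prop

lemma integrable_cos_pow_mul {h : V → ℂ} (hh : Integrable h) (z : V) (M : ℕ) :
    Integrable fun ξ => ((1 - cos (2 * π * inner ℝ z ξ) : ℝ) : ℂ) ^ M * h ξ := by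
  refine hh.bdd_mul (c := 2 ^ M) (by fun_prop) (Eventually.of_forall fun ξ => ?_)
  rw [norm_pow, Complex.norm_real, Real.norm_eq_abs]
  gcongr
  have := neg_one_le_cos (2 * π * inner ℝ z ξ)
  have := cos_le_one (2 * π * inner ℝ z ξ)
  rw [abs_le]; constructor <;> linarith

/-- The multiplier `1 - cos (2π⟪z, ξ⟫)` corresponds to a second difference in direction `z`. -/
lemma fourierInv_one_sub_cos_mul {h : V → ℂ} (hh : Integrable h) (z x : V) :
    𝓕⁻ (fun ξ => ((1 - cos (2 * π * inner ℝ z ξ) : ℝ) : ℂ) * h ξ) x =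
      𝓕⁻ h x - (1 / 2) * (𝓕⁻ h (x + z) + 𝓕⁻ h (x - z)) := by
  have hi : ∀ y : V, Integrable fun ξ => Complex.exp (↑(2 * π * inner ℝ ξ y) * Complex.I) * h ξ := by
    intro y
    refine hh.bdd_mul (c := 1) (by fun_prop) (Eventually.of_forall fun ξ => ?_)
    rw [Complex.norm_exp_ofReal_mul_I]
  simp only [Real.fourierInv_eq', smul_eq_mul]
  have hs : Integrable fun ξ => (1 / 2 : ℂ) *
      (Complex.exp (↑(2 * π * inner ℝ ξ (x + z)) * Complex.I) * h ξ +
        Complex.exp (↑(2 * π * inner ℝ ξ (x - z)) * Complex.I) * h ξ) :=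
    ((hi _).add (hi _)).const_mul _
  rw [← integral_add (hi _) (hi _), ← integral_const_mul, ← integral_sub (hi _) hs]
  refine integral_congr_ae (Eventually.of_forall fun ξ => ?_)
  simp only [inner_add_right, inner_sub_right, real_inner_comm ξ z]
  push_cast
  simp only [Complex.cos, mul_add, mul_sub, add_mul, sub_mul, Complex.exp_add, Complex.exp_sub,
    neg_mul, Complex.exp_neg]
  have := Complex.exp_ne_zero (2 * π * inner ℝ z ξ * Complex.I : ℂ)
  field_simp

lemma fourierInv_one_sub_cos_pow_mul {h : V → ℂ} (hh : Integrable h) (z : V) (M : ℕ) (x : V)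
    (s : ℝ) :
    𝓕⁻ (fun ξ => ((1 - cos (2 * π * inner ℝ z ξ) : ℝ) : ℂ) ^ M * h ξ) (x + s • z) =
      secondDiff^[M] (fun r => 𝓕⁻ h (x + r • z)) s := by
  induction M generalizing s with
  | zero => simp
  | succ M ih =>
    rw [Function.iterate_succ_apply', secondDiff, ← ih, ← ih, ← ih]
    have := fourierInv_one_sub_cos_mul (integrable_cos_pow_mul hh z M) z (x + s • z)
    have e1 : x + (s + 1) • z = x + s • z + z := by module
    have e2 : x + (s - 1) • z = x + s • z - z := by module
    rw [e1, e2, ← this]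
    simp only [pow_succ', mul_assoc]

end

/-- Iterated second differences of a Schwartz function gain a power of the step and keep the
rapid decay. -/
lemma exists_norm_iterate_secondDiff_le {V : Type*} [NormedAddCommGroup V]
    [InnerProductSpace ℝ V] (φ : 𝓢(V, ℂ)) (M k : ℕ) :
    ∃ C, 0 ≤ C ∧ ∀ z x : V, ‖z‖ ≤ 1 →
      ‖secondDiff^[M] (fun r => φ (x + r • z)) 0‖ ≤ C * ‖z‖ ^ (2 * M) * (1 + ‖x‖) ^ (-(k : ℝ)) := by
  obtain ⟨C, hC⟩ : ∃ C, ∀ y : V, (1 + ‖y‖) ^ k * ‖iteratedFDeriv ℝ (2 * M) φ y‖ ≤ C :=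
    ⟨_, fun y => φ.one_add_le_sup_seminorm_apply (𝕜 := ℝ) (m := (k, 2 * M)) le_rfl le_rfl y⟩
  have hC0 : 0 ≤ C := le_trans (by positivity) (hC 0)
  refine ⟨(1 + M) ^ k * C, by positivity, fun z x hz => ?_⟩
  refine norm_iterate_secondDiff_le M ?_ fun r hr => ?_
  · exact (φ.smooth ⊤).comp (contDiff_const.add (contDiff_id.smul contDiff_const))
  · have hlin : ∀ r : ℝ, (fun r : ℝ => φ (x + r • z)) =
        (fun y => φ (x + y)) ∘ (ContinuousLinearMap.toSpanSingleton ℝ z) := by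
      intro r; ext r; simp
    rw [hlin r, ← norm_iteratedFDeriv_eq_norm_iteratedDeriv,
      ContinuousLinearMap.iteratedFDeriv_comp_right (n := (⊤ : ℕ∞)) _
        (show ContDiff ℝ (⊤ : ℕ∞) fun y => φ (x + y) from
          (φ.smooth ⊤).comp (contDiff_const.add contDiff_id)) _
          (WithTop.coe_le_coe.2 le_top),
      iteratedFDeriv_comp_add_left]
    refine (ContinuousMultilinearMap.norm_compContinuousLinearMap_le _ _).trans ?_
    simp only [Finset.prod_const, Finset.card_univ, Fintype.card_fin,
      ContinuousLinearMap.norm_toSpanSingleton, ContinuousLinearMap.toSpanSingleton_apply]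
    set D := ‖iteratedFDeriv ℝ (2 * M) φ (x + r • z)‖
    have h1 : (1 + ‖x‖) ≤ (1 + M) * (1 + ‖x + r • z‖) := by
      have hrz : ‖r • z‖ ≤ M := by
        rw [norm_smul, Real.norm_eq_abs]
        have : |r| ≤ M := by simpa using hr
        nlinarith [abs_nonneg r, norm_nonneg z]
      have : ‖x‖ ≤ ‖x + r • z‖ + ‖r • z‖ := by
        simpa using norm_sub_le (x + r • z) (r • z)
      have hM : (0 : ℝ) ≤ M := by positivity
      nlinarith [norm_nonneg (x + r • z)]
    have h2 : (1 + ‖x‖) ^ k * D ≤ (1 + M) ^ k * C := by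
      calc (1 + ‖x‖) ^ k * D ≤ ((1 + M) * (1 + ‖x + r • z‖)) ^ k * D := by gcongr
        _ = (1 + M) ^ k * ((1 + ‖x + r • z‖) ^ k * D) := by rw [mul_pow, mul_assoc]
        _ ≤ _ := by gcongr; exact hC _
    rw [rpow_neg (by positivity), rpow_natCast, ← div_eq_mul_inv, le_div_iff₀ (by positivity)]
    calc D * ‖z‖ ^ (2 * M) * (1 + ‖x‖) ^ k = (1 + ‖x‖) ^ k * D * ‖z‖ ^ (2 * M) := by ring
      _ ≤ (1 + M) ^ k * C * ‖z‖ ^ (2 * M) := by gcongr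

/-! ### Decay of fractional Laplacians of Schwartz functions -/

section
variable {V : Type*} [NormedAddCommGroup V] [InnerProductSpace ℝ V] [FiniteDimensional ℝ V]
  [MeasurableSpace V] [BorelSpace V]

lemma lintegral_weight_iterate_secondDiff_le {g : V → ℂ} (hg : Continuous g) (z : V) (M : ℕ)
    (s : ℝ) :
    ∫⁻ x, ENNReal.ofReal ((1 + ‖x‖) ^ 2) * ‖secondDiff^[M] (fun r => g (x + r • z)) s‖ₑ ≤
      2 ^ M * ENNReal.ofReal ((1 + (|s| + M) * ‖z‖) ^ 2) *
        ∫⁻ x, ENNReal.ofReal ((1 + ‖x‖) ^ 2) * ‖g x‖ₑ := by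
  have hmeas : ∀ (M : ℕ) (s : ℝ), Measurable fun x =>
      ENNReal.ofReal ((1 + ‖x‖) ^ 2) * ‖secondDiff^[M] (fun r => g (x + r • z)) s‖ₑ := by
    intro M s
    have h1 : Continuous fun x : V => secondDiff^[M] (fun r => g (x + r • z)) s :=
      (continuous_iterate_secondDiff (F := fun (x : V) r => g (x + r • z)) (by fun_prop) M).comp
        (continuous_id.prodMk continuous_const)
    have h0 : Measurable fun x : V => ENNReal.ofReal ((1 + ‖x‖) ^ 2) := by fun_prop
    exact h0.mul h1.measurable.enorm
  induction M generalizing s with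
  | zero =>
    simp only [Function.iterate_zero, id_eq, pow_zero, one_mul, Nat.cast_zero, add_zero]
    refine (lintegral_add_right_eq_self (μ := (volume : Measure V))
      (fun x => ENNReal.ofReal ((1 + ‖x‖) ^ 2) * ‖g (x + s • z)‖ₑ) (-(s • z))).symm.trans_le ?_
    rw [← lintegral_const_mul' _ _ ENNReal.ofReal_ne_top]
    refine lintegral_mono fun x => ?_
    beta_reduce
    rw [neg_add_cancel_right, ← mul_assoc, ← ENNReal.ofReal_mul (by positivity)]
    gcongr
    rw [← mul_pow]
    gcongr
    have h1 : ‖x + -(s • z)‖ ≤ ‖x‖ + |s| * ‖z‖ := by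
      refine (norm_add_le _ _).trans ?_
      rw [norm_neg, norm_smul, Real.norm_eq_abs]
    have : 0 ≤ |s| * ‖z‖ := by positivity
    nlinarith [norm_nonneg x]
  | succ M ih =>
    set I := ∫⁻ x, ENNReal.ofReal ((1 + ‖x‖) ^ 2) * ‖g x‖ₑ
    set a := ENNReal.ofReal ((1 + (|s| + (M + 1 : ℕ)) * ‖z‖) ^ 2)
    have key : ∀ r : ℝ, |r| ≤ |s| + 1 →
        ∫⁻ x, ENNReal.ofReal ((1 + ‖x‖) ^ 2) * ‖secondDiff^[M] (fun r => g (x + r • z)) r‖ₑ ≤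
          2 ^ M * a * I := by
      intro r hr
      refine (ih r).trans ?_
      have h2 : (|r| + M) * ‖z‖ ≤ (|s| + (M + 1 : ℕ)) * ‖z‖ :=
        mul_le_mul_of_nonneg_right (by push_cast; linarith) (norm_nonneg z)
      have h3 : ENNReal.ofReal ((1 + (|r| + M) * ‖z‖) ^ 2) ≤ a :=
        ENNReal.ofReal_le_ofReal (pow_le_pow_left₀ (by positivity) (by linarith) 2)
      gcongr
    simp only [Function.iterate_succ_apply']
    set A : ℝ → V → ENNReal := fun r x =>
      ENNReal.ofReal ((1 + ‖x‖) ^ 2) * ‖secondDiff^[M] (fun r => g (x + r • z)) r‖ₑ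
    have hhalf : ‖(1 / 2 : ℂ)‖ₑ = 2⁻¹ := by
      rw [← ofReal_norm]
      have : ‖(1 / 2 : ℂ)‖ = 2⁻¹ := by norm_num
      rw [this, ENNReal.ofReal_inv_of_pos (by norm_num)]
      norm_num
    calc ∫⁻ x, ENNReal.ofReal ((1 + ‖x‖) ^ 2) *
          ‖secondDiff (secondDiff^[M] (fun r => g (x + r • z))) s‖ₑ
        ≤ ∫⁻ x, (A s x + 2⁻¹ * (A (s + 1) x + A (s - 1) x)) := by
          refine lintegral_mono fun x => ?_
          simp only [secondDiff, A]
          rw [← mul_add, ← mul_assoc, mul_comm (2⁻¹ : ENNReal), mul_assoc, ← mul_add]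
          gcongr
          refine enorm_sub_le.trans ?_
          gcongr
          rw [enorm_mul, hhalf]
          gcongr
          exact enorm_add_le _ _
      _ = (∫⁻ x, A s x) + 2⁻¹ * ((∫⁻ x, A (s + 1) x) + ∫⁻ x, A (s - 1) x) := by
          rw [lintegral_add_left (hmeas M s), lintegral_const_mul' _ _ (by simp),
            lintegral_add_left (hmeas M (s + 1))]
      _ ≤ 2 ^ M * a * I + 2⁻¹ * (2 ^ M * a * I + 2 ^ M * a * I) := by
          gcongr
          · exact key s (by linarith)
          · refine key _ ((abs_add_le _ _).trans (by simp))
          · refine key _ ((abs_sub _ _).trans (by simp))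
      _ = 2 ^ (M + 1) * a * I := by
          rw [← two_mul (2 ^ M * a * I), ← mul_assoc (2⁻¹ : ENNReal),
            ENNReal.inv_mul_cancel (by norm_num) (by norm_num), one_mul, pow_succ]
          ring

lemma integrable_one_sub_cos_pow_div (hd : 1 ≤ Module.finrank ℝ V) (ξ : V) :
    Integrable fun z : V => (1 - cos (2 * π * inner ℝ z ξ)) ^ (Module.finrank ℝ V) *
      (‖z‖ ^ (2 * Module.finrank ℝ V))⁻¹ := by
  set d := Module.finrank ℝ V
  have hI : Integrable (fun z : V => (1 + ‖z‖) ^ (-(2 * d : ℝ))) :=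
    integrable_one_add_norm (by have : (1 : ℝ) ≤ d := by exact_mod_cast hd
                                linarith)
  set C := (2 * π ^ 2 * ‖ξ‖ ^ 2 + 2) ^ d * 2 ^ (2 * d)
  refine (hI.const_mul C).mono' (Measurable.aestronglyMeasurable (by fun_prop))
    (Eventually.of_forall fun z => ?_)
  have h0 : 0 ≤ 1 - cos (2 * π * inner ℝ z ξ) := by linarith [cos_le_one (2 * π * inner ℝ z ξ)]
  rw [Real.norm_eq_abs, abs_of_nonneg (by positivity)]
  have hC0 : 0 ≤ C := by positivity
  have e : (2 * d : ℝ) = ((2 * d : ℕ) : ℝ) := by push_cast; ring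
  rw [e, rpow_neg (by positivity), rpow_natCast]
  rcases eq_or_ne z 0 with rfl | hz
  · have : 2 * d ≠ 0 := by omega
    simp only [norm_zero, ne_eq, this, not_false_eq_true, zero_pow, inv_zero, mul_zero]
    positivity
  have hz0 : 0 < ‖z‖ := norm_pos_iff.2 hz
  rw [← div_eq_mul_inv, ← div_eq_mul_inv, div_le_div_iff₀ (by positivity) (by positivity),
    pow_mul (1 + ‖z‖), ← mul_pow, pow_mul ‖z‖, show C = (2 * π ^ 2 * ‖ξ‖ ^ 2 + 2) ^ d * 2 ^ (2 * d)
    from rfl, pow_mul 2, ← mul_pow, ← mul_pow, mul_assoc (2 * π ^ 2 * ‖ξ‖ ^ 2 + 2)]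
  refine pow_le_pow_left₀ (by positivity) ?_ d
  rcases le_total ‖z‖ 1 with h1 | h1
  · have hc : 1 - cos (2 * π * inner ℝ z ξ) ≤ (2 * π ^ 2 * ‖ξ‖ ^ 2) * ‖z‖ ^ 2 := by
      have h := one_sub_sq_div_two_le_cos (x := 2 * π * inner ℝ z ξ)
      have h2 : (inner ℝ z ξ) ^ 2 ≤ ‖z‖ ^ 2 * ‖ξ‖ ^ 2 := by
        rw [← mul_pow, ← sq_abs]
        exact pow_le_pow_left₀ (abs_nonneg _) (abs_real_inner_le_norm z ξ) 2
      nlinarith [sq_nonneg π]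
    calc (1 - cos (2 * π * inner ℝ z ξ)) * (1 + ‖z‖) ^ 2
        ≤ (2 * π ^ 2 * ‖ξ‖ ^ 2) * ‖z‖ ^ 2 * 2 ^ 2 := by gcongr; linarith
      _ ≤ (2 * π ^ 2 * ‖ξ‖ ^ 2 + 2) * (2 ^ 2 * ‖z‖ ^ 2) := by nlinarith [sq_nonneg ‖z‖]
  · have hc : 1 - cos (2 * π * inner ℝ z ξ) ≤ 2 := by
      linarith [neg_one_le_cos (2 * π * inner ℝ z ξ)]
    calc (1 - cos (2 * π * inner ℝ z ξ)) * (1 + ‖z‖) ^ 2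
        ≤ 2 * (2 * ‖z‖) ^ 2 := by gcongr; linarith
      _ ≤ (2 * π ^ 2 * ‖ξ‖ ^ 2 + 2) * (2 ^ 2 * ‖z‖ ^ 2) := by
        have : 0 ≤ 2 * π ^ 2 * ‖ξ‖ ^ 2 * (2 ^ 2 * ‖z‖ ^ 2) := by positivity
        nlinarith [sq_nonneg ‖z‖]

/-- `‖ξ‖ ^ d` is a superposition of the multipliers `(1 - cos (2π⟪z, ξ⟫)) ^ d` of iterated second
differences, by homogeneity and rotation invariance. -/
lemma exists_integral_one_sub_cos_pow_eq (hd : 1 ≤ Module.finrank ℝ V) :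
    ∃ c : ℝ, 0 < c ∧ ∀ ξ : V, ∫ z : V, (1 - cos (2 * π * inner ℝ z ξ)) ^ (Module.finrank ℝ V) *
      (‖z‖ ^ (2 * Module.finrank ℝ V))⁻¹ = c * ‖ξ‖ ^ (Module.finrank ℝ V) := by
  set d := Module.finrank ℝ V with hd_def
  set J : V → ℝ := fun ξ => ∫ z : V, (1 - cos (2 * π * inner ℝ z ξ)) ^ d * (‖z‖ ^ (2 * d))⁻¹
  have : Nontrivial V := Module.finrank_pos_iff.1 hd
  obtain ⟨e, he⟩ : ∃ e : V, ‖e‖ = 1 := exists_norm_eq V zero_le_one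
  have hrot : ∀ ξ η : V, ‖ξ‖ = ‖η‖ → J ξ = J η := by
    intro ξ η h
    let R := (ℝ ∙ (ξ - η))ᗮ.reflection
    have hR : R ξ = η := Submodule.reflection_sub h
    rw [← hR]
    have := R.measurePreserving.integral_comp R.toHomeomorph.measurableEmbedding
      (fun z => (1 - cos (2 * π * inner ℝ z (R ξ))) ^ d * (‖z‖ ^ (2 * d))⁻¹)
    simpa using this
  have hscale : ∀ t : ℝ, 0 < t → J (t • e) = t ^ d * J e := by
    intro t ht
    have := Measure.integral_comp_smul (volume : Measure V)
      (fun z : V => (1 - cos (2 * π * inner ℝ z e)) ^ d * (‖z‖ ^ (2 * d))⁻¹) t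
    simp only [J]
    rw [← hd_def, abs_of_pos (by positivity), smul_eq_mul] at this
    have h2 : ∀ z : V, (1 - cos (2 * π * inner ℝ z (t • e))) ^ d * (‖z‖ ^ (2 * d))⁻¹ =
        t ^ (2 * d) * ((1 - cos (2 * π * inner ℝ (t • z) e)) ^ d * (‖t • z‖ ^ (2 * d))⁻¹) := by
      intro z
      rw [inner_smul_right, inner_smul_left, norm_smul, Real.norm_eq_abs, abs_of_pos ht, mul_pow,
        mul_inv]
      simp only [conj_trivial]
      field_simp
    simp_rw [h2]
    rw [integral_const_mul, this, ← mul_assoc]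
    congr 1
    rw [two_mul, pow_add]
    field_simp
  have hnn : ∀ z : V, 0 ≤ (1 - cos (2 * π * inner ℝ z e)) ^ d * (‖z‖ ^ (2 * d))⁻¹ := by
    intro z
    have : 0 ≤ 1 - cos (2 * π * inner ℝ z e) := by linarith [cos_le_one (2 * π * inner ℝ z e)]
    positivity
  refine ⟨J e, ?_, fun ξ => ?_⟩
  · refine (integral_pos_iff_support_of_nonneg hnn (integrable_one_sub_cos_pow_div hd e)).2 ?_
    have hU : IsOpen {z : V | cos (2 * π * inner ℝ z e) < 1 ∧ z ≠ 0} :=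
      (isOpen_lt (f := fun z : V => cos (2 * π * inner ℝ z e)) (by fun_prop)
        continuous_const).inter (isOpen_ne (x := (0 : V)))
    refine (hU.measure_pos volume ⟨(1 / 2 : ℝ) • e, ?_, ?_⟩).trans_le (measure_mono ?_)
    · rw [inner_smul_left, real_inner_self_eq_norm_sq, he]
      have : 2 * π * ((starRingEnd ℝ) (1 / 2) * 1 ^ 2) = π := by simp; ring
      rw [this, cos_pi]; norm_num
    · refine smul_ne_zero (by norm_num) (norm_ne_zero_iff.1 (by rw [he]; norm_num))
    · rintro z ⟨hz, hz0⟩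
      have h1 : 0 < 1 - cos (2 * π * inner ℝ z e) := by linarith
      have h2 : 0 < ‖z‖ := norm_pos_iff.2 hz0
      rw [Function.mem_support]
      positivity
  · rcases eq_or_ne ξ 0 with rfl | hξ
    · have : d ≠ 0 := by omega
      simp [this]
    · change J ξ = _
      rw [hrot ξ (‖ξ‖ • e) (by simp [norm_smul, he]), hscale _ (norm_pos_iff.2 hξ), mul_comm]

lemma integrable_norm_pow_mul_fourier (φ : 𝓢(V, ℂ)) (k : ℕ) :
    Integrable fun ξ => (‖ξ‖ ^ k : ℝ) * 𝓕 (φ : V → ℂ) ξ := by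
  have h := (𝓕 φ).integrable_pow_mul volume k
  rw [← integrable_norm_iff]
  · refine h.congr (Eventually.of_forall fun ξ => ?_)
    simp [SchwartzMap.fourier_coe]
  · have h1 : Continuous (𝓕 (φ : V → ℂ)) := by
      rw [← SchwartzMap.fourier_coe]; exact (𝓕 φ).continuous
    have : Continuous fun ξ : V => ((‖ξ‖ ^ k : ℝ) : ℂ) := by fun_prop
    exact (this.mul h1).aestronglyMeasurable

/-- `(-Δ)^{d/2} φ` is a superposition of iterated second differences of `φ`. -/
lemma exists_fourierInv_norm_pow_eq (hd : 1 ≤ Module.finrank ℝ V) (φ : 𝓢(V, ℂ)) :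
    ∃ c : ℝ, 0 < c ∧ ∀ x : V,
      𝓕⁻ (fun ξ => ((‖ξ‖ ^ (Module.finrank ℝ V) : ℝ) : ℂ) * 𝓕 (φ : V → ℂ) ξ) x =
        (c⁻¹ : ℝ) * ∫ z : V, (((‖z‖ ^ (2 * Module.finrank ℝ V))⁻¹ : ℝ) : ℂ) *
          secondDiff^[Module.finrank ℝ V] (fun r => φ (x + r • z)) 0 := by
  obtain ⟨c, hc, hJ⟩ := exists_integral_one_sub_cos_pow_eq (V := V) hd
  refine ⟨c, hc, fun x => ?_⟩
  set d := Module.finrank ℝ V with hd_def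
  have hFi : Integrable (𝓕 (φ : V → ℂ)) := by
    rw [← SchwartzMap.fourier_coe]; exact (𝓕 φ).integrable
  have hinv : 𝓕⁻ (𝓕 (φ : V → ℂ)) = φ :=
    φ.continuous.fourierInv_fourier_eq φ.integrable hFi
  have h1 : ∀ z, secondDiff^[d] (fun r => φ (x + r • z)) 0 =
      𝓕⁻ (fun ξ => ((1 - cos (2 * π * inner ℝ z ξ) : ℝ) : ℂ) ^ d * 𝓕 (φ : V → ℂ) ξ) x := by
    intro z
    have := fourierInv_one_sub_cos_pow_mul hFi z d x 0
    rw [hinv, zero_smul, add_zero] at this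
    exact this.symm
  simp_rw [h1]
  simp only [Real.fourierInv_eq', smul_eq_mul]
  set F : V → V → ℂ := fun z ξ => Complex.exp (↑(2 * π * inner ℝ ξ x) * Complex.I) *
    (((1 - cos (2 * π * inner ℝ z ξ)) ^ d * (‖z‖ ^ (2 * d))⁻¹ : ℝ) * 𝓕 (φ : V → ℂ) ξ) with hF
  have hnorm : ∀ z ξ, ‖F z ξ‖ = (1 - cos (2 * π * inner ℝ z ξ)) ^ d * (‖z‖ ^ (2 * d))⁻¹ *
      ‖𝓕 (φ : V → ℂ) ξ‖ := by
    intro z ξ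
    have : 0 ≤ 1 - cos (2 * π * inner ℝ z ξ) := by linarith [cos_le_one (2 * π * inner ℝ z ξ)]
    simp only [hF]
    rw [norm_mul, Complex.norm_exp_ofReal_mul_I, one_mul, norm_mul, Complex.norm_real,
      Real.norm_eq_abs, abs_of_nonneg (by positivity)]
  have hmeas : Measurable (𝓕 (φ : V → ℂ)) := by
    rw [← SchwartzMap.fourier_coe]; exact (𝓕 φ).continuous.measurable
  have hint : Integrable (Function.uncurry F) ((volume : Measure V).prod volume) := by
    rw [integrable_prod_iff']
    · constructor
      · refine Eventually.of_forall fun ξ => ?_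
        simp only [Function.uncurry, hF]
        exact ((integrable_one_sub_cos_pow_div hd ξ).ofReal.mul_const _).const_mul _
      · simp only [Function.uncurry, hnorm]
        simp_rw [integral_mul_const, hJ]
        have := (integrable_norm_pow_mul_fourier φ d).norm.const_mul c
        refine this.congr (Eventually.of_forall fun ξ => ?_)
        simp [mul_assoc]
    · refine Measurable.aestronglyMeasurable ?_
      simp only [hF, Function.uncurry_def]
      fun_prop
  have hswap := integral_integral_swap hint
  have hL : ∫ ξ, ∫ z, F z ξ = c * ∫ ξ, Complex.exp (↑(2 * π * inner ℝ ξ x) * Complex.I) *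
      (((‖ξ‖ ^ d : ℝ) : ℂ) * 𝓕 (φ : V → ℂ) ξ) := by
    rw [← integral_const_mul]
    refine integral_congr_ae (Eventually.of_forall fun ξ => ?_)
    simp only [hF]
    rw [integral_const_mul, integral_mul_const, integral_complex_ofReal, hJ]
    push_cast
    ring
  have hR : ∀ z, ∫ ξ, F z ξ = (((‖z‖ ^ (2 * d))⁻¹ : ℝ) : ℂ) *
      ∫ ξ, Complex.exp (↑(2 * π * inner ℝ ξ x) * Complex.I) *
        (((1 - cos (2 * π * inner ℝ z ξ) : ℝ) : ℂ) ^ d * 𝓕 (φ : V → ℂ) ξ) := by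
    intro z
    rw [← integral_const_mul]
    refine integral_congr_ae (Eventually.of_forall fun ξ => ?_)
    simp only [hF]
    push_cast
    ring
  simp_rw [hR] at hswap
  rw [hswap, hL, ← mul_assoc, ← Complex.ofReal_mul, inv_mul_cancel₀ hc.ne', Complex.ofReal_one,
    one_mul]

/-- `(-Δ)^{d/2} φ` has finite second moment when `d ≥ 3`. -/
lemma integrable_weight_mul_fourierInv_norm_pow (hd : 3 ≤ Module.finrank ℝ V) (φ : 𝓢(V, ℂ)) :
    Integrable fun x : V => (((1 + ‖x‖) ^ 2 : ℝ) : ℂ) *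
      𝓕⁻ (fun ξ => ((‖ξ‖ ^ (Module.finrank ℝ V) : ℝ) : ℂ) * 𝓕 (φ : V → ℂ) ξ) x := by
  obtain ⟨c, hc, hrep⟩ := exists_fourierInv_norm_pow_eq (by omega) φ
  set d := Module.finrank ℝ V with hd_def
  set ψ := 𝓕⁻ (fun ξ => ((‖ξ‖ ^ d : ℝ) : ℂ) * 𝓕 (φ : V → ℂ) ξ) with hψ
  have hψc : Continuous ψ := by
    have h := integrable_norm_pow_mul_fourier φ d
    exact VectorFourier.fourierIntegral_continuous Real.continuous_fourierChar
      (L := -innerₗ V) (by exact continuous_inner.neg) h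
  have hwc : Continuous fun x : V => (((1 + ‖x‖) ^ 2 : ℝ) : ℂ) := by fun_prop
  refine ⟨(hwc.mul hψc).aestronglyMeasurable, ?_⟩
  set D : V → V → ℂ := fun z x => secondDiff^[d] (fun r => φ (x + r • z)) 0 with hD
  have hDc : Continuous fun p : V × V => D p.1 p.2 :=
    (continuous_iterate_secondDiff (X := V × V) (F := fun p r => φ (p.2 + r • p.1))
      (by have := φ.continuous; fun_prop) d).comp (continuous_id.prodMk continuous_const)
  have hbound : ∀ x, ‖(((1 + ‖x‖) ^ 2 : ℝ) : ℂ) * ψ x‖ₑ ≤ ENNReal.ofReal c⁻¹ *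
      ∫⁻ z, ENNReal.ofReal ((‖z‖ ^ (2 * d))⁻¹) * (ENNReal.ofReal ((1 + ‖x‖) ^ 2) * ‖D z x‖ₑ) := by
    intro x
    have e1 : ∀ a : ℝ, 0 ≤ a → ‖(a : ℂ)‖ₑ = ENNReal.ofReal a := by
      intro a ha
      rw [← ofReal_norm, Complex.norm_real, Real.norm_of_nonneg ha]
    rw [hrep x, enorm_mul, enorm_mul, e1 _ (by positivity), e1 _ (by positivity), ← mul_assoc,
      mul_comm (ENNReal.ofReal _), mul_assoc]
    gcongr
    refine (mul_le_mul_right (enorm_integral_le_lintegral_enorm _) _).trans ?_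
    rw [← lintegral_const_mul' _ _ ENNReal.ofReal_ne_top]
    refine lintegral_mono fun z => le_of_eq ?_
    rw [enorm_mul, e1 _ (by positivity)]
    ring
  obtain ⟨C, hC0, hC⟩ := exists_norm_iterate_secondDiff_le φ d (d + 3)
  set N := ∫⁻ x, ENNReal.ofReal ((1 + ‖x‖) ^ 2) * ‖φ x‖ₑ with hN
  have hNfin : N < ⊤ := by
    have h := (φ.integrable_pow_mul volume 0).add (φ.integrable_pow_mul volume 2)
    have h' := (h.const_mul 2).hasFiniteIntegral
    refine lt_of_le_of_lt (lintegral_mono fun x => ?_) h'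
    rw [← ofReal_norm, ← ofReal_norm, ← ENNReal.ofReal_mul (by positivity)]
    refine ENNReal.ofReal_le_ofReal ?_
    simp only [Pi.add_apply, pow_zero, one_mul]
    refine le_trans ?_ (le_abs_self _)
    have : (1 + ‖x‖) ^ 2 ≤ 2 * (1 + ‖x‖ ^ 2) := by nlinarith [sq_nonneg (1 - ‖x‖)]
    calc (1 + ‖x‖) ^ 2 * ‖φ x‖ ≤ 2 * (1 + ‖x‖ ^ 2) * ‖φ x‖ := by gcongr
      _ = _ := by ring
  set Q := ∫⁻ x : V, ENNReal.ofReal ((1 + ‖x‖) ^ (-((d + 1 : ℕ) : ℝ))) with hQ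
  have hQfin : Q < ⊤ := by
    have : Integrable (fun x : V => (1 + ‖x‖) ^ (-((d + 1 : ℕ) : ℝ))) :=
      integrable_one_add_norm (by push_cast; linarith)
    have h' := this.hasFiniteIntegral
    refine lt_of_le_of_lt (lintegral_mono fun x => ?_) h'
    rw [← ofReal_norm]
    exact ENNReal.ofReal_le_ofReal (le_abs_self _)
  set P := ∫⁻ x : V, ENNReal.ofReal ((1 + ‖x‖) ^ (-((2 * d - 2 : ℕ) : ℝ))) with hP
  have hPfin : P < ⊤ := by
    have : Integrable (fun x : V => (1 + ‖x‖) ^ (-((2 * d - 2 : ℕ) : ℝ))) :=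
      integrable_one_add_norm (by rw [← hd_def]; exact_mod_cast (by omega))
    have h' := this.hasFiniteIntegral
    refine lt_of_le_of_lt (lintegral_mono fun x => ?_) h'
    rw [← ofReal_norm]
    exact ENNReal.ofReal_le_ofReal (le_abs_self _)
  -- Small steps use the gain of a power of the step, large steps only the moments of `φ`.
  have hz : ∀ z : V, ENNReal.ofReal ((‖z‖ ^ (2 * d))⁻¹) *
      ∫⁻ x, ENNReal.ofReal ((1 + ‖x‖) ^ 2) * ‖D z x‖ₑ ≤
      (ENNReal.ofReal (C * 2 ^ (2 * d - 2)) * Q +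
        2 ^ d * ENNReal.ofReal ((1 + d) ^ 2 * 2 ^ (2 * d - 2)) * N) *
        ENNReal.ofReal ((1 + ‖z‖) ^ (-((2 * d - 2 : ℕ) : ℝ))) := by
    intro z
    rw [rpow_neg (by positivity), rpow_natCast]
    rcases le_total ‖z‖ 1 with h1 | h1
    · have : ∫⁻ x, ENNReal.ofReal ((1 + ‖x‖) ^ 2) * ‖D z x‖ₑ ≤
          ENNReal.ofReal (C * ‖z‖ ^ (2 * d)) * Q := by
        rw [← lintegral_const_mul' _ _ ENNReal.ofReal_ne_top]
        refine lintegral_mono fun x => ?_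
        rw [← ofReal_norm, ← ENNReal.ofReal_mul (by positivity),
          ← ENNReal.ofReal_mul (by positivity)]
        refine ENNReal.ofReal_le_ofReal ?_
        refine (mul_le_mul_of_nonneg_left (hC z x h1) (by positivity)).trans (le_of_eq ?_)
        have : (1 + ‖x‖) ^ (-((d + 1 : ℕ) : ℝ)) =
            (1 + ‖x‖) ^ 2 * (1 + ‖x‖) ^ (-((d + 3 : ℕ) : ℝ)) := by
          rw [← rpow_natCast (1 + ‖x‖) 2, ← rpow_add (by positivity)]
          congr 1; push_cast; ring
        rw [this]; ring
      refine (mul_le_mul_right this _).trans ?_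
      rw [← mul_assoc, ← ENNReal.ofReal_mul (by positivity), add_mul]
      refine le_trans ?_ le_self_add
      rw [mul_right_comm, ← ENNReal.ofReal_mul (by positivity)]
      refine mul_le_mul_left (ENNReal.ofReal_le_ofReal ?_) _
      have h2 : (1 + ‖z‖) ^ (2 * d - 2) ≤ 2 ^ (2 * d - 2) := by gcongr; linarith
      calc (‖z‖ ^ (2 * d))⁻¹ * (C * ‖z‖ ^ (2 * d)) = C * ((‖z‖ ^ (2 * d))⁻¹ * ‖z‖ ^ (2 * d)) := by
            ring
        _ ≤ C * 1 := by gcongr; exact inv_mul_le_one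
        _ ≤ C * (2 ^ (2 * d - 2) * ((1 + ‖z‖) ^ (2 * d - 2))⁻¹) := by
            gcongr
            rw [← div_eq_mul_inv, one_le_div (by positivity)]; exact h2
        _ = _ := by ring
    · have := lintegral_weight_iterate_secondDiff_le φ.continuous z d 0
      refine (mul_le_mul_right this _).trans ?_
      rw [abs_zero, zero_add, add_mul]
      refine le_trans ?_ le_add_self
      rw [← hN]
      have hz0 : 0 < ‖z‖ := by linarith
      have hd2 : 2 * d = (2 * d - 2) + 2 := by omega
      have key : (‖z‖ ^ (2 * d))⁻¹ * (1 + d * ‖z‖) ^ 2 ≤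
          ((1 + d) ^ 2 * 2 ^ (2 * d - 2)) * ((1 + ‖z‖) ^ (2 * d - 2))⁻¹ := by
        have a1 : (1 + d * ‖z‖) ^ 2 ≤ (1 + d) ^ 2 * ‖z‖ ^ 2 := by
          rw [← mul_pow]; gcongr; nlinarith
        have a2 : (1 + ‖z‖) ^ (2 * d - 2) ≤ 2 ^ (2 * d - 2) * ‖z‖ ^ (2 * d - 2) := by
          rw [← mul_pow]; gcongr; linarith
        rw [← div_eq_inv_mul, ← div_eq_mul_inv, div_le_div_iff₀ (by positivity) (by positivity)]
        calc (1 + d * ‖z‖) ^ 2 * (1 + ‖z‖) ^ (2 * d - 2)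
            ≤ ((1 + d) ^ 2 * ‖z‖ ^ 2) * (2 ^ (2 * d - 2) * ‖z‖ ^ (2 * d - 2)) := by gcongr
          _ = (1 + d) ^ 2 * 2 ^ (2 * d - 2) * ‖z‖ ^ (2 * d) := by
            conv_rhs => rw [hd2, pow_add]
            simp only [Nat.add_sub_cancel]
            ring
      calc ENNReal.ofReal ((‖z‖ ^ (2 * d))⁻¹) * (2 ^ d * ENNReal.ofReal ((1 + d * ‖z‖) ^ 2) * N)
          = 2 ^ d * (ENNReal.ofReal ((‖z‖ ^ (2 * d))⁻¹ * (1 + d * ‖z‖) ^ 2)) * N := by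
            rw [ENNReal.ofReal_mul (by positivity)]; ring
        _ ≤ 2 ^ d * (ENNReal.ofReal (((1 + d) ^ 2 * 2 ^ (2 * d - 2)) *
              ((1 + ‖z‖) ^ (2 * d - 2))⁻¹)) * N := by gcongr
        _ = _ := by
            rw [ENNReal.ofReal_mul (by positivity)]; ring
  have hDm := hDc.measurable
  calc ∫⁻ x, ‖(((1 + ‖x‖) ^ 2 : ℝ) : ℂ) * ψ x‖ₑ
      ≤ ∫⁻ x, ENNReal.ofReal c⁻¹ * ∫⁻ z, ENNReal.ofReal ((‖z‖ ^ (2 * d))⁻¹) *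
          (ENNReal.ofReal ((1 + ‖x‖) ^ 2) * ‖D z x‖ₑ) := lintegral_mono hbound
    _ = ENNReal.ofReal c⁻¹ * ∫⁻ z, ENNReal.ofReal ((‖z‖ ^ (2 * d))⁻¹) *
          ∫⁻ x, ENNReal.ofReal ((1 + ‖x‖) ^ 2) * ‖D z x‖ₑ := by
        rw [lintegral_const_mul' _ _ ENNReal.ofReal_ne_top, lintegral_lintegral_swap]
        · congr 1
          refine lintegral_congr fun z => ?_
          rw [lintegral_const_mul' _ _ ENNReal.ofReal_ne_top]
        · refine Measurable.aemeasurable ?_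
          have : Measurable fun p : V × V => D p.2 p.1 := hDm.comp measurable_swap
          simp only [Function.uncurry_def]
          fun_prop
    _ ≤ ENNReal.ofReal c⁻¹ * ((ENNReal.ofReal (C * 2 ^ (2 * d - 2)) * Q +
        2 ^ d * ENNReal.ofReal ((1 + d) ^ 2 * 2 ^ (2 * d - 2)) * N) * P) := by
        refine mul_le_mul_right ?_ _
        rw [hP, ← lintegral_const_mul _ (by fun_prop)]
        exact lintegral_mono hz
    _ < ⊤ := by
        refine ENNReal.mul_lt_top ENNReal.ofReal_lt_top (ENNReal.mul_lt_top ?_ hPfin)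
        refine ENNReal.add_lt_top.2 ⟨ENNReal.mul_lt_top ENNReal.ofReal_lt_top hQfin, ?_⟩
        refine ENNReal.mul_lt_top (ENNReal.mul_lt_top ?_ ENNReal.ofReal_lt_top) hNfin
        exact ENNReal.pow_lt_top (by simp)

end

/-! ### Gaussian pairings and vanishing moments -/

section
variable {V : Type*} [NormedAddCommGroup V] [InnerProductSpace ℝ V] [FiniteDimensional ℝ V]
  [MeasurableSpace V] [BorelSpace V]

/-- Pairing a Gaussian with an inverse Fourier transform, evaluated on the Fourier side. -/
lemma integral_gaussian_mul_fourierInv {h : V → ℂ} (hh : Integrable h) {b : ℝ} (hb : 0 < b)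
    (y : V) :
    ∫ x, ((rexp (-b * ‖x - y‖ ^ 2) : ℝ) : ℂ) * 𝓕⁻ h x =
      ∫ ξ, (((π / b) ^ (Module.finrank ℝ V / 2 : ℝ) * rexp (-(π ^ 2 / b) * ‖ξ‖ ^ 2) : ℝ) : ℂ) *
        (Complex.exp (↑(2 * π * inner ℝ ξ y) * Complex.I) * h ξ) := by
  have hgi : Integrable fun x : V => ((rexp (-b * ‖x - y‖ ^ 2) : ℝ) : ℂ) := by
    have := (GaussianFourier.integrable_cexp_neg_mul_sq_norm_add (b := (b : ℂ)) (by simpa) 0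
      (0 : V)).comp_sub_right y
    refine this.congr (Eventually.of_forall fun x => ?_)
    push_cast
    simp
  have hg : ∀ ξ : V, ∫ x, Complex.exp (↑(2 * π * inner ℝ ξ x) * Complex.I) *
      ((rexp (-b * ‖x - y‖ ^ 2) : ℝ) : ℂ) =
      (((π / b) ^ (Module.finrank ℝ V / 2 : ℝ) * rexp (-(π ^ 2 / b) * ‖ξ‖ ^ 2) : ℝ) : ℂ) *
        Complex.exp (↑(2 * π * inner ℝ ξ y) * Complex.I) := by
    intro ξ
    rw [← integral_add_right_eq_self (μ := (volume : Measure V)) _ y]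
    have h1 : ∀ x : V, Complex.exp (↑(2 * π * inner ℝ ξ (x + y)) * Complex.I) *
        ((rexp (-b * ‖x + y - y‖ ^ 2) : ℝ) : ℂ) =
        Complex.exp (↑(2 * π * inner ℝ ξ y) * Complex.I) *
          Complex.exp (-(b : ℂ) * (‖x‖ : ℂ) ^ 2 + (2 * π * Complex.I) * (inner ℝ ξ x : ℝ)) := by
      intro x
      rw [add_sub_cancel_right, inner_add_right]
      push_cast
      rw [← Complex.exp_add, ← Complex.exp_add]
      congr 1
      ring
    simp_rw [h1]
    rw [integral_const_mul, GaussianFourier.integral_cexp_neg_mul_sq_norm_add (by simpa), mul_comm]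
    congr 1
    rw [Complex.ofReal_mul, Complex.ofReal_cpow (by positivity)]
    push_cast
    congr 2
    rw [mul_pow, Complex.I_sq]
    have : (b : ℂ) ≠ 0 := by exact_mod_cast hb.ne'
    field_simp
    ring
  have hflip := VectorFourier.integral_fourierIntegral_smul_eq_flip (L := -innerₗ V)
    (μ := volume) (ν := volume) Real.continuous_fourierChar (by exact continuous_inner.neg) hh hgi
  have e1 : ∫ x, ((rexp (-b * ‖x - y‖ ^ 2) : ℝ) : ℂ) * 𝓕⁻ h x =
      ∫ x, VectorFourier.fourierIntegral Real.fourierChar volume (-innerₗ V) h x •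
        ((rexp (-b * ‖x - y‖ ^ 2) : ℝ) : ℂ) := by
    refine integral_congr_ae (Eventually.of_forall fun x => ?_)
    simp only [smul_eq_mul]
    rw [mul_comm]
    rfl
  rw [e1, hflip]
  refine integral_congr_ae (Eventually.of_forall fun ξ => ?_)
  have e2 : VectorFourier.fourierIntegral Real.fourierChar volume (-innerₗ V).flip
      (fun x : V => ((rexp (-b * ‖x - y‖ ^ 2) : ℝ) : ℂ)) ξ =
      ∫ x, Complex.exp (↑(2 * π * inner ℝ ξ x) * Complex.I) *
      ((rexp (-b * ‖x - y‖ ^ 2) : ℝ) : ℂ) := by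
    refine integral_congr_ae (Eventually.of_forall fun x => ?_)
    simp [Circle.smul_def, Real.fourierChar_apply]
  simp only [smul_eq_mul]
  rw [e2, hg]
  ring

lemma norm_pow_mul_exp_le (d : ℕ) {b r : ℝ} (hb : 0 < b) (hr : 0 ≤ r) :
    r ^ d * rexp (-(π ^ 2 / b) * r ^ 2) ≤
      √(d.factorial) * (b / π ^ 2) ^ (d / 2 : ℝ) * rexp (-(π ^ 2 / (2 * b)) * r ^ 2) := by
  set t := π ^ 2 / b * r ^ 2 with ht
  have ht0 : 0 ≤ t := by positivity
  have h1 : t ^ d ≤ d.factorial * rexp t := by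
    have := Real.pow_div_factorial_le_exp t ht0 d
    rwa [div_le_iff₀ (by positivity), mul_comm] at this
  have h2 : r ^ d = (b / π ^ 2) ^ (d / 2 : ℝ) * √(t ^ d) := by
    have e : √(t ^ d) = t ^ (d / 2 : ℝ) := by
      rw [Real.sqrt_eq_rpow, ← rpow_natCast, ← rpow_mul ht0]
      congr 1; ring
    rw [e, ← mul_rpow (by positivity) ht0]
    have : b / π ^ 2 * t = r ^ 2 := by rw [ht]; field_simp
    rw [this, ← rpow_natCast r 2, ← rpow_mul hr, ← rpow_natCast]
    congr 1; push_cast; ring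
  have h3 : √(t ^ d) ≤ √(d.factorial) * rexp (t / 2) := by
    rw [Real.exp_half, ← Real.sqrt_mul (by positivity)]
    exact Real.sqrt_le_sqrt h1
  have e4 : -(π ^ 2 / b) * r ^ 2 = -t := by rw [ht]; ring
  have e5 : -(π ^ 2 / (2 * b)) * r ^ 2 = -t / 2 := by rw [ht]; field_simp
  rw [h2, e4, e5]
  calc (b / π ^ 2) ^ (d / 2 : ℝ) * √(t ^ d) * rexp (-t)
      ≤ (b / π ^ 2) ^ (d / 2 : ℝ) * (√(d.factorial) * rexp (t / 2)) * rexp (-t) := by gcongr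
    _ = √(d.factorial) * (b / π ^ 2) ^ (d / 2 : ℝ) * (rexp (t / 2) * rexp (-t)) := by ring
    _ = _ := by rw [← Real.exp_add]; congr 2; ring

/-- The Gaussian average of `(-Δ)^{d/2} φ` at scale `b^{-1/2}` decays like `b^{d/2}` as `b → 0`. -/
lemma exists_norm_integral_gaussian_le (φ : 𝓢(V, ℂ)) :
    ∃ C : ℝ, ∀ b : ℝ, 0 < b →
      ‖∫ x, ((rexp (-b * ‖x‖ ^ 2) : ℝ) : ℂ) *
        𝓕⁻ (fun ξ => ((‖ξ‖ ^ (Module.finrank ℝ V) : ℝ) : ℂ) * 𝓕 (φ : V → ℂ) ξ) x‖ ≤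
        C * b ^ (Module.finrank ℝ V / 2 : ℝ) := by
  set d := Module.finrank ℝ V with hd_def
  obtain ⟨B, hB⟩ : ∃ B, ∀ ξ : V, ‖𝓕 (φ : V → ℂ) ξ‖ ≤ B := by
    refine ⟨SchwartzMap.seminorm ℝ 0 0 (𝓕 φ), fun ξ => ?_⟩
    rw [← SchwartzMap.fourier_coe]
    exact (𝓕 φ).norm_le_seminorm ℝ ξ
  have hB0 : 0 ≤ B := (norm_nonneg _).trans (hB 0)
  refine ⟨√(d.factorial) * (1 / π ^ 2) ^ (d / 2 : ℝ) * B * 2 ^ (d / 2 : ℝ), fun b hb => ?_⟩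
  have h1 := integral_gaussian_mul_fourierInv (integrable_norm_pow_mul_fourier φ d) hb 0
  simp only [sub_zero, inner_zero_right, mul_zero, Complex.ofReal_zero, zero_mul, Complex.exp_zero,
    one_mul] at h1
  rw [h1, ← hd_def]
  have hG : Integrable fun ξ : V => rexp (-(π ^ 2 / (2 * b)) * ‖ξ‖ ^ 2) := by
    have := (GaussianFourier.integrable_cexp_neg_mul_sq_norm_add
      (b := ((π ^ 2 / (2 * b) : ℝ) : ℂ)) (by simp only [Complex.ofReal_re]; positivity) 0
      (0 : V)).norm
    refine this.congr (Eventually.of_forall fun x => ?_)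
    simp only [zero_mul, add_zero, Complex.norm_exp]
    congr 1
    rw [← Complex.ofReal_pow, ← Complex.ofReal_neg, ← Complex.ofReal_mul, Complex.ofReal_re]
  set K := (π / b) ^ (d / 2 : ℝ) * (√(d.factorial) * (b / π ^ 2) ^ (d / 2 : ℝ)) * B
  have h2 : ‖∫ ξ : V, (((π / b) ^ (d / 2 : ℝ) * rexp (-(π ^ 2 / b) * ‖ξ‖ ^ 2) : ℝ) : ℂ) *
      (((‖ξ‖ ^ d : ℝ) : ℂ) * 𝓕 (φ : V → ℂ) ξ)‖ ≤
      ∫ ξ : V, K * rexp (-(π ^ 2 / (2 * b)) * ‖ξ‖ ^ 2) := by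
    refine norm_integral_le_of_norm_le (hG.const_mul K) (Eventually.of_forall fun ξ => ?_)
    rw [norm_mul, norm_mul, Complex.norm_real, Complex.norm_real, Real.norm_of_nonneg (by positivity),
      Real.norm_of_nonneg (by positivity)]
    calc (π / b) ^ (d / 2 : ℝ) * rexp (-(π ^ 2 / b) * ‖ξ‖ ^ 2) * (‖ξ‖ ^ d * ‖𝓕 (φ : V → ℂ) ξ‖)
        = (π / b) ^ (d / 2 : ℝ) * (‖ξ‖ ^ d * rexp (-(π ^ 2 / b) * ‖ξ‖ ^ 2)) *
          ‖𝓕 (φ : V → ℂ) ξ‖ := by ring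
      _ ≤ (π / b) ^ (d / 2 : ℝ) * (√(d.factorial) * (b / π ^ 2) ^ (d / 2 : ℝ) *
          rexp (-(π ^ 2 / (2 * b)) * ‖ξ‖ ^ 2)) * B := by
          refine mul_le_mul (mul_le_mul_of_nonneg_left ?_ (by positivity)) (hB ξ) (norm_nonneg _)
            (by positivity)
          exact norm_pow_mul_exp_le d hb (norm_nonneg ξ)
      _ = _ := by ring
  refine h2.trans (le_of_eq ?_)
  rw [integral_const_mul, GaussianFourier.integral_rexp_neg_mul_sq_norm (by positivity), ← hd_def]
  have e1 : (b / π ^ 2) ^ (d / 2 : ℝ) = b ^ (d / 2 : ℝ) * (1 / π ^ 2) ^ (d / 2 : ℝ) := by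
    rw [← mul_rpow (by positivity) (by positivity)]; congr 1; ring
  have e2 : (π / b) ^ (d / 2 : ℝ) * (π / (π ^ 2 / (2 * b))) ^ (d / 2 : ℝ) = 2 ^ (d / 2 : ℝ) := by
    rw [← mul_rpow (by positivity) (by positivity)]; congr 1; field_simp
  simp only [K]
  rw [e1, ← e2]
  ring

lemma integrable_of_integrable_weight {ψ : V → ℂ} (hm : AEStronglyMeasurable ψ)
    (h : Integrable fun x : V => (((1 + ‖x‖) ^ 2 : ℝ) : ℂ) * ψ x) :
    Integrable ψ ∧ (Integrable fun x : V => ((‖x‖ ^ 2 : ℝ) : ℂ) * ψ x) ∧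
      Integrable fun x : V => ((‖x‖ : ℝ) : ℂ) * ψ x := by
  have key : ∀ (w : V → ℝ), Continuous w → (∀ x, 0 ≤ w x) → (∀ x, w x ≤ (1 + ‖x‖) ^ 2) →
      Integrable fun x : V => ((w x : ℝ) : ℂ) * ψ x := by
    intro w hc h0 h1
    refine h.mono ((Complex.continuous_ofReal.comp hc).aestronglyMeasurable.mul hm)
      (Eventually.of_forall fun x => ?_)
    rw [norm_mul, norm_mul, Complex.norm_real, Complex.norm_real, Real.norm_of_nonneg (h0 x),
      Real.norm_of_nonneg (by positivity)]
    gcongr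
    exact h1 x
  refine ⟨?_, ?_, ?_⟩
  · simpa using key (fun _ => 1) continuous_const (by simp)
      (fun x => by nlinarith [norm_nonneg x])
  · exact key (fun x => ‖x‖ ^ 2) (by fun_prop) (fun x => by positivity)
      (fun x => by nlinarith [norm_nonneg x])
  · exact key (fun x => ‖x‖) (by fun_prop) (fun x => by positivity)
      (fun x => by nlinarith [norm_nonneg x, sq_nonneg ‖x‖])

lemma continuous_fourierInv_norm_pow (φ : 𝓢(V, ℂ)) (k : ℕ) :
    Continuous (𝓕⁻ (fun ξ => ((‖ξ‖ ^ k : ℝ) : ℂ) * 𝓕 (φ : V → ℂ) ξ)) :=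
  VectorFourier.fourierIntegral_continuous Real.continuous_fourierChar
    (L := -innerₗ V) (by exact continuous_inner.neg) (integrable_norm_pow_mul_fourier φ k)

/-- `(-Δ)^{d/2} φ` is orthogonal to constants and to `‖x‖ ^ 2` when `d ≥ 3`. -/
lemma integral_fourierInv_norm_pow_eq_zero (hd : 3 ≤ Module.finrank ℝ V) (φ : 𝓢(V, ℂ)) :
    ∫ x, 𝓕⁻ (fun ξ => ((‖ξ‖ ^ (Module.finrank ℝ V) : ℝ) : ℂ) * 𝓕 (φ : V → ℂ) ξ) x = 0 ∧
    ∫ x, ((‖x‖ ^ 2 : ℝ) : ℂ) *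
      𝓕⁻ (fun ξ => ((‖ξ‖ ^ (Module.finrank ℝ V) : ℝ) : ℂ) * 𝓕 (φ : V → ℂ) ξ) x = 0 := by
  obtain ⟨C, hC⟩ := exists_norm_integral_gaussian_le φ
  have hw := integrable_weight_mul_fourierInv_norm_pow hd φ
  have hc := continuous_fourierInv_norm_pow φ (Module.finrank ℝ V)
  set d := Module.finrank ℝ V with hd_def
  set ψ := 𝓕⁻ (fun ξ => ((‖ξ‖ ^ d : ℝ) : ℂ) * 𝓕 (φ : V → ℂ) ξ) with hψ
  obtain ⟨hi, hi2, -⟩ := integrable_of_integrable_weight hc.aestronglyMeasurable hw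
  have hd2 : (1 : ℝ) < d / 2 := by
    have : (3 : ℝ) ≤ d := by exact_mod_cast hd
    linarith
  -- the test sequence `b = 1 / (k + 1)`
  set b : ℕ → ℝ := fun k => 1 / ((k : ℝ) + 1) with hb
  have hbpos : ∀ k, 0 < b k := fun k => by positivity
  have hb0 : Tendsto b atTop (𝓝 0) := tendsto_one_div_add_atTop_nhds_zero_nat
  have hpow : ∀ p : ℝ, 0 < p → Tendsto (fun k => C * b k ^ p) atTop (𝓝 0) := by
    intro p hp
    have := (hb0.rpow_const (p := p) (Or.inr hp.le)).const_mul C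
    rwa [zero_rpow hp.ne', mul_zero] at this
  set I : ℕ → ℂ := fun k => ∫ x, ((rexp (-b k * ‖x‖ ^ 2) : ℝ) : ℂ) * ψ x
  have hI0 : Tendsto I atTop (𝓝 0) :=
    squeeze_zero_norm (fun k => hC (b k) (hbpos k)) (hpow _ (by linarith))
  have hexp : ∀ (k : ℕ) (x : V), ‖((rexp (-b k * ‖x‖ ^ 2) : ℝ) : ℂ)‖ ≤ 1 := by
    intro k x
    rw [Complex.norm_real, Real.norm_of_nonneg (exp_pos _).le, Real.exp_le_one_iff]
    have := hbpos k
    nlinarith [sq_nonneg ‖x‖]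
  have hIlim : Tendsto I atTop (𝓝 (∫ x, ψ x)) := by
    refine tendsto_integral_of_dominated_convergence (fun x => ‖ψ x‖) ?_ hi.norm ?_ ?_
    · intro k
      exact Continuous.aestronglyMeasurable (by fun_prop)
    · intro k
      refine Eventually.of_forall fun x => ?_
      rw [norm_mul]
      exact mul_le_of_le_one_left (norm_nonneg _) (hexp k x)
    · refine Eventually.of_forall fun x => ?_
      have h1 : Tendsto (fun k => rexp (-b k * ‖x‖ ^ 2)) atTop (𝓝 1) := by
        have := (hb0.neg.mul_const (‖x‖ ^ 2)).rexp
        simpa using this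
      have := ((Complex.continuous_ofReal.tendsto _).comp h1).mul_const (ψ x)
      simpa using this
  have hz : ∫ x, ψ x = 0 := tendsto_nhds_unique hIlim hI0
  refine ⟨hz, ?_⟩
  have hJ0 : Tendsto (fun k => ((b k)⁻¹ : ℂ) * I k) atTop (𝓝 0) := by
    refine squeeze_zero_norm (a := fun k => C * b k ^ (d / 2 - 1 : ℝ)) (fun k => ?_)
      (hpow _ (by linarith))
    rw [norm_mul, norm_inv, Complex.norm_real, Real.norm_of_nonneg (hbpos k).le,
      rpow_sub_one (hbpos k).ne', ← mul_div_assoc, div_eq_inv_mul]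
    exact mul_le_mul_of_nonneg_left (hC (b k) (hbpos k)) (inv_nonneg.2 (hbpos k).le)
  have hJ : ∀ k, ((b k)⁻¹ : ℂ) * I k =
      ∫ x, (((b k)⁻¹ * (rexp (-b k * ‖x‖ ^ 2) - 1) : ℝ) : ℂ) * ψ x := by
    intro k
    have hik : Integrable fun x => ((rexp (-b k * ‖x‖ ^ 2) : ℝ) : ℂ) * ψ x :=
      hi.bdd_mul (c := 1) (Continuous.aestronglyMeasurable (by fun_prop))
        (Eventually.of_forall (hexp k))
    have : I k = ∫ x, (((rexp (-b k * ‖x‖ ^ 2) : ℝ) : ℂ) * ψ x - ψ x) := by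
      rw [integral_sub hik hi, hz, sub_zero]
    rw [this, ← integral_const_mul]
    refine integral_congr_ae (Eventually.of_forall fun x => ?_)
    push_cast
    ring
  have hJlim : Tendsto (fun k => ((b k)⁻¹ : ℂ) * I k) atTop
      (𝓝 (∫ x, ((-‖x‖ ^ 2 : ℝ) : ℂ) * ψ x)) := by
    simp_rw [hJ]
    refine tendsto_integral_of_dominated_convergence (fun x => ‖((‖x‖ ^ 2 : ℝ) : ℂ) * ψ x‖) ?_
      hi2.norm ?_ ?_
    · intro k
      exact Continuous.aestronglyMeasurable (by fun_prop)
    · intro k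
      refine Eventually.of_forall fun x => ?_
      rw [norm_mul, norm_mul, Complex.norm_real, Complex.norm_real, norm_mul, norm_inv,
        Real.norm_of_nonneg (hbpos k).le, Real.norm_of_nonneg (by positivity : 0 ≤ ‖x‖ ^ 2)]
      refine mul_le_mul_of_nonneg_right ?_ (norm_nonneg _)
      have hbx : 0 ≤ b k * ‖x‖ ^ 2 := mul_nonneg (hbpos k).le (by positivity)
      rw [← div_eq_inv_mul, div_le_iff₀ (hbpos k), Real.norm_eq_abs, abs_sub_comm, abs_of_nonneg
        (by rw [sub_nonneg, Real.exp_le_one_iff]; linarith)]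
      have := Real.add_one_le_exp (-b k * ‖x‖ ^ 2)
      linarith
    · refine Eventually.of_forall fun x => ?_
      have h1 : Tendsto (fun k => (b k)⁻¹ * (rexp (-b k * ‖x‖ ^ 2) - 1)) atTop
          (𝓝 (-‖x‖ ^ 2)) := by
        have hder : HasDerivAt (fun t : ℝ => rexp (-t * ‖x‖ ^ 2)) (-‖x‖ ^ 2) 0 := by
          have := ((hasDerivAt_id (0 : ℝ)).neg.mul_const (‖x‖ ^ 2)).exp
          simpa using this
        have hb0' : Tendsto b atTop (𝓝[≠] 0) :=
          tendsto_nhdsWithin_iff.2 ⟨hb0, Eventually.of_forall fun k => (hbpos k).ne'⟩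
        have := (hasDerivAt_iff_tendsto_slope_zero.1 hder).comp hb0'
        simpa [Function.comp_def] using this
      exact ((Complex.continuous_ofReal.tendsto _).comp h1).mul_const (ψ x)
  have := tendsto_nhds_unique hJlim hJ0
  have e : ∀ x : V, ((-‖x‖ ^ 2 : ℝ) : ℂ) * ψ x = -(((‖x‖ ^ 2 : ℝ) : ℂ) * ψ x) := by
    intro x; push_cast; ring
  simp_rw [e] at this
  rwa [integral_neg, neg_eq_zero] at this

end

/-! ### The logarithmic kernel and the fundamental solution -/

lemma abs_exp_neg_sub_exp_neg_le {p q : ℝ} (hp : 0 ≤ p) (hq : 0 ≤ q) :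
    |rexp (-p) - rexp (-q)| ≤ |p - q| := by
  wlog h : p ≤ q generalizing p q
  · rw [abs_sub_comm, abs_sub_comm p]
    exact this hq hp (by linarith)
  have h1 : rexp (-q) ≤ rexp (-p) := Real.exp_le_exp.2 (by linarith)
  rw [abs_of_nonneg (by linarith), abs_sub_comm, abs_of_nonneg (by linarith)]
  have h2 : rexp (-q) = rexp (-p) * rexp (-(q - p)) := by rw [← Real.exp_add]; congr 1; ring
  have h3 := Real.add_one_le_exp (-(q - p))
  have h4 : rexp (-p) ≤ 1 := Real.exp_le_one_iff.2 (by linarith)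
  rw [h2]
  nlinarith [Real.exp_pos (-p)]

/-- The integrand of the Frullani representation
`-log a = ∫ s in (0, ∞), (exp (-a/s) - exp (-1/s)) / s`. -/
noncomputable def logKernel (a s : ℝ) : ℝ := s⁻¹ * (rexp (-(a * s⁻¹)) - rexp (-s⁻¹))

lemma measurable_logKernel : Measurable (Function.uncurry logKernel) := by
  unfold logKernel Function.uncurry
  fun_prop

lemma integrableOn_logKernel {a : ℝ} (ha : 0 < a) : IntegrableOn (logKernel a) (Ioi 0) := by
  have hm : Measurable (logKernel a) := measurable_logKernel.comp (measurable_const.prodMk measurable_id)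
  rw [← Ioc_union_Ioi_eq_Ioi (zero_le_one' ℝ)]
  refine IntegrableOn.union ?_ ?_
  · refine Measure.integrableOn_of_bounded (M := a⁻¹ + 1) (by simp) hm.aestronglyMeasurable ?_
    refine (ae_restrict_mem measurableSet_Ioc).mono fun s hs => ?_
    have hs0 : 0 < s⁻¹ := inv_pos.2 hs.1
    have h1 : ∀ c : ℝ, 0 < c → s⁻¹ * rexp (-(c * s⁻¹)) ≤ c⁻¹ := by
      intro c hc
      rw [Real.exp_neg, ← div_eq_mul_inv, div_le_iff₀ (Real.exp_pos _), ← div_eq_inv_mul,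
        le_div_iff₀ hc]
      have := Real.add_one_le_exp (c * s⁻¹)
      linarith
    have h2 := h1 a ha
    have h3 := h1 1 one_pos
    rw [one_mul, inv_one] at h3
    have h4 : 0 < s⁻¹ * rexp (-(a * s⁻¹)) := by positivity
    have h5 : 0 < s⁻¹ * rexp (-s⁻¹) := by positivity
    have h6 : 0 < a⁻¹ := inv_pos.2 ha
    rw [logKernel, mul_sub, Real.norm_eq_abs, abs_le]
    constructor <;> linarith
  · have hI : IntegrableOn (fun s : ℝ => |a - 1| * s ^ (-2 : ℝ)) (Ioi 1) :=
      (integrableOn_Ioi_rpow_of_lt (by norm_num) one_pos).const_mul _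
    refine Integrable.mono' hI hm.aestronglyMeasurable ?_
    refine (ae_restrict_mem measurableSet_Ioi).mono fun s hs => ?_
    have hs1 : (1 : ℝ) < s := hs
    have hs0 : 0 < s⁻¹ := inv_pos.2 (by linarith)
    have := abs_exp_neg_sub_exp_neg_le (p := a * s⁻¹) (q := s⁻¹) (by positivity) hs0.le
    rw [logKernel, Real.norm_eq_abs, abs_mul, abs_of_pos hs0]
    calc s⁻¹ * |rexp (-(a * s⁻¹)) - rexp (-s⁻¹)| ≤ s⁻¹ * |a * s⁻¹ - s⁻¹| := by gcongr
      _ = |a - 1| * s ^ (-2 : ℝ) := by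
        rw [show a * s⁻¹ - s⁻¹ = (a - 1) * s⁻¹ by ring, abs_mul, abs_of_pos hs0,
          rpow_neg (by linarith), rpow_two]
        field_simp

lemma integral_logKernel {a : ℝ} (ha : 0 < a) : ∫ s in Ioi 0, logKernel a s = -log a := by
  have hc : ContinuousOn (fun x : ℝ => rexp (-x⁻¹)) (Ioi 0) :=
    (continuousOn_inv₀.mono fun x (hx : 0 < x) => hx.ne').neg.rexp
  have h := Frullani.integral_Ioi_eq (f := fun x : ℝ => rexp (-x⁻¹)) (a := a⁻¹) (b := 1) (L := 0)
    (R := 1) (hc.locallyIntegrableOn measurableSet_Ioi) (inv_pos.2 ha) one_pos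
    (Real.tendsto_exp_neg_atTop_nhds_zero.comp tendsto_inv_nhdsGT_zero)
    (by simpa using (tendsto_inv_atTop_zero.neg.rexp : Tendsto (fun x : ℝ => rexp (-x⁻¹)) _ _))
  have e : ∀ s : ℝ, s⁻¹ • (rexp (-(a⁻¹ * s)⁻¹) - rexp (-(1 * s)⁻¹)) = logKernel a s := by
    intro s
    rw [logKernel, mul_inv, inv_inv, one_mul, smul_eq_mul]
  simp_rw [e] at h
  rw [h (integrableOn_logKernel ha)]
  simp

lemma integral_norm_logKernel {a : ℝ} (ha : 0 < a) :
    ∫ s in Ioi 0, ‖logKernel a s‖ = |log a| := by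
  rcases le_total a 1 with h | h
  · have : ∀ s ∈ Ioi (0 : ℝ), ‖logKernel a s‖ = logKernel a s := by
      intro s hs
      have hs0 : 0 < s⁻¹ := inv_pos.2 hs
      refine Real.norm_of_nonneg (mul_nonneg hs0.le (sub_nonneg.2 (Real.exp_le_exp.2 ?_)))
      nlinarith
    rw [setIntegral_congr_fun measurableSet_Ioi this, integral_logKernel ha,
      abs_of_nonpos (log_nonpos ha.le h)]
  · have : ∀ s ∈ Ioi (0 : ℝ), ‖logKernel a s‖ = -logKernel a s := by
      intro s hs
      have hs0 : 0 < s⁻¹ := inv_pos.2 hs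
      refine Real.norm_of_nonpos (mul_nonpos_of_nonneg_of_nonpos hs0.le
        (sub_nonpos.2 (Real.exp_le_exp.2 ?_)))
      nlinarith
    rw [setIntegral_congr_fun measurableSet_Ioi this, integral_neg, integral_logKernel ha,
      abs_of_nonneg (log_nonneg h), neg_neg]

section
variable {V : Type*} [NormedAddCommGroup V] [InnerProductSpace ℝ V] [FiniteDimensional ℝ V]
  [MeasurableSpace V] [BorelSpace V]

lemma integrable_posLog_norm_inv (hd : 2 ≤ Module.finrank ℝ V) :
    Integrable fun z : V => log⁺ ‖z‖⁻¹ := by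
  have : Nontrivial V := Module.finrank_pos_iff.1 (show 0 < Module.finrank ℝ V by omega)
  rw [integrable_fun_norm_addHaar volume (f := fun r => log⁺ r⁻¹),
    ← Ioc_union_Ioi_eq_Ioi (zero_le_one' ℝ)]
  refine IntegrableOn.union ?_ ?_
  · refine Measure.integrableOn_of_bounded (M := 1) (by simp)
      (Measurable.aestronglyMeasurable (by have := continuous_posLog.measurable; fun_prop)) ?_
    refine (ae_restrict_mem measurableSet_Ioc).mono fun s hs => ?_
    have hs0 : 0 < s⁻¹ := inv_pos.2 hs.1
    have h1 : (1 : ℝ) ≤ s⁻¹ := one_le_inv_iff₀.2 ⟨hs.1, hs.2⟩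
    have h2 : log⁺ s⁻¹ = log s⁻¹ := posLog_eq_log (by rwa [abs_of_pos hs0])
    have h3 : log s⁻¹ ≤ s⁻¹ := (Real.log_le_sub_one_of_pos hs0).trans (by linarith)
    have h4 : 0 ≤ log s⁻¹ := log_nonneg h1
    rw [h2, smul_eq_mul, Real.norm_of_nonneg (mul_nonneg (by have := hs.1; positivity) h4)]
    calc s ^ (Module.finrank ℝ V - 1) * log s⁻¹ ≤ s ^ 1 * s⁻¹ := by
          refine mul_le_mul (pow_le_pow_of_le_one hs.1.le hs.2 (by omega)) h3 h4 (by
            rw [pow_one]; exact hs.1.le)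
      _ = 1 := by rw [pow_one, mul_inv_cancel₀ hs.1.ne']
  · refine integrableOn_zero.congr_fun (fun s hs => ?_) measurableSet_Ioi
    have hs1 : (1 : ℝ) < s := hs
    have : log⁺ s⁻¹ = 0 := by
      rw [posLog_eq_zero_iff, abs_of_pos (by positivity)]
      exact inv_le_one_of_one_le₀ hs1.le
    simp [this]

/-- A pointwise bound for the kernel `log ((1 + ‖y‖) / ‖x - y‖)`, valid on the diagonal too, where
the kernel takes the junk value `0`. -/
lemma abs_log_kernel_le {V : Type*} [NormedAddCommGroup V] (x y : V) :
    |log ((1 + ‖y‖) / ‖x - y‖)| ≤ log (1 + ‖x‖) + log (1 + ‖y‖) + log⁺ ‖x - y‖⁻¹ := by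
  have hx : 0 ≤ log (1 + ‖x‖) := log_nonneg (by linarith [norm_nonneg x])
  have hy : 0 ≤ log (1 + ‖y‖) := log_nonneg (by linarith [norm_nonneg y])
  have hp : 0 ≤ log⁺ ‖x - y‖⁻¹ := posLog_nonneg
  rcases eq_or_ne x y with rfl | h
  · simp only [sub_self, norm_zero, div_zero, log_zero, abs_zero, inv_zero, posLog_zero]
    linarith
  · have hr : 0 < ‖x - y‖ := norm_pos_iff.2 (sub_ne_zero.2 h)
    have h1 : log ‖x - y‖⁻¹ ≤ log⁺ ‖x - y‖⁻¹ := le_max_right _ _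
    rw [log_inv] at h1
    rw [log_div (by positivity) hr.ne', abs_le]
    constructor
    · have h2 : ‖x - y‖ ≤ (1 + ‖x‖) * (1 + ‖y‖) := by
        have := norm_sub_le x y
        nlinarith [norm_nonneg x, norm_nonneg y]
      have h3 := log_le_log hr h2
      rw [log_mul (by positivity) (by positivity)] at h3
      linarith
    · linarith

lemma integrable_log_kernel_mul (hd : 2 ≤ Module.finrank ℝ V) {w : V → ℂ} {f : V → ℝ} {B : ℝ}
    (hwm : AEStronglyMeasurable w) (hwB : ∀ x, ‖w x‖ ≤ B)
    (hw : Integrable w) (hw1 : Integrable fun x => ((‖x‖ : ℝ) : ℂ) * w x)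
    (hf : Integrable f) (hf1 : Integrable fun y => log (1 + ‖y‖) * f y) :
    Integrable (fun p : V × V => ((log ((1 + ‖p.2‖) / ‖p.1 - p.2‖) * f p.2 : ℝ) : ℂ) * w p.1)
      ((volume : Measure V).prod volume) := by
  have hB0 : 0 ≤ B := (norm_nonneg _).trans (hwB 0)
  have hw2 : Integrable fun x => log (1 + ‖x‖) * ‖w x‖ := by
    refine hw1.norm.mono' ((Measurable.aestronglyMeasurable (by fun_prop)).mul hwm.norm)
      (Eventually.of_forall fun x => ?_)
    have h0 : 0 ≤ log (1 + ‖x‖) := log_nonneg (by linarith [norm_nonneg x])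
    rw [Real.norm_of_nonneg (mul_nonneg h0 (norm_nonneg _)), norm_mul, Complex.norm_real, norm_norm]
    gcongr
    have := Real.log_le_sub_one_of_pos (show 0 < 1 + ‖x‖ by positivity)
    linarith
  have i1 : Integrable (fun p : V × V => (log (1 + ‖p.1‖) * ‖w p.1‖) * |f p.2|)
      ((volume : Measure V).prod volume) := hw2.mul_prod hf.abs
  have i2 : Integrable (fun p : V × V => ‖w p.1‖ * |log (1 + ‖p.2‖) * f p.2|)
      ((volume : Measure V).prod volume) := hw.norm.mul_prod hf1.abs
  have i3 : Integrable (fun p : V × V => |f p.2| * log⁺ ‖p.1 - p.2‖⁻¹)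
      ((volume : Measure V).prod volume) :=
    hf.abs.convolution_integrand (ContinuousLinearMap.mul ℝ ℝ) (integrable_posLog_norm_inv hd)
  refine ((i1.add i2).add (i3.const_mul B)).mono' ?_ (Eventually.of_forall fun p => ?_)
  · refine AEStronglyMeasurable.mul ?_ hwm.comp_fst
    refine Complex.continuous_ofReal.comp_aestronglyMeasurable (AEStronglyMeasurable.mul ?_
      hf.aestronglyMeasurable.comp_snd)
    exact Measurable.aestronglyMeasurable (by fun_prop)
  · have h1 := abs_log_kernel_le p.1 p.2
    have h2 : 0 ≤ log (1 + ‖p.2‖) := log_nonneg (by linarith [norm_nonneg p.2])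
    have h3 : 0 ≤ log⁺ ‖p.1 - p.2‖⁻¹ := posLog_nonneg
    rw [norm_mul, Complex.norm_real, Real.norm_eq_abs, abs_mul]
    simp only [Pi.add_apply]
    rw [abs_mul, abs_of_nonneg h2]
    calc |log ((1 + ‖p.2‖) / ‖p.1 - p.2‖)| * |f p.2| * ‖w p.1‖
        ≤ (log (1 + ‖p.1‖) + log (1 + ‖p.2‖) + log⁺ ‖p.1 - p.2‖⁻¹) * |f p.2| * ‖w p.1‖ := by
          gcongr
      _ = log (1 + ‖p.1‖) * ‖w p.1‖ * |f p.2| + ‖w p.1‖ * (log (1 + ‖p.2‖) * |f p.2|) +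
          ‖w p.1‖ * (|f p.2| * log⁺ ‖p.1 - p.2‖⁻¹) := by ring
      _ ≤ _ := by gcongr; exact hwB _

lemma abs_log_norm_sub_le {V : Type*} [NormedAddCommGroup V] (x y : V) :
    |log ‖x - y‖| ≤ ‖x‖ + ‖y‖ + log⁺ ‖x - y‖⁻¹ := by
  have hp : 0 ≤ log⁺ ‖x - y‖⁻¹ := posLog_nonneg
  have h0 := norm_nonneg (x - y)
  have h1 := norm_sub_le x y
  have h2 := Real.log_le_self h0
  have h3 : log ‖x - y‖⁻¹ ≤ log⁺ ‖x - y‖⁻¹ := le_max_right _ _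
  rw [log_inv] at h3
  rw [abs_le]
  constructor <;> linarith [norm_nonneg x, norm_nonneg y]

lemma integrable_log_norm_sub_mul (hd : 2 ≤ Module.finrank ℝ V) {w : V → ℂ} {B : ℝ}
    (hwm : AEStronglyMeasurable w) (hwB : ∀ x, ‖w x‖ ≤ B)
    (hw : Integrable w) (hw1 : Integrable fun x => ((‖x‖ : ℝ) : ℂ) * w x) (y : V) :
    Integrable fun x => ((log ‖x - y‖ : ℝ) : ℂ) * w x := by
  have i3 : Integrable fun x : V => log⁺ ‖x - y‖⁻¹ * B :=
    ((integrable_posLog_norm_inv hd).comp_sub_right y).mul_const B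
  refine ((hw1.norm.add (hw.norm.const_mul ‖y‖)).add i3).mono'
    ((Measurable.aestronglyMeasurable (by fun_prop)).mul hwm) (Eventually.of_forall fun x => ?_)
  simp only [Pi.add_apply]
  rw [norm_mul, norm_mul, Complex.norm_real, Complex.norm_real, Real.norm_eq_abs, norm_norm]
  have h1 := abs_log_norm_sub_le x y
  have h3 : 0 ≤ log⁺ ‖x - y‖⁻¹ := posLog_nonneg
  calc |log ‖x - y‖| * ‖w x‖ ≤ (‖x‖ + ‖y‖ + log⁺ ‖x - y‖⁻¹) * ‖w x‖ := by gcongr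
    _ = ‖x‖ * ‖w x‖ + ‖y‖ * ‖w x‖ + log⁺ ‖x - y‖⁻¹ * ‖w x‖ := by ring
    _ ≤ _ := by gcongr; exact hwB x

lemma integral_heat_trace {d : ℕ} (hd : 1 ≤ d) {r : ℝ} (hr : 0 < r) :
    IntegrableOn (fun s : ℝ => s⁻¹ * ((π / s⁻¹) ^ (d / 2 : ℝ) * rexp (-(π ^ 2 / s⁻¹) * r ^ 2)))
      (Ioi 0) ∧
    ∫ s in Ioi (0 : ℝ), s⁻¹ * ((π / s⁻¹) ^ (d / 2 : ℝ) * rexp (-(π ^ 2 / s⁻¹) * r ^ 2)) =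
      Gamma (d / 2) * π ^ (-(d / 2) : ℝ) * (r ^ d)⁻¹ := by
  have hd0 : (0 : ℝ) < d / 2 := by
    have : (1 : ℝ) ≤ d := by exact_mod_cast hd
    linarith
  have e : ∀ s ∈ Ioi (0 : ℝ), s⁻¹ * ((π / s⁻¹) ^ (d / 2 : ℝ) * rexp (-(π ^ 2 / s⁻¹) * r ^ 2)) =
      π ^ (d / 2 : ℝ) * (s ^ ((d / 2 : ℝ) - 1) * rexp (-(π ^ 2 * r ^ 2 * s))) := by
    intro s hs
    have hs0 : 0 < s := hs
    rw [div_inv_eq_mul, div_inv_eq_mul, mul_rpow pi_pos.le hs0.le, rpow_sub_one hs0.ne',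
      show -(π ^ 2 * s) * r ^ 2 = -(π ^ 2 * r ^ 2 * s) by ring]
    field_simp
  have hpos : 0 < π ^ 2 * r ^ 2 := by positivity
  have hG := Real.integral_rpow_mul_exp_neg_mul_Ioi hd0 hpos
  have hGpos : 0 < (1 / (π ^ 2 * r ^ 2)) ^ (d / 2 : ℝ) * Gamma (d / 2) :=
    mul_pos (by positivity) (Gamma_pos_of_pos hd0)
  constructor
  · rw [integrableOn_congr_fun e measurableSet_Ioi]
    refine Integrable.const_mul ?_ _
    by_contra hni
    rw [integral_undef hni] at hG
    exact hGpos.ne hG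
  · rw [setIntegral_congr_fun measurableSet_Ioi e, integral_const_mul, hG]
    have h1 : (1 / (π ^ 2 * r ^ 2)) ^ (d / 2 : ℝ) = (π ^ d)⁻¹ * (r ^ d)⁻¹ := by
      rw [one_div, inv_rpow hpos.le, ← mul_pow, ← rpow_natCast (π * r) 2,
        ← rpow_mul (by positivity), ← mul_inv, ← mul_pow, ← rpow_natCast]
      congr 2; push_cast; ring
    have h2 : π ^ (d / 2 : ℝ) * (π ^ d)⁻¹ = π ^ (-(d / 2) : ℝ) := by
      rw [← rpow_natCast, ← rpow_neg pi_pos.le, ← rpow_add pi_pos]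
      congr 1; ring
    rw [h1, ← h2]
    ring

/-- Up to a constant, `-log ‖x‖` is a fundamental solution of `(-Δ)^{d/2}`. -/
theorem integral_neg_log_mul_fourierInv_norm_pow (hd : 3 ≤ Module.finrank ℝ V) (φ : 𝓢(V, ℂ))
    (y : V) :
    ∫ x, ((-log ‖x - y‖ : ℝ) : ℂ) *
      𝓕⁻ (fun ξ => ((‖ξ‖ ^ (Module.finrank ℝ V) : ℝ) : ℂ) * 𝓕 (φ : V → ℂ) ξ) x =
    ((Gamma (Module.finrank ℝ V / 2) * π ^ (-(Module.finrank ℝ V / 2) : ℝ) / 2 : ℝ) : ℂ) * φ y := by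
  have : Nontrivial V := Module.finrank_pos_iff.1 (show 0 < Module.finrank ℝ V by omega)
  have hw := integrable_weight_mul_fourierInv_norm_pow hd φ
  have hc := continuous_fourierInv_norm_pow φ (Module.finrank ℝ V)
  have hz := (integral_fourierInv_norm_pow_eq_zero hd φ).1
  have hhi := integrable_norm_pow_mul_fourier φ (Module.finrank ℝ V)
  set d := Module.finrank ℝ V with hd_def
  set h : V → ℂ := fun ξ => ((‖ξ‖ ^ d : ℝ) : ℂ) * 𝓕 (φ : V → ℂ) ξ with hh
  set ψ := 𝓕⁻ h with hψ
  obtain ⟨hi, -, hi1⟩ := integrable_of_integrable_weight hc.aestronglyMeasurable hw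
  have hψB : ∀ x, ‖ψ x‖ ≤ ∫ ξ, ‖h ξ‖ := fun x =>
    VectorFourier.norm_fourierIntegral_le_integral_norm _ _ _ _ x
  have hae : ∀ᵐ x : V, x ≠ y := by
    rw [ae_iff]; simp
  have hae0 : ∀ᵐ x : V, x ≠ 0 := by
    rw [ae_iff]; simp
  have hlog := integrable_log_norm_sub_mul (by omega) hc.aestronglyMeasurable hψB hi hi1 y
  set ν : Measure ℝ := volume.restrict (Ioi 0) with hν
  have hlogsq : ∀ x : V, log (‖x - y‖ ^ 2) = 2 * log ‖x - y‖ := fun x => by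
    rw [log_pow]; norm_num
  -- first exchange: the Frullani integral against `ψ`
  have hF1 : Integrable (Function.uncurry fun (x : V) (s : ℝ) =>
      ((logKernel (‖x - y‖ ^ 2) s : ℝ) : ℂ) * ψ x) ((volume : Measure V).prod ν) := by
    rw [integrable_prod_iff]
    · constructor
      · filter_upwards [hae] with x hx
        have : 0 < ‖x - y‖ ^ 2 := by have := norm_pos_iff.2 (sub_ne_zero.2 hx); positivity
        exact (integrableOn_logKernel this).ofReal.mul_const (ψ x)
      · refine (hlog.norm.const_mul 2).congr ?_
        filter_upwards [hae] with x hx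
        have : 0 < ‖x - y‖ ^ 2 := by have := norm_pos_iff.2 (sub_ne_zero.2 hx); positivity
        simp only [Function.uncurry, norm_mul, Complex.norm_real]
        rw [integral_mul_const, integral_norm_logKernel this, hlogsq, abs_mul, Real.norm_eq_abs]
        simp [mul_assoc]
    · refine AEStronglyMeasurable.mul ?_ hc.aestronglyMeasurable.comp_fst
      refine Measurable.aestronglyMeasurable (Complex.measurable_ofReal.comp ?_)
      exact measurable_logKernel.comp
        ((by fun_prop : Measurable fun p : V × ℝ => ‖p.1 - y‖ ^ 2).prodMk measurable_snd)
  have hswap1 := integral_integral_swap hF1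
  have hL1 : ∫ x, ∫ s, ((logKernel (‖x - y‖ ^ 2) s : ℝ) : ℂ) * ψ x ∂ν =
      2 * ∫ x, ((-log ‖x - y‖ : ℝ) : ℂ) * ψ x := by
    rw [← integral_const_mul]
    refine integral_congr_ae ?_
    filter_upwards [hae] with x hx
    have : 0 < ‖x - y‖ ^ 2 := by have := norm_pos_iff.2 (sub_ne_zero.2 hx); positivity
    rw [integral_mul_const, integral_complex_ofReal, hν, integral_logKernel this, hlogsq]
    push_cast
    ring
  -- the Gaussian pairing, moved to the Fourier side
  set q : ℝ → V → ℝ := fun s ξ =>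
    s⁻¹ * ((π / s⁻¹) ^ (d / 2 : ℝ) * rexp (-(π ^ 2 / s⁻¹) * ‖ξ‖ ^ 2)) with hq
  have hR1 : ∀ s ∈ Ioi (0 : ℝ), ∫ x, ((logKernel (‖x - y‖ ^ 2) s : ℝ) : ℂ) * ψ x =
      ∫ ξ, ((q s ξ : ℝ) : ℂ) * (Complex.exp (↑(2 * π * inner ℝ ξ y) * Complex.I) * h ξ) := by
    intro s hs
    have hs0 : 0 < s⁻¹ := inv_pos.2 hs
    have hg := integral_gaussian_mul_fourierInv hhi hs0 y
    have hgi : Integrable fun x : V => ((rexp (-s⁻¹ * ‖x - y‖ ^ 2) : ℝ) : ℂ) * ψ x := by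
      refine hi.bdd_mul (c := 1) (Continuous.aestronglyMeasurable (by fun_prop))
        (Eventually.of_forall fun x => ?_)
      rw [Complex.norm_real, Real.norm_of_nonneg (exp_pos _).le, Real.exp_le_one_iff]
      nlinarith [sq_nonneg ‖x - y‖]
    have e1 : ∀ x, ((logKernel (‖x - y‖ ^ 2) s : ℝ) : ℂ) * ψ x =
        (s⁻¹ : ℂ) * (((rexp (-s⁻¹ * ‖x - y‖ ^ 2) : ℝ) : ℂ) * ψ x - (rexp (-s⁻¹) : ℝ) * ψ x) := by
      intro x
      rw [logKernel, show -(‖x - y‖ ^ 2 * s⁻¹) = -s⁻¹ * ‖x - y‖ ^ 2 by ring]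
      push_cast
      ring
    simp_rw [e1]
    rw [integral_const_mul, integral_sub hgi (hi.const_mul _), integral_const_mul, hz, mul_zero,
      sub_zero, hg, ← integral_const_mul]
    refine integral_congr_ae (Eventually.of_forall fun ξ => ?_)
    simp only [hq]
    push_cast
    ring
  have hL2 : ∫ s, (∫ x, ((logKernel (‖x - y‖ ^ 2) s : ℝ) : ℂ) * ψ x) ∂ν =
      ∫ s, (∫ ξ, ((q s ξ : ℝ) : ℂ) *
        (Complex.exp (↑(2 * π * inner ℝ ξ y) * Complex.I) * h ξ)) ∂ν :=
    setIntegral_congr_fun measurableSet_Ioi hR1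
  -- second exchange: the time integral of the heat multiplier is a power of `‖ξ‖`
  have hFi : Integrable (𝓕 (φ : V → ℂ)) := by
    rw [← SchwartzMap.fourier_coe]; exact (𝓕 φ).integrable
  set G := Gamma (d / 2) * π ^ (-(d / 2) : ℝ) with hG
  have hG0 : 0 ≤ G := mul_nonneg (Gamma_nonneg_of_nonneg (by positivity)) (by positivity)
  have hF2 : Integrable (Function.uncurry fun (s : ℝ) (ξ : V) => ((q s ξ : ℝ) : ℂ) *
        (Complex.exp (↑(2 * π * inner ℝ ξ y) * Complex.I) * h ξ)) (ν.prod volume) := by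
    rw [integrable_prod_iff']
    · constructor
      · filter_upwards [hae0] with ξ hξ
        have hIq : Integrable (fun s => q s ξ) ν :=
          (integral_heat_trace (d := d) (by omega) (norm_pos_iff.2 hξ)).1
        exact (hIq.ofReal (𝕜 := ℂ)).mul_const
          (Complex.exp (↑(2 * π * inner ℝ ξ y) * Complex.I) * h ξ)
      · refine (hFi.norm.const_mul G).congr ?_
        filter_upwards [hae0] with ξ hξ
        have hξ0 := norm_pos_iff.2 hξ
        simp only [Function.uncurry, norm_mul, Complex.norm_real]
        rw [integral_mul_const]
        have : ∫ s, ‖q s ξ‖ ∂ν = G * (‖ξ‖ ^ d)⁻¹ := by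
          rw [← (integral_heat_trace (d := d) (by omega) hξ0).2]
          refine setIntegral_congr_fun measurableSet_Ioi fun s hs => ?_
          have hs0 : 0 < s := hs
          exact Real.norm_of_nonneg (by positivity)
        rw [this, Complex.norm_exp_ofReal_mul_I, one_mul, hh, norm_mul, Complex.norm_real,
          Real.norm_of_nonneg (by positivity)]
        field_simp
    · refine AEStronglyMeasurable.mul (Measurable.aestronglyMeasurable ?_) ?_
      · simp only [hq]
        fun_prop
      · have : AEStronglyMeasurable (fun ξ : V =>
            Complex.exp (↑(2 * π * inner ℝ ξ y) * Complex.I) * h ξ) :=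
          (Continuous.aestronglyMeasurable (by fun_prop)).mul hhi.aestronglyMeasurable
        exact this.comp_snd
  have hswap2 := integral_integral_swap hF2
  have hinv : 𝓕⁻ (𝓕 (φ : V → ℂ)) = φ :=
    φ.continuous.fourierInv_fourier_eq φ.integrable hFi
  have hR2 : ∫ ξ, ∫ s, ((q s ξ : ℝ) : ℂ) *
      (Complex.exp (↑(2 * π * inner ℝ ξ y) * Complex.I) * h ξ) ∂ν = G * φ y := by
    conv_rhs => rw [← hinv, Real.fourierInv_eq', ← integral_const_mul]
    refine integral_congr_ae ?_
    filter_upwards [hae0] with ξ hξ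
    have hξ0 := norm_pos_iff.2 hξ
    rw [integral_mul_const, integral_complex_ofReal, hν, hq,
      (integral_heat_trace (d := d) (by omega) hξ0).2, hh]
    have : (‖ξ‖ : ℂ) ≠ 0 := by exact_mod_cast hξ0.ne'
    push_cast [smul_eq_mul, ← hG]
    rw [hG]
    push_cast
    field_simp
  rw [hL1, hL2, hswap2, hR2] at hswap1
  have h2 : (2 : ℂ) ≠ 0 := two_ne_zero
  rw [← mul_right_inj' h2, hswap1]
  push_cast
  ring

end

/-! ### The logarithmic kernel in cylindrical coordinates -/

/-- The kernel `½ log (2 cosh τ) - ∑ j, β j (cosh τ)^{-2(j+1)}`. For suitable `β` it is the average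
of `log |x - y| - (log |x| + log |y|) / 2` over spheres with `τ = log |x| - log |y|`. -/
noncomputable def cylKernel (β : ℕ → ℝ) (τ : ℝ) : ℝ :=
  1 / 2 * log (2 * cosh τ) - ∑' j, β j * (cosh τ)⁻¹ ^ (2 * (j + 1))

lemma abs_le_log_two_mul_cosh (τ : ℝ) : |τ| ≤ log (2 * cosh τ) := by
  rw [← Real.cosh_abs, Real.cosh_eq, Real.le_log_iff_exp_le (by positivity)]
  have := Real.exp_pos (-|τ|)
  linarith

lemma log_two_mul_cosh_le (τ : ℝ) : log (2 * cosh τ) ≤ |τ| + log 2 := by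
  rw [← Real.cosh_abs, Real.cosh_eq, Real.log_le_iff_le_exp (by positivity), Real.exp_add,
    Real.exp_log two_pos]
  have : rexp (-|τ|) ≤ rexp |τ| := Real.exp_le_exp.2 (by linarith [abs_nonneg τ])
  linarith

lemma inv_cosh_pow_le_one (τ : ℝ) (k : ℕ) : (cosh τ)⁻¹ ^ k ≤ 1 :=
  pow_le_one₀ (inv_nonneg.2 (cosh_pos τ).le) (inv_le_one_of_one_le₀ (one_le_cosh τ))

lemma summable_cylKernel {β : ℕ → ℝ} (hβ0 : ∀ j, 0 ≤ β j) (hβ : Summable β)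
    (τ : ℝ) : Summable fun j => β j * (cosh τ)⁻¹ ^ (2 * (j + 1)) :=
  hβ.of_nonneg_of_le (fun j => mul_nonneg (hβ0 j) (pow_nonneg (inv_nonneg.2 (cosh_pos τ).le) _))
    fun j => mul_le_of_le_one_right (hβ0 j) (inv_cosh_pow_le_one τ _)

lemma continuous_cylKernel {β : ℕ → ℝ} (hβ0 : ∀ j, 0 ≤ β j) (hβ : Summable β) :
    Continuous (cylKernel β) := by
  refine Continuous.sub (continuous_const.mul (Continuous.log (by fun_prop)
    fun τ => (by positivity [cosh_pos τ] : 2 * cosh τ ≠ 0))) ?_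
  refine continuous_tsum (u := β) (fun j => ?_) hβ fun j τ => ?_
  · exact continuous_const.mul
      ((continuous_cosh.inv₀ fun τ => (cosh_pos τ).ne').pow _)
  · rw [Real.norm_of_nonneg (mul_nonneg (hβ0 j) (pow_nonneg (inv_nonneg.2 (cosh_pos τ).le) _))]
    exact mul_le_of_le_one_right (hβ0 j) (inv_cosh_pow_le_one τ _)

lemma half_abs_sub_le_cylKernel {β : ℕ → ℝ} (hβ0 : ∀ j, 0 ≤ β j) (hβ : Summable β)
    (τ : ℝ) : |τ| / 2 - ∑' j, β j ≤ cylKernel β τ := by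
  have h1 := abs_le_log_two_mul_cosh τ
  have h2 : ∑' j, β j * (cosh τ)⁻¹ ^ (2 * (j + 1)) ≤ ∑' j, β j :=
    (summable_cylKernel hβ0 hβ τ).tsum_le_tsum
      (fun j => mul_le_of_le_one_right (hβ0 j) (inv_cosh_pow_le_one τ _)) hβ
  unfold cylKernel
  linarith

lemma cylKernel_neg (β : ℕ → ℝ) (τ : ℝ) : cylKernel β (-τ) = cylKernel β τ := by
  simp [cylKernel, cosh_neg]

lemma cylKernel_le {β : ℕ → ℝ} (hβ0 : ∀ j, 0 ≤ β j) (τ : ℝ) :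
    cylKernel β τ ≤ |τ| / 2 + 1 / 2 * log 2 := by
  have h1 := log_two_mul_cosh_le τ
  have h2 : 0 ≤ ∑' j, β j * (cosh τ)⁻¹ ^ (2 * (j + 1)) :=
    tsum_nonneg fun j => mul_nonneg (hβ0 j) (pow_nonneg (inv_nonneg.2 (cosh_pos τ).le) _)
  unfold cylKernel
  linarith

/-! ### Conditional negativity of the kernel -/

/-- A bounded kernel that is a mixture of products `h ω t * h ω s` is positive semidefinite. -/
lemma integral_mixture_nonneg {Ω : Type*} [MeasurableSpace Ω] {ν : Measure Ω} [SFinite ν]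
    {w : Ω → ℝ} {h : Ω → ℝ → ℝ} (hw : Measurable w) (hh : Measurable (Function.uncurry h))
    (hw0 : ∀ ω, 0 ≤ w ω) (hh0 : ∀ ω t, 0 ≤ h ω t) {k : ℝ → ℝ → ℝ} {B : ℝ}
    (hki : ∀ t s, Integrable (fun ω => w ω * (h ω t * h ω s)) ν)
    (hk : ∀ t s, ∫ ω, w ω * (h ω t * h ω s) ∂ν = k t s) (hkB : ∀ t s, k t s ≤ B)
    {g : ℝ → ℝ} (hg : Integrable g) :
    0 ≤ ∫ p : ℝ × ℝ, k p.1 p.2 * (g p.1 * g p.2) ∂(volume.prod volume) := by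
  have hk0 : ∀ t s, 0 ≤ k t s := fun t s => by
    rw [← hk]
    exact integral_nonneg fun ω => mul_nonneg (hw0 ω) (mul_nonneg (hh0 ω t) (hh0 ω s))
  set F : ℝ × ℝ → Ω → ℝ := fun p ω => w ω * (h ω p.1 * h ω p.2) * (g p.1 * g p.2) with hF
  have hmw : Measurable fun q : (ℝ × ℝ) × Ω => w q.2 * (h q.2 q.1.1 * h q.2 q.1.2) := by
    have h1 : Measurable fun q : (ℝ × ℝ) × Ω => h q.2 q.1.1 :=
      hh.comp (measurable_snd.prodMk (measurable_fst.comp measurable_fst))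
    have h2 : Measurable fun q : (ℝ × ℝ) × Ω => h q.2 q.1.2 :=
      hh.comp (measurable_snd.prodMk (measurable_snd.comp measurable_fst))
    have h3 : Measurable fun q : (ℝ × ℝ) × Ω => w q.2 := hw.comp measurable_snd
    exact h3.mul (h1.mul h2)
  have hgg : Integrable (fun p : ℝ × ℝ => g p.1 * g p.2) (volume.prod volume) := hg.mul_prod hg
  have hFi : Integrable (Function.uncurry F) ((volume.prod volume).prod ν) := by
    have hFm : AEStronglyMeasurable (Function.uncurry F) ((volume.prod volume).prod ν) :=
      hmw.aestronglyMeasurable.mul hgg.aestronglyMeasurable.comp_fst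
    rw [integrable_prod_iff hFm]
    refine ⟨Eventually.of_forall fun p => (hki p.1 p.2).mul_const (g p.1 * g p.2), ?_⟩
    have e : ∀ p : ℝ × ℝ, ∫ ω, ‖F p ω‖ ∂ν = k p.1 p.2 * |g p.1 * g p.2| := by
      intro p
      rw [← hk, ← integral_mul_const]
      refine integral_congr_ae (Eventually.of_forall fun ω => ?_)
      simp only [hF]
      rw [norm_mul, Real.norm_of_nonneg (mul_nonneg (hw0 ω) (mul_nonneg (hh0 ω _) (hh0 ω _))),
        Real.norm_eq_abs]
    simp only [Function.uncurry]
    simp_rw [e]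
    refine (hgg.abs.const_mul B).mono' ?_ (Eventually.of_forall fun p => ?_)
    · refine AEStronglyMeasurable.mul ?_ hgg.abs.aestronglyMeasurable
      have : (fun p : ℝ × ℝ => k p.1 p.2) = fun p => ∫ ω, w ω * (h ω p.1 * h ω p.2) ∂ν := by
        ext p; rw [hk]
      rw [this]
      exact hmw.stronglyMeasurable.integral_prod_right'.aestronglyMeasurable
    · rw [Real.norm_of_nonneg (mul_nonneg (hk0 _ _) (abs_nonneg _))]
      exact mul_le_mul_of_nonneg_right (hkB _ _) (abs_nonneg _)
  have hswap := integral_integral_swap hFi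
  have hL : ∀ p : ℝ × ℝ, ∫ ω, F p ω ∂ν = k p.1 p.2 * (g p.1 * g p.2) := by
    intro p
    rw [← hk, ← integral_mul_const]
  simp_rw [hL] at hswap
  rw [hswap]
  refine integral_nonneg fun ω => ?_
  have : ∫ p : ℝ × ℝ, F p ω ∂(volume.prod volume) =
      w ω * ((∫ t, h ω t * g t) * ∫ s, h ω s * g s) := by
    rw [← integral_prod_mul, ← integral_const_mul]
    refine integral_congr_ae (Eventually.of_forall fun p => ?_)
    simp only [hF]
    ring
  simp only [this]
  exact mul_nonneg (hw0 ω) (mul_self_nonneg _)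

/-- Negative powers of `2 cosh (t - s)` are positive semidefinite kernels. -/
lemma integral_rpow_two_mul_cosh_nonneg {r : ℝ} (hr : 0 < r) {g : ℝ → ℝ} (hg : Integrable g) :
    0 ≤ ∫ p : ℝ × ℝ, (2 * cosh (p.1 - p.2)) ^ (-r) * (g p.1 * g p.2) ∂(volume.prod volume) := by
  have hG : 0 < Gamma r := Gamma_pos_of_pos hr
  have key : ∀ t s : ℝ, ∫ l in Ioi (0 : ℝ), l ^ (r - 1) *
      (rexp (r * t) * rexp (-(l * rexp (2 * t))) * (rexp (r * s) * rexp (-(l * rexp (2 * s))))) =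
      Gamma r * (2 * cosh (t - s)) ^ (-r) := by
    intro t s
    have hpos : 0 < rexp (2 * t) + rexp (2 * s) := by positivity
    have e : ∀ l : ℝ, l ^ (r - 1) *
        (rexp (r * t) * rexp (-(l * rexp (2 * t))) * (rexp (r * s) * rexp (-(l * rexp (2 * s))))) =
        rexp (r * (t + s)) * (l ^ (r - 1) * rexp (-((rexp (2 * t) + rexp (2 * s)) * l))) := by
      intro l
      have : rexp (-((rexp (2 * t) + rexp (2 * s)) * l)) =
          rexp (-(l * rexp (2 * t))) * rexp (-(l * rexp (2 * s))) := by
        rw [← Real.exp_add]; congr 1; ring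
      rw [this, mul_add, Real.exp_add]
      ring
    simp_rw [e]
    rw [integral_const_mul, Real.integral_rpow_mul_exp_neg_mul_Ioi hr hpos]
    have h1 : rexp (2 * t) + rexp (2 * s) = rexp (t + s) * (2 * cosh (t - s)) := by
      rw [Real.cosh_eq, mul_div_cancel₀ _ two_ne_zero, mul_add, ← Real.exp_add, ← Real.exp_add]
      congr 2 <;> ring
    have hc : 0 < 2 * cosh (t - s) := by have := cosh_pos (t - s); positivity
    rw [h1, one_div, inv_rpow (by positivity), mul_rpow (exp_pos _).le hc.le, ← Real.exp_mul,
      rpow_neg hc.le, mul_comm (t + s) r]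
    have := Real.exp_ne_zero (r * (t + s))
    field_simp
  have hmain := integral_mixture_nonneg (ν := volume.restrict (Ioi (0 : ℝ)))
    (w := fun l => |l| ^ (r - 1)) (h := fun l t => rexp (r * t) * rexp (-(l * rexp (2 * t))))
    (k := fun t s => Gamma r * (2 * cosh (t - s)) ^ (-r)) (B := Gamma r)
    (by fun_prop) (by fun_prop) (fun l => by positivity) (fun l t => by positivity)
    (fun t s => ?_) (fun t s => ?_) (fun t s => ?_) hg
  · have e : ∀ p : ℝ × ℝ, Gamma r * (2 * cosh (p.1 - p.2)) ^ (-r) * (g p.1 * g p.2) =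
        Gamma r * ((2 * cosh (p.1 - p.2)) ^ (-r) * (g p.1 * g p.2)) := fun p => by ring
    simp_rw [e] at hmain
    rw [integral_const_mul] at hmain
    exact nonneg_of_mul_nonneg_right hmain hG
  · have : IntegrableOn (fun l : ℝ => l ^ (r - 1) *
      (rexp (r * t) * rexp (-(l * rexp (2 * t))) * (rexp (r * s) * rexp (-(l * rexp (2 * s))))))
      (Ioi 0) := by
      by_contra hni
      have h := key t s
      rw [integral_undef hni] at h
      have hc : 0 < 2 * cosh (t - s) := by have := cosh_pos (t - s); positivity
      exact (mul_pos hG (rpow_pos_of_pos hc (-r))).ne h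
    refine this.congr_fun (fun l hl => ?_) measurableSet_Ioi
    have hl0 : 0 < l := hl
    simp only [abs_of_pos hl0]
  · rw [← key t s]
    refine setIntegral_congr_fun measurableSet_Ioi fun l hl => ?_
    have hl0 : 0 < l := hl
    simp only [abs_of_pos hl0]
  · refine mul_le_of_le_one_right hG.le (rpow_le_one_of_one_le_of_nonpos ?_ (by linarith))
    have := one_le_cosh (t - s)
    linarith

section
variable {f g : ℝ → ℝ}

lemma integrable_abs_mul_prod (hf : Integrable f) (hf1 : Integrable fun t => |t| * f t)
    (hg : Integrable g) (hg1 : Integrable fun t => |t| * g t) {k : ℝ → ℝ} (hk : Continuous k)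
    {a b : ℝ} (hkb : ∀ τ, |k τ| ≤ a * |τ| + b) (ha : 0 ≤ a) :
    Integrable (fun p : ℝ × ℝ => k (p.1 - p.2) * (f p.1 * g p.2)) (volume.prod volume) := by
  have i1 : Integrable (fun p : ℝ × ℝ => (|p.1| * f p.1) * g p.2) (volume.prod volume) :=
    hf1.mul_prod hg
  have i2 : Integrable (fun p : ℝ × ℝ => f p.1 * (|p.2| * g p.2)) (volume.prod volume) :=
    hf.mul_prod hg1
  have i3 : Integrable (fun p : ℝ × ℝ => f p.1 * g p.2) (volume.prod volume) := hf.mul_prod hg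
  refine (((i1.abs.const_mul a).add (i2.abs.const_mul a)).add (i3.abs.const_mul b)).mono'
    ((by fun_prop : Continuous fun p : ℝ × ℝ => k (p.1 - p.2)).aestronglyMeasurable.mul
      i3.aestronglyMeasurable) (Eventually.of_forall fun p => ?_)
  simp only [Pi.add_apply, Real.norm_eq_abs, abs_mul, abs_abs]
  have h1 : |p.1 - p.2| ≤ |p.1| + |p.2| := abs_sub _ _
  calc |k (p.1 - p.2)| * (|f p.1| * |g p.2|)
      ≤ (a * (|p.1| + |p.2|) + b) * (|f p.1| * |g p.2|) := by
        refine mul_le_mul_of_nonneg_right ((hkb _).trans ?_) (by positivity)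
        gcongr
    _ = _ := by ring

lemma integrable_abs_mul_shift (hg : Integrable g) (hg1 : Integrable fun t => |t| * g t)
    {k : ℝ → ℝ} (hk : Continuous k) {a b : ℝ} (hkb : ∀ τ, |k τ| ≤ a * |τ| + b) (ha : 0 ≤ a)
    (t : ℝ) : Integrable fun s => k (t - s) * g s := by
  refine ((hg1.abs.const_mul a).add (hg.abs.const_mul (a * |t| + b))).mono'
    ((by fun_prop : Continuous fun s : ℝ => k (t - s)).aestronglyMeasurable.mul
      hg.aestronglyMeasurable) (Eventually.of_forall fun s => ?_)
  simp only [Pi.add_apply, Real.norm_eq_abs, abs_mul, abs_abs]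
  have h1 : |t - s| ≤ |t| + |s| := abs_sub _ _
  calc |k (t - s)| * |g s| ≤ (a * (|t| + |s|) + b) * |g s| := by
        refine mul_le_mul_of_nonneg_right ((hkb _).trans ?_) (by positivity)
        gcongr
    _ = _ := by ring

end

/-- `log (2 cosh (t - s))` is conditionally negative semidefinite. -/
lemma integral_log_two_mul_cosh_nonpos {g : ℝ → ℝ} (hg : Integrable g)
    (hg1 : Integrable fun t => |t| * g t) (hg0 : ∫ t, g t = 0) :
    ∫ p : ℝ × ℝ, log (2 * cosh (p.1 - p.2)) * (g p.1 * g p.2) ∂(volume.prod volume) ≤ 0 := by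
  have hc : ∀ τ : ℝ, 1 ≤ 2 * cosh τ := fun τ => by have := one_le_cosh τ; linarith
  have hl0 : ∀ τ : ℝ, 0 ≤ log (2 * cosh τ) := fun τ => log_nonneg (hc τ)
  have hlc : Continuous fun τ : ℝ => log (2 * cosh τ) :=
    Continuous.log (by fun_prop) fun τ => (by linarith [hc τ] : 2 * cosh τ ≠ 0)
  have hi := integrable_abs_mul_prod hg hg1 hg hg1 hlc (a := 1) (b := log 2)
    (fun τ => by rw [abs_of_nonneg (hl0 τ), one_mul]; exact log_two_mul_cosh_le τ) zero_le_one
  set ε : ℕ → ℝ := fun k => 1 / ((k : ℝ) + 1) with hε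
  have hεpos : ∀ k, 0 < ε k := fun k => by positivity
  have hε0 : Tendsto ε atTop (𝓝 0) := tendsto_one_div_add_atTop_nhds_zero_nat
  have hrp : ∀ (k : ℕ) (τ : ℝ), (2 * cosh τ) ^ (-ε k) = rexp (-(ε k * log (2 * cosh τ))) := by
    intro k τ
    rw [rpow_def_of_pos (by linarith [hc τ])]
    congr 1; ring
  have hgg : Integrable (fun p : ℝ × ℝ => g p.1 * g p.2) (volume.prod volume) := hg.mul_prod hg
  have hlim : Tendsto (fun k => ∫ p : ℝ × ℝ,
      ((ε k)⁻¹ * (1 - (2 * cosh (p.1 - p.2)) ^ (-ε k))) * (g p.1 * g p.2) ∂(volume.prod volume))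
      atTop (𝓝 (∫ p : ℝ × ℝ, log (2 * cosh (p.1 - p.2)) * (g p.1 * g p.2)
        ∂(volume.prod volume))) := by
    refine tendsto_integral_of_dominated_convergence
      (fun p : ℝ × ℝ => |log (2 * cosh (p.1 - p.2)) * (g p.1 * g p.2)|) (fun k => ?_) hi.abs
      (fun k => Eventually.of_forall fun p => ?_) (Eventually.of_forall fun p => ?_)
    · refine AEStronglyMeasurable.mul (Measurable.aestronglyMeasurable ?_) hgg.aestronglyMeasurable
      fun_prop
    · rw [norm_mul, abs_mul, Real.norm_eq_abs, Real.norm_eq_abs]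
      refine mul_le_mul_of_nonneg_right ?_ (abs_nonneg _)
      have h1 := Real.add_one_le_exp (-(ε k * log (2 * cosh (p.1 - p.2))))
      have h2 : rexp (-(ε k * log (2 * cosh (p.1 - p.2)))) ≤ 1 :=
        Real.exp_le_one_iff.2 (by have := mul_nonneg (hεpos k).le (hl0 (p.1 - p.2)); linarith)
      rw [hrp, abs_of_nonneg (hl0 _), abs_of_nonneg (mul_nonneg (inv_nonneg.2 (hεpos k).le)
        (by linarith)), ← div_eq_inv_mul, div_le_iff₀ (hεpos k)]
      linarith
    · refine Tendsto.mul_const _ ?_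
      set L := log (2 * cosh (p.1 - p.2))
      have hder : HasDerivAt (fun x : ℝ => 1 - rexp (-(x * L))) L 0 := by
        have := (((hasDerivAt_id (0 : ℝ)).mul_const L).neg.exp).const_sub 1
        simpa using this
      have hb0' : Tendsto ε atTop (𝓝[≠] 0) :=
        tendsto_nhdsWithin_iff.2 ⟨hε0, Eventually.of_forall fun k => (hεpos k).ne'⟩
      have := (hasDerivAt_iff_tendsto_slope_zero.1 hder).comp hb0'
      simp only [hrp]
      simpa [Function.comp_def] using this
  refine le_of_tendsto hlim (Eventually.of_forall fun k => ?_)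
  have h1 := integral_rpow_two_mul_cosh_nonneg (hεpos k) hg
  have hi2 : Integrable (fun p : ℝ × ℝ => (2 * cosh (p.1 - p.2)) ^ (-ε k) * (g p.1 * g p.2))
      (volume.prod volume) := by
    refine hgg.bdd_mul (c := 1) (Measurable.aestronglyMeasurable (by fun_prop))
      (Eventually.of_forall fun p => ?_)
    rw [Real.norm_of_nonneg (rpow_nonneg (by linarith [hc (p.1 - p.2)]) _)]
    exact rpow_le_one_of_one_le_of_nonpos (hc _) (by linarith [hεpos k])
  have e : ∀ p : ℝ × ℝ,
      ((ε k)⁻¹ * (1 - (2 * cosh (p.1 - p.2)) ^ (-ε k))) * (g p.1 * g p.2) =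
      (ε k)⁻¹ * (g p.1 * g p.2 - (2 * cosh (p.1 - p.2)) ^ (-ε k) * (g p.1 * g p.2)) :=
    fun p => by ring
  simp_rw [e]
  rw [integral_const_mul, integral_sub hgg hi2, integral_prod_mul, hg0, zero_mul, zero_sub]
  exact mul_nonpos_of_nonneg_of_nonpos (inv_nonneg.2 (hεpos k).le) (by linarith)

/-- The cylindrical kernel is conditionally negative semidefinite. -/
lemma integral_cylKernel_nonpos {β : ℕ → ℝ} (hβ0 : ∀ j, 0 ≤ β j) (hβ : Summable β)
    {g : ℝ → ℝ} (hg : Integrable g) (hg1 : Integrable fun t => |t| * g t)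
    (hg0 : ∫ t, g t = 0) :
    ∫ p : ℝ × ℝ, cylKernel β (p.1 - p.2) * (g p.1 * g p.2) ∂(volume.prod volume) ≤ 0 := by
  have hc : ∀ τ : ℝ, 1 ≤ 2 * cosh τ := fun τ => by have := one_le_cosh τ; linarith
  have hlc : Continuous fun τ : ℝ => log (2 * cosh τ) :=
    Continuous.log (by fun_prop) fun τ => (by linarith [hc τ] : 2 * cosh τ ≠ 0)
  have hi := integrable_abs_mul_prod hg hg1 hg hg1 hlc (a := 1) (b := log 2)
    (fun τ => by
      rw [abs_of_nonneg (log_nonneg (hc τ)), one_mul]; exact log_two_mul_cosh_le τ) zero_le_one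
  have hgg : Integrable (fun p : ℝ × ℝ => g p.1 * g p.2) (volume.prod volume) := hg.mul_prod hg
  set F : ℕ → ℝ × ℝ → ℝ := fun j p =>
    β j * (cosh (p.1 - p.2))⁻¹ ^ (2 * (j + 1)) * (g p.1 * g p.2) with hF
  have hFb : ∀ j p, ‖F j p‖ ≤ β j * |g p.1 * g p.2| := by
    intro j p
    have h0 : 0 ≤ β j * (cosh (p.1 - p.2))⁻¹ ^ (2 * (j + 1)) :=
      mul_nonneg (hβ0 j) (pow_nonneg (inv_nonneg.2 (cosh_pos _).le) _)
    rw [hF, norm_mul, Real.norm_of_nonneg h0, Real.norm_eq_abs]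
    exact mul_le_mul_of_nonneg_right
      (mul_le_of_le_one_right (hβ0 j) (inv_cosh_pow_le_one _ _)) (abs_nonneg _)
  have hFi : ∀ j, Integrable (F j) (volume.prod volume) := fun j =>
    (hgg.abs.const_mul (β j)).mono' ((Measurable.aestronglyMeasurable (by fun_prop)).mul
      hgg.aestronglyMeasurable) (Eventually.of_forall (hFb j))
  have hsum : Summable fun j => ∫ p, ‖F j p‖ ∂(volume.prod volume) := by
    refine (hβ.mul_right (∫ p : ℝ × ℝ, |g p.1 * g p.2| ∂(volume.prod volume))).of_nonneg_of_le
      (fun j => integral_nonneg fun p => norm_nonneg _) fun j => ?_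
    rw [← integral_const_mul]
    exact integral_mono (hFi j).norm (hgg.abs.const_mul _) (hFb j)
  have hHS := hasSum_integral_of_summable_integral_norm hFi hsum
  have hpos : ∀ j, 0 ≤ ∫ p, F j p ∂(volume.prod volume) := by
    intro j
    have h1 := integral_rpow_two_mul_cosh_nonneg (r := (2 * (j + 1) : ℕ)) (by positivity) hg
    have e : ∀ p, F j p = (β j * 2 ^ (2 * (j + 1))) *
        ((2 * cosh (p.1 - p.2)) ^ (-((2 * (j + 1) : ℕ) : ℝ)) * (g p.1 * g p.2)) := by
      intro p
      rw [rpow_neg (by linarith [hc (p.1 - p.2)]), rpow_natCast, mul_pow, hF]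
      simp only [inv_pow]
      have := (cosh_pos (p.1 - p.2)).ne'
      field_simp
    simp_rw [e]
    rw [integral_const_mul]
    exact mul_nonneg (mul_nonneg (hβ0 j) (by positivity)) h1
  have hT : ∀ p : ℝ × ℝ, ∑' j, F j p =
      (∑' j, β j * (cosh (p.1 - p.2))⁻¹ ^ (2 * (j + 1))) * (g p.1 * g p.2) := fun p => tsum_mul_right
  have hTi : Integrable (fun p : ℝ × ℝ => ∑' j, F j p) (volume.prod volume) := by
    refine (hgg.abs.const_mul (∑' j, β j)).mono' ?_ (Eventually.of_forall fun p => ?_)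
    · simp_rw [hT]
      refine AEStronglyMeasurable.mul ?_ hgg.aestronglyMeasurable
      have hcont : Continuous fun τ : ℝ => ∑' j, β j * (cosh τ)⁻¹ ^ (2 * (j + 1)) := by
        refine continuous_tsum (u := β) (fun j => ?_) hβ fun j τ => ?_
        · exact continuous_const.mul ((continuous_cosh.inv₀ fun τ => (cosh_pos τ).ne').pow _)
        · rw [Real.norm_of_nonneg
            (mul_nonneg (hβ0 j) (pow_nonneg (inv_nonneg.2 (cosh_pos τ).le) _))]
          exact mul_le_of_le_one_right (hβ0 j) (inv_cosh_pow_le_one τ _)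
      exact (hcont.comp (continuous_fst.sub continuous_snd)).aestronglyMeasurable
    · rw [hT, norm_mul, Real.norm_eq_abs (_ * _), Real.norm_of_nonneg (tsum_nonneg fun j =>
        mul_nonneg (hβ0 j) (pow_nonneg (inv_nonneg.2 (cosh_pos _).le) _))]
      exact mul_le_mul_of_nonneg_right ((summable_cylKernel hβ0 hβ _).tsum_le_tsum
        (fun j => mul_le_of_le_one_right (hβ0 j) (inv_cosh_pow_le_one _ _)) hβ) (abs_nonneg _)
  have e : ∀ p : ℝ × ℝ, cylKernel β (p.1 - p.2) * (g p.1 * g p.2) =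
      1 / 2 * (log (2 * cosh (p.1 - p.2)) * (g p.1 * g p.2)) - ∑' j, F j p := by
    intro p
    rw [hT, cylKernel]
    ring
  simp_rw [e]
  rw [integral_sub (hi.const_mul _) hTi, integral_const_mul, ← hHS.tsum_eq]
  have h1 := integral_log_two_mul_cosh_nonpos hg hg1 hg0
  have h2 : 0 ≤ ∑' j, ∫ p, F j p ∂(volume.prod volume) := tsum_nonneg hpos
  linarith

/-! ### Mean-field equations on the line -/

/-- An even continuous kernel which is `|τ| / 2` up to a bounded error and conditionally negative
semidefinite. -/
structure IsLogKernel (K : ℝ → ℝ) (C : ℝ) : Prop where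
  cont : Continuous K
  even : ∀ τ, K (-τ) = K τ
  lower : ∀ τ, |τ| / 2 - C ≤ K τ
  upper : ∀ τ, K τ ≤ |τ| / 2 + C
  condNeg : ∀ g : ℝ → ℝ, Integrable g → (Integrable fun t => |t| * g t) → ∫ t, g t = 0 →
    ∫ p : ℝ × ℝ, K (p.1 - p.2) * (g p.1 * g p.2) ∂(volume.prod volume) ≤ 0

/-- An external field bounded above by `D - c |t|`. -/
structure IsField (W : ℝ → ℝ) (c D : ℝ) : Prop where
  meas : Measurable W
  nonneg : 0 ≤ c
  le : ∀ t, W t ≤ D - c * |t|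

/-- A probability density on the line with finite first moment. -/
structure IsDens (q : ℝ → ℝ) : Prop where
  meas : Measurable q
  nonneg : ∀ t, 0 ≤ q t
  int : Integrable q
  mom : Integrable fun t => |t| * q t
  mass : ∫ t, q t = 1

/-- The potential `K * q`. -/
noncomputable def linePot (K q : ℝ → ℝ) (t : ℝ) : ℝ := ∫ s, K (t - s) * q s

/-- The interaction form `∬ K (t - s) f t g s`. -/
noncomputable def pairing (K f g : ℝ → ℝ) : ℝ :=
  ∫ p : ℝ × ℝ, K (p.1 - p.2) * (f p.1 * g p.2) ∂(volume.prod volume)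

/-- The logarithm of the partition function of the field `W - κ (K * q)`. -/
noncomputable def logZ (K W : ℝ → ℝ) (κ : ℝ) (q : ℝ → ℝ) : ℝ :=
  log (∫ t, rexp (W t - κ * linePot K q t))

/-- The Gibbs density of the field `W - κ (K * q)`. A solution of the mean-field equation is a
fixed point of this map. -/
noncomputable def gibbs (K W : ℝ → ℝ) (κ : ℝ) (q : ℝ → ℝ) (t : ℝ) : ℝ :=
  rexp (W t - κ * linePot K q t - logZ K W κ q)

lemma integrable_exp_neg_mul_abs {a : ℝ} (ha : 0 < a) : Integrable fun t : ℝ => rexp (-a * |t|) := by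
  have h := (integrable_fun_norm_addHaar (E := ℝ) volume (f := fun r => rexp (-a * r))).2
  refine h ?_
  simpa using exp_neg_integrableOn_Ioi 0 ha

lemma integral_exp_neg_mul_abs {a : ℝ} (ha : 0 < a) : ∫ t : ℝ, rexp (-a * |t|) = 2 / a := by
  rw [integral_comp_abs (f := fun r => rexp (-a * r)), integral_exp_mul_Ioi (by linarith)]
  simp
  field_simp

lemma integrable_abs_mul_exp_neg_mul_abs {a : ℝ} (ha : 0 < a) :
    Integrable fun t : ℝ => |t| * rexp (-a * |t|) := by
  refine ((integrable_exp_neg_mul_abs (half_pos ha)).const_mul (2 / a)).mono'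
    (Measurable.aestronglyMeasurable (by fun_prop)) (Eventually.of_forall fun t => ?_)
  rw [Real.norm_of_nonneg (by positivity)]
  have h1 : a / 2 * |t| ≤ rexp (a / 2 * |t|) := by
    have := Real.add_one_le_exp (a / 2 * |t|); linarith
  have h2 : rexp (-a * |t|) = rexp (-(a / 2) * |t|) * (rexp (a / 2 * |t|))⁻¹ := by
    rw [← Real.exp_neg, ← Real.exp_add]; congr 1; ring
  rw [h2]
  have h3 : |t| * (rexp (a / 2 * |t|))⁻¹ ≤ 2 / a := by
    rw [← div_eq_mul_inv, div_le_div_iff₀ (Real.exp_pos _) ha]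
    linarith
  calc |t| * (rexp (-(a / 2) * |t|) * (rexp (a / 2 * |t|))⁻¹)
      = |t| * (rexp (a / 2 * |t|))⁻¹ * rexp (-(a / 2) * |t|) := by ring
    _ ≤ _ := by gcongr

section
variable {K W q p : ℝ → ℝ} {C c D κ : ℝ}

lemma IsLogKernel.abs_le (hK : IsLogKernel K C) (τ : ℝ) : |K τ| ≤ 1 / 2 * |τ| + C := by
  have h1 := hK.lower τ
  have h2 := hK.upper τ
  rw [_root_.abs_le]
  constructor <;> linarith [abs_nonneg τ]

lemma IsLogKernel.integrable_shift (hK : IsLogKernel K C) (hq : Integrable q)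
    (hq1 : Integrable fun t => |t| * q t) (t : ℝ) : Integrable fun s => K (t - s) * q s :=
  integrable_abs_mul_shift hq hq1 hK.cont hK.abs_le (by norm_num) t

lemma IsLogKernel.integrable_prod (hK : IsLogKernel K C) (hp : Integrable p)
    (hp1 : Integrable fun t => |t| * p t) (hq : Integrable q)
    (hq1 : Integrable fun t => |t| * q t) :
    Integrable (fun r : ℝ × ℝ => K (r.1 - r.2) * (p r.1 * q r.2)) (volume.prod volume) :=
  integrable_abs_mul_prod hp hp1 hq hq1 hK.cont hK.abs_le (by norm_num)

lemma measurable_linePot (hK : IsLogKernel K C) (hq : Measurable q) : Measurable (linePot K q) := by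
  have : Measurable fun r : ℝ × ℝ => K (r.1 - r.2) * q r.2 := by
    have := hK.cont.measurable
    fun_prop
  exact this.stronglyMeasurable.integral_prod_right.measurable

lemma pairing_eq (hK : IsLogKernel K C) (hp : IsDens p) (hq : IsDens q) :
    (Integrable fun t => p t * linePot K q t) ∧ pairing K p q = ∫ t, p t * linePot K q t := by
  have hi := hK.integrable_prod hp.int hp.mom hq.int hq.mom
  have e : ∀ t, ∫ s, K (t - s) * (p t * q s) = p t * linePot K q t := by
    intro t
    rw [linePot, ← integral_const_mul]
    congr 1
    ext s
    ring
  constructor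
  · exact hi.integral_prod_left.congr (Eventually.of_forall e)
  · rw [pairing, integral_prod _ hi]
    simp only [e]

lemma pairing_symm (hK : IsLogKernel K C) (f g : ℝ → ℝ) : pairing K f g = pairing K g f := by
  rw [pairing, ← integral_prod_swap, pairing]
  refine integral_congr_ae (Eventually.of_forall fun r => ?_)
  simp only [Prod.fst_swap, Prod.snd_swap]
  rw [← hK.even, neg_sub]
  ring

/-- Conditional negativity of the kernel on the difference of two densities, in polarized form. -/
lemma pairing_le (hK : IsLogKernel K C) (hp : IsDens p) (hq : IsDens q) :
    pairing K p p + pairing K q q ≤ 2 * pairing K p q := by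
  have h := hK.condNeg (fun t => p t - q t) (hp.int.sub hq.int)
    (by simp only [mul_sub]; exact hp.mom.sub hq.mom)
    (by rw [integral_sub hp.int hq.int, hp.mass, hq.mass, sub_self])
  have ipp := hK.integrable_prod hp.int hp.mom hp.int hp.mom
  have ipq := hK.integrable_prod hp.int hp.mom hq.int hq.mom
  have iqp := hK.integrable_prod hq.int hq.mom hp.int hp.mom
  have iqq := hK.integrable_prod hq.int hq.mom hq.int hq.mom
  have e : ∀ r : ℝ × ℝ, K (r.1 - r.2) * ((p r.1 - q r.1) * (p r.2 - q r.2)) =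
      (K (r.1 - r.2) * (p r.1 * p r.2) - K (r.1 - r.2) * (p r.1 * q r.2)) -
      (K (r.1 - r.2) * (q r.1 * p r.2) - K (r.1 - r.2) * (q r.1 * q r.2)) := fun r => by ring
  simp_rw [e] at h
  have i1 : Integrable (fun r : ℝ × ℝ => K (r.1 - r.2) * (p r.1 * p r.2) -
    K (r.1 - r.2) * (p r.1 * q r.2)) (volume.prod volume) := ipp.sub ipq
  have i2 : Integrable (fun r : ℝ × ℝ => K (r.1 - r.2) * (q r.1 * p r.2) -
    K (r.1 - r.2) * (q r.1 * q r.2)) (volume.prod volume) := iqp.sub iqq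
  rw [integral_sub i1 i2, integral_sub ipp ipq, integral_sub iqp iqq] at h
  change pairing K p p - pairing K p q - (pairing K q p - pairing K q q) ≤ 0 at h
  rw [pairing_symm hK q p] at h
  linarith

lemma linePot_bounds (hK : IsLogKernel K C) (hq : IsDens q) (t : ℝ) :
    |t| / 2 - (∫ s, |s| * q s) / 2 - C ≤ linePot K q t ∧
      linePot K q t ≤ |t| / 2 + (∫ s, |s| * q s) / 2 + C := by
  have hi := hK.integrable_shift hq.int hq.mom t
  have il : Integrable fun s => (|t| / 2 - C) * q s - 1 / 2 * (|s| * q s) :=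
    (hq.int.const_mul _).sub (hq.mom.const_mul _)
  have iu : Integrable fun s => (|t| / 2 + C) * q s + 1 / 2 * (|s| * q s) :=
    (hq.int.const_mul _).add (hq.mom.const_mul _)
  constructor
  · have h := integral_mono il hi fun s => ?_
    · rw [integral_sub (hq.int.const_mul _) (hq.mom.const_mul _), integral_const_mul,
        integral_const_mul, hq.mass] at h
      unfold linePot
      linarith
    · have h1 : |t| - |s| ≤ |t - s| := abs_sub_abs_le_abs_sub t s
      have h2 := hK.lower (t - s)
      calc (|t| / 2 - C) * q s - 1 / 2 * (|s| * q s) = ((|t| - |s|) / 2 - C) * q s := by ring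
        _ ≤ K (t - s) * q s := mul_le_mul_of_nonneg_right (by linarith) (hq.nonneg s)
  · have h := integral_mono hi iu fun s => ?_
    · rw [integral_add (hq.int.const_mul _) (hq.mom.const_mul _), integral_const_mul,
        integral_const_mul, hq.mass] at h
      unfold linePot
      linarith
    · have h1 : |t - s| ≤ |t| + |s| := abs_sub _ _
      have h2 := hK.upper (t - s)
      calc K (t - s) * q s ≤ ((|t| + |s|) / 2 + C) * q s :=
            mul_le_mul_of_nonneg_right (by linarith) (hq.nonneg s)
        _ = _ := by ring

lemma IsField.le_const (hW : IsField W c D) (t : ℝ) : W t ≤ D := by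
  have := hW.le t
  have := mul_nonneg hW.nonneg (abs_nonneg t)
  linarith

lemma exp_field_sub_le (hW : IsField W c D) (hκ : 0 < κ) {U t b : ℝ} (hU : |t| / 2 - b ≤ U) :
    rexp (W t - κ * U) ≤ rexp (D + κ * b) * rexp (-(κ / 2) * |t|) := by
  rw [← Real.exp_add]
  refine Real.exp_le_exp.2 ?_
  have h1 := hW.le_const t
  have h2 := mul_le_mul_of_nonneg_left hU hκ.le
  linarith

lemma integrable_exp_field (hW : IsField W c D) (hκ : 0 < κ) {U : ℝ → ℝ} (hUm : Measurable U)
    {b : ℝ} (hU : ∀ t, |t| / 2 - b ≤ U t) : Integrable fun t => rexp (W t - κ * U t) := by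
  have := hW.meas
  refine ((integrable_exp_neg_mul_abs (half_pos hκ)).const_mul (rexp (D + κ * b))).mono'
    (Measurable.aestronglyMeasurable (by fun_prop)) (Eventually.of_forall fun t => ?_)
  rw [Real.norm_of_nonneg (Real.exp_pos _).le]
  exact exp_field_sub_le hW hκ (hU t)

lemma integrable_exp_linePot (hK : IsLogKernel K C) (hW : IsField W c D) (hκ : 0 < κ)
    (hq : IsDens q) : Integrable fun t => rexp (W t - κ * linePot K q t) :=
  integrable_exp_field hW hκ (measurable_linePot hK hq.meas) (b := (∫ s, |s| * q s) / 2 + C)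
    fun t => by linarith [(linePot_bounds hK hq t).1]

/-- A lower bound for the partition function of densities with first moment at most `m`. -/
noncomputable def minZ (W : ℝ → ℝ) (κ C m : ℝ) : ℝ :=
  ∫ t, rexp (W t - κ * (|t| / 2 + m / 2 + C))

lemma minZ_pos (hW : IsField W c D) (hκ : 0 < κ) (m : ℝ) : 0 < minZ W κ C m :=
  integral_exp_pos (integrable_exp_field hW hκ (U := fun t => |t| / 2 + m / 2 + C) (by fun_prop)
    (b := -(m / 2 + C)) fun t => by linarith)

lemma minZ_le (hK : IsLogKernel K C) (hW : IsField W c D) (hκ : 0 < κ) (hq : IsDens q) {m : ℝ}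
    (hm : ∫ s, |s| * q s ≤ m) : minZ W κ C m ≤ ∫ t, rexp (W t - κ * linePot K q t) := by
  refine integral_mono (integrable_exp_field hW hκ (U := fun t => |t| / 2 + m / 2 + C)
    (by fun_prop) (b := -(m / 2 + C)) fun t => by linarith)
    (integrable_exp_linePot hK hW hκ hq) fun t => ?_
  refine Real.exp_le_exp.2 ?_
  have := mul_le_mul_of_nonneg_left (linePot_bounds hK hq t).2 hκ.le
  nlinarith

lemma exp_logZ (hK : IsLogKernel K C) (hW : IsField W c D) (hκ : 0 < κ) (hq : IsDens q) :
    rexp (logZ K W κ q) = ∫ t, rexp (W t - κ * linePot K q t) :=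
  Real.exp_log (integral_exp_pos (integrable_exp_linePot hK hW hκ hq))

lemma gibbs_eq (hK : IsLogKernel K C) (hW : IsField W c D) (hκ : 0 < κ) (hq : IsDens q) (t : ℝ) :
    gibbs K W κ q t =
      rexp (W t - κ * linePot K q t) / ∫ t, rexp (W t - κ * linePot K q t) := by
  rw [gibbs, Real.exp_sub, exp_logZ hK hW hκ hq]

lemma gibbs_le (hK : IsLogKernel K C) (hW : IsField W c D) (hκ : 0 < κ) (hq : IsDens q) {m : ℝ}
    (hm : ∫ s, |s| * q s ≤ m) (t : ℝ) :
    gibbs K W κ q t ≤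
      rexp (D + κ * (m / 2 + C)) / minZ W κ C m * rexp (-(κ / 2) * |t|) := by
  rw [gibbs_eq hK hW hκ hq, div_mul_eq_mul_div]
  have h := (linePot_bounds hK hq t).1
  exact div_le_div₀ (by positivity) (exp_field_sub_le hW hκ (by linarith)) (minZ_pos hW hκ m)
    (minZ_le hK hW hκ hq hm)

lemma measurable_gibbs (hK : IsLogKernel K C) (hW : IsField W c D) (hq : Measurable q) :
    Measurable (gibbs K W κ q) := by
  have h1 := measurable_linePot hK hq
  have h2 := hW.meas
  unfold gibbs
  fun_prop

/-- Densities with an exponential bound have finite first moment. -/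
lemma isDens_of_le (hm : Measurable p) (h0 : ∀ t, 0 ≤ p t) {a F : ℝ} (ha : 0 < a)
    (hF : ∀ t, p t ≤ F * rexp (-a * |t|)) (h1 : ∫ t, p t = 1) : IsDens p where
  meas := hm
  nonneg := h0
  int := ((integrable_exp_neg_mul_abs ha).const_mul F).mono' hm.aestronglyMeasurable
    (Eventually.of_forall fun t => by rw [Real.norm_of_nonneg (h0 t)]; exact hF t)
  mom := ((integrable_abs_mul_exp_neg_mul_abs ha).const_mul F).mono'
    (Measurable.aestronglyMeasurable (by fun_prop)) (Eventually.of_forall fun t => by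
      rw [Real.norm_of_nonneg (mul_nonneg (abs_nonneg t) (h0 t))]
      calc |t| * p t ≤ |t| * (F * rexp (-a * |t|)) :=
            mul_le_mul_of_nonneg_left (hF t) (abs_nonneg t)
        _ = _ := by ring)
  mass := h1

lemma isDens_gibbs (hK : IsLogKernel K C) (hW : IsField W c D) (hκ : 0 < κ) (hq : IsDens q) :
    IsDens (gibbs K W κ q) := by
  refine isDens_of_le (measurable_gibbs hK hW hq.meas) (fun t => (Real.exp_pos _).le)
    (half_pos hκ) (gibbs_le hK hW hκ hq le_rfl) ?_
  simp_rw [gibbs_eq hK hW hκ hq]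
  rw [integral_div, div_self (integral_exp_pos (integrable_exp_linePot hK hW hκ hq)).ne']

lemma linePot_even (hK : IsLogKernel K C) (hq : ∀ t, q (-t) = q t) (t : ℝ) :
    linePot K q (-t) = linePot K q t := by
  rw [linePot, ← integral_neg_eq_self, linePot]
  refine integral_congr_ae (Eventually.of_forall fun s => ?_)
  beta_reduce
  rw [hq, ← hK.even]
  congr 2
  ring

/-! ### Energy along the Gibbs iteration -/

/-- The dual free energy, in which the density enters only through its potential and its
interaction energy. It lies between consecutive values of `gibbsEnergy` along the iteration of the
Gibbs map. -/
noncomputable def dualEnergy (K W : ℝ → ℝ) (κ : ℝ) (q : ℝ → ℝ) : ℝ :=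
  -logZ K W κ q - κ / 2 * pairing K q q

/-- The free energy of the Gibbs density of `q`. The entropy and the field have been eliminated
with the explicit formula for the Gibbs density. -/
noncomputable def gibbsEnergy (K W : ℝ → ℝ) (κ : ℝ) (q : ℝ → ℝ) : ℝ :=
  -logZ K W κ q - κ * pairing K (gibbs K W κ q) q +
    κ / 2 * pairing K (gibbs K W κ q) (gibbs K W κ q)

lemma gibbsEnergy_le_dualEnergy (hK : IsLogKernel K C) (hW : IsField W c D) (hκ : 0 < κ)
    (hq : IsDens q) : gibbsEnergy K W κ q ≤ dualEnergy K W κ q := by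
  have h := pairing_le hK (isDens_gibbs hK hW hκ hq) hq
  unfold gibbsEnergy dualEnergy
  nlinarith

lemma mul_log_sub_log_ge {x y : ℝ} (hx : 0 < x) (hy : 0 < y) :
    (√x - √y) ^ 2 + x - y ≤ x * (log x - log y) := by
  have hsx := Real.sqrt_pos.2 hx
  have hsy := Real.sqrt_pos.2 hy
  have h1 := Real.log_le_sub_one_of_pos (div_pos hsy hsx)
  rw [log_div hsy.ne' hsx.ne', log_sqrt hx.le, log_sqrt hy.le] at h1
  have hx2 := Real.sq_sqrt hx.le
  have hy2 := Real.sq_sqrt hy.le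
  have h2 : x * (√y / √x) = √x * √y := by
    rw [← hx2]; field_simp; rw [Real.sqrt_sq hsx.le]
  have h3 := mul_le_mul_of_nonneg_left h1 hx.le
  nlinarith

lemma integrable_sqrt_sub_sq (hp : IsDens p) (hq : IsDens q) :
    Integrable fun t => (√(p t) - √(q t)) ^ 2 := by
  have h1 := hp.meas
  have h2 := hq.meas
  refine ((hp.int.add hq.int)).mono' (Measurable.aestronglyMeasurable (by fun_prop))
    (Eventually.of_forall fun t => ?_)
  rw [Real.norm_of_nonneg (sq_nonneg _), Pi.add_apply]
  nlinarith [Real.sq_sqrt (hp.nonneg t), Real.sq_sqrt (hq.nonneg t), Real.sqrt_nonneg (p t),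
    Real.sqrt_nonneg (q t), mul_nonneg (Real.sqrt_nonneg (p t)) (Real.sqrt_nonneg (q t))]

/-- One step of the iteration lowers the energy by at least a squared Hellinger distance. -/
lemma hellinger_le (hK : IsLogKernel K C) (hW : IsField W c D) (hκ : 0 < κ) (hq : IsDens q) :
    ∫ t, (√(gibbs K W κ q t) - √(gibbs K W κ (gibbs K W κ q) t)) ^ 2 ≤
      gibbsEnergy K W κ q - dualEnergy K W κ (gibbs K W κ q) := by
  set p := gibbs K W κ q with hp_def
  have hp : IsDens p := isDens_gibbs hK hW hκ hq
  set p' := gibbs K W κ p with hp'_def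
  have hp' : IsDens p' := isDens_gibbs hK hW hκ hp
  have ipp := (pairing_eq hK hp hp).1
  have ipq := (pairing_eq hK hp hq).1
  have hpt : ∀ t, (√(p t) - √(p' t)) ^ 2 + p t - p' t ≤
      κ * (p t * linePot K p t) - κ * (p t * linePot K q t) +
        (logZ K W κ p - logZ K W κ q) * p t := by
    intro t
    have h := mul_log_sub_log_ge (x := p t) (y := p' t) (Real.exp_pos _) (Real.exp_pos _)
    refine h.trans (le_of_eq ?_)
    have e1 : log (p t) = W t - κ * linePot K q t - logZ K W κ q := Real.log_exp _
    have e2 : log (p' t) = W t - κ * linePot K p t - logZ K W κ p := Real.log_exp _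
    rw [e1, e2]
    ring
  have i0 := integrable_sqrt_sub_sq hp hp'
  have i1 : Integrable fun t => (√(p t) - √(p' t)) ^ 2 + p t := i0.add hp.int
  have i2 : Integrable fun t => κ * (p t * linePot K p t) - κ * (p t * linePot K q t) :=
    (ipp.const_mul κ).sub (ipq.const_mul κ)
  have h := integral_mono (i1.sub hp'.int) (i2.add (hp.int.const_mul _)) hpt
  simp only [Pi.sub_apply, Pi.add_apply] at h
  rw [integral_sub i1 hp'.int, integral_add i0 hp.int, integral_add i2 (hp.int.const_mul _),
    integral_sub (ipp.const_mul κ) (ipq.const_mul κ), integral_const_mul, integral_const_mul,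
    integral_const_mul, hp.mass, hp'.mass, ← (pairing_eq hK hp hp).2, ← (pairing_eq hK hp hq).2]
    at h
  unfold gibbsEnergy dualEnergy
  rw [← hp_def]
  linarith

/-- Gibbs' inequality against the density `a/2 exp (-a |t|)` controls the first moment. -/
lemma moment_le_gibbsEnergy (hK : IsLogKernel K C) (hW : IsField W c D) (hκ : 0 < κ)
    (hq : IsDens q) {a : ℝ} (ha : 0 < a) :
    (c - a) * ∫ t, |t| * gibbs K W κ q t ≤
      D - log (a / 2) + gibbsEnergy K W κ q -
        κ / 2 * pairing K (gibbs K W κ q) (gibbs K W κ q) := by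
  set p := gibbs K W κ q with hp_def
  have hp : IsDens p := isDens_gibbs hK hW hκ hq
  have ipq := (pairing_eq hK hp hq).1
  have hpt : ∀ t, (log (a / 2) - D + logZ K W κ q) * p t + (c - a) * (|t| * p t) +
      κ * (p t * linePot K q t) ≤ a / 2 * rexp (-a * |t|) - p t := by
    intro t
    have hp0 : 0 < p t := Real.exp_pos _
    have hr0 : 0 < a / 2 * rexp (-a * |t|) := by positivity
    have h1 := Real.log_le_sub_one_of_pos (div_pos hr0 hp0)
    have e1 : log (p t) = W t - κ * linePot K q t - logZ K W κ q := Real.log_exp _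
    rw [log_div hr0.ne' hp0.ne', log_mul (by positivity) (Real.exp_pos _).ne', Real.log_exp, e1]
      at h1
    have h2 := hW.le t
    have h3 : log (a / 2) - a * |t| - (D - c * |t|) + κ * linePot K q t + logZ K W κ q ≤
        a / 2 * rexp (-a * |t|) / p t - 1 := by linarith
    have h4 := mul_le_mul_of_nonneg_right h3 hp0.le
    have h5 : (a / 2 * rexp (-a * |t|) / p t - 1) * p t = a / 2 * rexp (-a * |t|) - p t := by
      field_simp
    rw [h5] at h4
    linarith
  have ie := (integrable_exp_neg_mul_abs ha).const_mul (a / 2)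
  have i1 : Integrable fun t => (log (a / 2) - D + logZ K W κ q) * p t + (c - a) * (|t| * p t) :=
    (hp.int.const_mul _).add (hp.mom.const_mul _)
  have h := integral_mono (i1.add (ipq.const_mul κ)) (ie.sub hp.int) hpt
  simp only [Pi.sub_apply, Pi.add_apply] at h
  rw [integral_add i1 (ipq.const_mul κ), integral_add (hp.int.const_mul _) (hp.mom.const_mul _),
    integral_sub ie hp.int, integral_const_mul, integral_const_mul, integral_const_mul,
    integral_const_mul, integral_exp_neg_mul_abs ha, hp.mass, ← (pairing_eq hK hp hq).2] at h
  have e : a / 2 * (2 / a) = 1 := by field_simp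
  rw [e] at h
  unfold gibbsEnergy
  rw [← hp_def]
  linarith

lemma pairing_self_ge (hK : IsLogKernel K C) (hp : IsDens p) : -C ≤ pairing K p p := by
  rw [(pairing_eq hK hp hp).2]
  have h : ∀ t, p t * (-C) ≤ p t * linePot K p t := by
    intro t
    refine mul_le_mul_of_nonneg_left ?_ (hp.nonneg t)
    have h1 := integral_mono (hp.int.const_mul (-C)) (hK.integrable_shift hp.int hp.mom t) fun s =>
      mul_le_mul_of_nonneg_right (by linarith [hK.lower (t - s), abs_nonneg (t - s)] :
        -C ≤ K (t - s)) (hp.nonneg s)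
    rwa [integral_const_mul, hp.mass, mul_one] at h1
  have h2 := integral_mono (hp.int.mul_const (-C)) (pairing_eq hK hp hp).1 h
  rwa [integral_mul_const, hp.mass, one_mul] at h2

lemma pairing_self_ge_of_even (hK : IsLogKernel K C) (hp : IsDens p) (he : ∀ t, p (-t) = p t) :
    (∫ t, |t| * p t) / 2 - C ≤ pairing K p p := by
  rw [(pairing_eq hK hp hp).2]
  have hlow : ∀ t, |t| / 2 - C ≤ linePot K p t := by
    intro t
    have i1 := hK.integrable_shift hp.int hp.mom t
    have i2 := hK.integrable_shift hp.int hp.mom (-t)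
    have h1 := integral_mono (hp.int.const_mul (|t| - 2 * C)) (i1.add i2) fun s => ?_
    · simp only [Pi.add_apply] at h1
      rw [integral_add i1 i2, integral_const_mul, hp.mass, mul_one] at h1
      have h2 : linePot K p (-t) = linePot K p t := linePot_even hK he t
      unfold linePot at h2 ⊢
      linarith
    · have h1 := hK.lower (t - s)
      have h2 := hK.lower (-t - s)
      have h3 : 2 * |t| ≤ |t - s| + |-t - s| := by
        have := abs_sub (t - s) (-t - s)
        rw [show t - s - (-t - s) = 2 * t by ring, abs_mul, abs_two] at this
        exact this
      simp only [Pi.add_apply]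
      rw [← add_mul]
      exact mul_le_mul_of_nonneg_right (by linarith) (hp.nonneg s)
  have i3 : Integrable fun t => 1 / 2 * (|t| * p t) - C * p t :=
    (hp.mom.const_mul _).sub (hp.int.const_mul _)
  have h := integral_mono i3 (pairing_eq hK hp hp).1 fun t => ?_
  · rw [integral_sub (hp.mom.const_mul _) (hp.int.const_mul _), integral_const_mul,
      integral_const_mul, hp.mass] at h
    linarith
  · have := mul_le_mul_of_nonneg_left (hlow t) (hp.nonneg t)
    linarith

/-- Coercivity: the energy controls the first moment, if the field is confining or if the density
is even. -/
lemma exists_moment_le (hK : IsLogKernel K C) (hW : IsField W c D) (hκ : 0 < κ) :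
    ∃ c' D' : ℝ, 0 < c' ∧ ∀ q, IsDens q → (0 < c ∨ ∀ t, gibbs K W κ q (-t) = gibbs K W κ q t) →
      c' * ∫ t, |t| * gibbs K W κ q t ≤ gibbsEnergy K W κ q + D' := by
  rcases hW.nonneg.lt_or_eq with hc | hc
  · refine ⟨c / 2, D - log (c / 2 / 2) + κ / 2 * C, half_pos hc, fun q hq _ => ?_⟩
    have h1 := moment_le_gibbsEnergy hK hW hκ hq (half_pos hc)
    have h2 := pairing_self_ge hK (isDens_gibbs hK hW hκ hq)
    have h3 := mul_le_mul_of_nonneg_left h2 (half_pos hκ).le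
    rw [show c - c / 2 = c / 2 by ring] at h1
    linarith
  · refine ⟨κ / 8, D - log (κ / 8 / 2) + κ / 2 * C, by positivity, fun q hq he => ?_⟩
    have he' := he.resolve_left (by rw [← hc]; exact lt_irrefl 0)
    have h1 := moment_le_gibbsEnergy hK hW hκ hq (show 0 < κ / 8 by positivity)
    have h2 := pairing_self_ge_of_even hK (isDens_gibbs hK hW hκ hq) he'
    have h3 := mul_le_mul_of_nonneg_left h2 (half_pos hκ).le
    rw [← hc] at h1
    linarith

end

/-! ### Existence of a fixed point of the Gibbs map -/

section
variable {K W q p : ℝ → ℝ} {C c D κ : ℝ}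

lemma gibbs_even (hK : IsLogKernel K C) (hWe : ∀ t, W (-t) = W t) (hq : ∀ t, q (-t) = q t)
    (t : ℝ) : gibbs K W κ q (-t) = gibbs K W κ q t := by
  rw [gibbs, gibbs, hWe, linePot_even hK hq]

lemma integrable_kernel_bound {a : ℝ} (ha : 0 < a) (A B F : ℝ) :
    Integrable fun s : ℝ => (A * |s| + B) * (F * rexp (-a * |s|)) := by
  have := ((integrable_abs_mul_exp_neg_mul_abs ha).const_mul (A * F)).add
    ((integrable_exp_neg_mul_abs ha).const_mul (B * F))
  refine this.congr (Eventually.of_forall fun s => ?_)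
  simp only [Pi.add_apply]
  ring

lemma abs_kernel_shift_le (hK : IsLogKernel K C) {F x q : ℝ} (t s : ℝ) (hq0 : 0 ≤ q)
    (hq : q ≤ F * x) : |K (t - s) * q| ≤ (1 / 2 * |s| + (1 / 2 * |t| + C)) * (F * x) := by
  rw [abs_mul, abs_of_nonneg hq0]
  have h1 := hK.abs_le (t - s)
  have h2 : |t - s| ≤ |t| + |s| := abs_sub _ _
  have h3 : |K (t - s)| ≤ 1 / 2 * |s| + (1 / 2 * |t| + C) := by linarith
  exact mul_le_mul h3 hq hq0 ((abs_nonneg _).trans h3)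

/-- Uniformly exponentially decaying densities which converge pointwise have convergent
potentials. -/
lemma tendsto_linePot (hK : IsLogKernel K C) {q : ℕ → ℝ → ℝ} {P : ℝ → ℝ} {a F : ℝ} (ha : 0 < a)
    (hm : ∀ k, Measurable (q k)) (h0 : ∀ k t, 0 ≤ q k t) (hF : ∀ k t, q k t ≤ F * rexp (-a * |t|))
    (hP : ∀ t, Tendsto (fun k => q k t) atTop (𝓝 (P t))) (t : ℝ) :
    Tendsto (fun k => linePot K (q k) t) atTop (𝓝 (linePot K P t)) := by
  refine tendsto_integral_of_dominated_convergence _ (fun k => ?_)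
    (integrable_kernel_bound ha (1 / 2) (1 / 2 * |t| + C) F) (fun k => ?_) ?_
  · have := hK.cont.measurable
    have := hm k
    exact Measurable.aestronglyMeasurable (by fun_prop)
  · exact Eventually.of_forall fun s => abs_kernel_shift_le hK t s (h0 k s) (hF k s)
  · exact Eventually.of_forall fun s => (hP s).const_mul _

/-- The modulus of continuity shared by the potentials of all densities bounded by
`F exp (-a |s|)`. -/
lemma tendsto_kernel_modulus (hK : IsLogKernel K C) {a F : ℝ} (ha : 0 < a) (t : ℝ) :
    Tendsto (fun t' => ∫ s, |K (t' - s) - K (t - s)| * (F * rexp (-a * |s|))) (𝓝 t) (𝓝 0) := by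
  have hc := hK.cont
  have h : Tendsto (fun t' => ∫ s, |K (t' - s) - K (t - s)| * (F * rexp (-a * |s|))) (𝓝 t)
      (𝓝 (∫ s, |K (t - s) - K (t - s)| * (F * rexp (-a * |s|)))) := by
    refine tendsto_integral_filter_of_dominated_convergence
      (fun s => (1 * |s| + (|t| + 1 + 2 * C)) * (|F| * rexp (-a * |s|)))
      (Eventually.of_forall fun t' => (by fun_prop : Continuous _).aestronglyMeasurable) ?_
      (integrable_kernel_bound ha _ _ _) ?_
    · filter_upwards [Metric.ball_mem_nhds t one_pos] with t' ht'
      refine Eventually.of_forall fun s => ?_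
      rw [Metric.mem_ball, Real.dist_eq] at ht'
      rw [Real.norm_eq_abs, abs_mul, abs_abs, abs_mul, abs_of_pos (Real.exp_pos _)]
      refine mul_le_mul_of_nonneg_right ?_ (by positivity)
      have h1 := hK.abs_le (t' - s)
      have h2 := hK.abs_le (t - s)
      have h3 : |t' - s| ≤ |t'| + |s| := abs_sub _ _
      have h4 : |t - s| ≤ |t| + |s| := abs_sub _ _
      have h5 : |t'| - |t| ≤ |t' - t| := abs_sub_abs_le_abs_sub _ _
      have h6 := abs_sub (K (t' - s)) (K (t - s))
      linarith
    · refine Eventually.of_forall fun s => ?_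
      exact (by fun_prop : Continuous fun t' => |K (t' - s) - K (t - s)| *
        (F * rexp (-a * |s|))).tendsto t
  simpa using h

lemma abs_linePot_sub_le (hK : IsLogKernel K C) {a F : ℝ} (ha : 0 < a) (hq : IsDens q)
    (hF : ∀ t, q t ≤ F * rexp (-a * |t|)) (t' t : ℝ) :
    |linePot K q t' - linePot K q t| ≤
      ∫ s, |K (t' - s) - K (t - s)| * (F * rexp (-a * |s|)) := by
  have hc := hK.cont
  rw [linePot, linePot, ← integral_sub (hK.integrable_shift hq.int hq.mom t')
    (hK.integrable_shift hq.int hq.mom t), ← Real.norm_eq_abs]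
  refine norm_integral_le_of_norm_le ?_ (Eventually.of_forall fun s => ?_)
  · refine (((integrable_kernel_bound ha (1 / 2) (1 / 2 * |t'| + C) |F|).add
      (integrable_kernel_bound ha (1 / 2) (1 / 2 * |t| + C) |F|))).mono'
      (by fun_prop : Continuous _).aestronglyMeasurable (Eventually.of_forall fun s => ?_)
    rw [Real.norm_eq_abs, abs_mul, abs_abs, abs_mul, abs_of_pos (Real.exp_pos _), Pi.add_apply,
      ← add_mul]
    refine mul_le_mul_of_nonneg_right ?_ (by positivity)
    have h1 := hK.abs_le (t' - s)
    have h2 := hK.abs_le (t - s)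
    have h3 : |t' - s| ≤ |t'| + |s| := abs_sub _ _
    have h4 : |t - s| ≤ |t| + |s| := abs_sub _ _
    have h6 := abs_sub (K (t' - s)) (K (t - s))
    linarith
  · rw [← sub_mul, Real.norm_eq_abs, abs_mul, abs_of_nonneg (hq.nonneg s)]
    exact mul_le_mul_of_nonneg_left (hF s) (abs_nonneg _)

/-- A diagonal argument: the potentials of uniformly exponentially decaying densities have a
pointwise convergent subsequence. -/
lemma exists_subseq_tendsto_linePot (hK : IsLogKernel K C) {q : ℕ → ℝ → ℝ} {a F : ℝ}
    (ha : 0 < a) (hq : ∀ k, IsDens (q k)) (hF : ∀ k t, q k t ≤ F * rexp (-a * |t|)) :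
    ∃ φ : ℕ → ℕ, StrictMono φ ∧ ∃ U : ℝ → ℝ,
      ∀ t, Tendsto (fun k => linePot K (q (φ k)) t) atTop (𝓝 (U t)) := by
  set B : ℝ → ℝ := fun t => ∫ s, (1 / 2 * |s| + (1 / 2 * |t| + C)) * (F * rexp (-a * |s|)) with hB
  have hbd : ∀ k t, |linePot K (q k) t| ≤ B t := by
    intro k t
    rw [linePot, ← Real.norm_eq_abs]
    exact norm_integral_le_of_norm_le (integrable_kernel_bound ha _ _ _)
      (Eventually.of_forall fun s => abs_kernel_shift_le hK t s ((hq k).nonneg s) (hF k s))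
  have hcomp : IsCompact (Set.pi univ fun r : ℚ => Icc (-B r) (B r)) :=
    isCompact_univ_pi fun r => isCompact_Icc
  obtain ⟨V, -, φ, hφ, hV⟩ := hcomp.tendsto_subseq (x := fun k (r : ℚ) => linePot K (q k) r)
    (fun k r _ => _root_.abs_le.1 (hbd k r))
  rw [tendsto_pi_nhds] at hV
  refine ⟨φ, hφ, ?_⟩
  have hex : ∀ t, ∃ U, Tendsto (fun k => linePot K (q (φ k)) t) atTop (𝓝 U) := by
    intro t
    refine cauchySeq_tendsto_of_complete (Metric.cauchySeq_iff'.2 fun ε hε => ?_)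
    obtain ⟨r, hr⟩ : ∃ r : ℚ, ∫ s, |K (r - s) - K (t - s)| * (F * rexp (-a * |s|)) < ε / 4 := by
      have h := (tendsto_kernel_modulus hK ha (F := F) t).eventually_lt_const
        (show (0 : ℝ) < ε / 4 by positivity)
      obtain ⟨δ, hδ, hball⟩ := Metric.eventually_nhds_iff.1 h
      obtain ⟨r, hr1, hr2⟩ := exists_rat_btwn (show t < t + δ by linarith)
      refine ⟨r, hball ?_⟩
      rw [Real.dist_eq, abs_of_pos (by linarith)]
      linarith
    obtain ⟨N, hN⟩ := Metric.cauchySeq_iff'.1 (hV r).cauchySeq (ε / 4) (by positivity)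
    refine ⟨N, fun k hk => ?_⟩
    have h1 := hN k hk
    have h2 := abs_linePot_sub_le hK ha (hq (φ k)) (hF _) r t
    have h3 := abs_linePot_sub_le hK ha (hq (φ N)) (hF _) r t
    simp only [Function.comp] at h1
    rw [Real.dist_eq, abs_lt] at *
    rw [_root_.abs_le] at h2 h3
    constructor <;> linarith
  choose U hU using hex
  exact ⟨U, hU⟩

/-- Convergence of the Gibbs densities under pointwise convergence of the potentials. -/
lemma tendsto_gibbs (hK : IsLogKernel K C) (hW : IsField W c D) (hκ : 0 < κ) {q : ℕ → ℝ → ℝ}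
    {m : ℝ} (hq : ∀ k, IsDens (q k)) (hm : ∀ k, ∫ s, |s| * q k s ≤ m) {U : ℝ → ℝ}
    (hU : ∀ t, Tendsto (fun k => linePot K (q k) t) atTop (𝓝 (U t))) (t : ℝ) :
    Tendsto (fun k => gibbs K W κ (q k) t) atTop
      (𝓝 (rexp (W t - κ * U t) / ∫ s, rexp (W s - κ * U s))) := by
  have hexp : ∀ t, Tendsto (fun k => rexp (W t - κ * linePot K (q k) t)) atTop
      (𝓝 (rexp (W t - κ * U t))) := fun t =>
    (Real.continuous_exp.tendsto _).comp (((hU t).const_mul κ).const_sub (W t))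
  have hlow : ∀ k t, |t| / 2 - (m / 2 + C) ≤ linePot K (q k) t := fun k t => by
    linarith [(linePot_bounds hK (hq k) t).1, hm k]
  have hZ : Tendsto (fun k => ∫ s, rexp (W s - κ * linePot K (q k) s)) atTop
      (𝓝 (∫ s, rexp (W s - κ * U s))) := by
    refine tendsto_integral_of_dominated_convergence _ (fun k => ?_)
      ((integrable_exp_neg_mul_abs (half_pos hκ)).const_mul (rexp (D + κ * (m / 2 + C))))
      (fun k => ?_) (Eventually.of_forall hexp)
    · exact (integrable_exp_linePot hK hW hκ (hq k)).aestronglyMeasurable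
    · refine Eventually.of_forall fun s => ?_
      rw [Real.norm_of_nonneg (Real.exp_pos _).le]
      exact exp_field_sub_le hW hκ (hlow k s)
  have hZ0 : 0 < ∫ s, rexp (W s - κ * U s) :=
    (minZ_pos hW hκ m).trans_le (ge_of_tendsto' hZ fun k => minZ_le hK hW hκ (hq k) (hm k))
  simp_rw [gibbs_eq hK hW hκ (hq _)]
  exact (hexp t).div hZ hZ0.ne'

lemma isDens_half_exp : IsDens fun t => 1 / 2 * rexp (-1 * |t|) := by
  refine isDens_of_le (by fun_prop) (fun t => by positivity) one_pos (F := 1 / 2)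
    (fun t => le_rfl) ?_
  rw [integral_const_mul, integral_exp_neg_mul_abs one_pos]
  norm_num

/-- The mean-field equation has a solution. The Gibbs iteration lowers the energy, so that its
successive Hellinger distances tend to zero, and it stays in a compact set, because the energy
controls the first moment. -/
theorem exists_gibbs_fixed (hK : IsLogKernel K C) (hW : IsField W c D) (hκ : 0 < κ)
    (h : 0 < c ∨ ∀ t, W (-t) = W t) :
    ∃ p A F, IsDens p ∧ (∀ t, p t ≤ F * rexp (-(κ / 2) * |t|)) ∧
      ∀ t, p t = rexp (W t - κ * linePot K p t - A) := by
  set p : ℕ → ℝ → ℝ := fun k => (gibbs K W κ)^[k] fun t => 1 / 2 * rexp (-1 * |t|) with hp_def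
  have hps : ∀ k, p (k + 1) = gibbs K W κ (p k) := fun k => Function.iterate_succ_apply' _ _ _
  have hd : ∀ k, IsDens (p k) := by
    intro k
    induction k with
    | zero => exact isDens_half_exp
    | succ k ih => rw [hps]; exact isDens_gibbs hK hW hκ ih
  have hev : 0 < c ∨ ∀ k t, gibbs K W κ (p k) (-t) = gibbs K W κ (p k) t := by
    refine h.imp_right fun hWe => ?_
    have : ∀ k t, p k (-t) = p k t := by
      intro k
      induction k with
      | zero => intro t; simp [hp_def]
      | succ k ih => rw [hps]; exact gibbs_even hK hWe ih
    exact fun k => gibbs_even hK hWe (this k)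
  obtain ⟨c', D', hc', hmom⟩ := exists_moment_le hK hW hκ
  set E : ℕ → ℝ := fun k => gibbsEnergy K W κ (p k) with hE
  have hmomk : ∀ k, c' * ∫ t, |t| * p (k + 1) t ≤ E k + D' := fun k => by
    rw [hps]
    exact hmom (p k) (hd k) (hev.imp_right fun h => h k)
  have hmom0 : ∀ k, 0 ≤ ∫ t, |t| * p k t := fun k =>
    integral_nonneg fun t => mul_nonneg (abs_nonneg t) ((hd k).nonneg t)
  have hElow : ∀ k, -D' ≤ E k := fun k => by
    have := mul_nonneg hc'.le (hmom0 (k + 1))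
    linarith [hmomk k]
  have hstep : ∀ k, ∫ t, (√(p (k + 1) t) - √(p (k + 2) t)) ^ 2 ≤ E k - E (k + 1) := by
    intro k
    have h1 := hellinger_le hK hW hκ (hd k)
    have h2 := gibbsEnergy_le_dualEnergy hK hW hκ (hd (k + 1))
    rw [← hps, ← hps] at h1
    simp only [hE]
    linarith
  have hH0 : ∀ k, 0 ≤ ∫ t, (√(p (k + 1) t) - √(p (k + 2) t)) ^ 2 := fun k =>
    integral_nonneg fun t => sq_nonneg _
  have hanti : Antitone E := antitone_nat_of_succ_le fun k => by linarith [hstep k, hH0 k]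
  have hElim := tendsto_atTop_ciInf hanti ⟨-D', by rintro _ ⟨k, rfl⟩; exact hElow k⟩
  have hH : Tendsto (fun k => ∫ t, (√(p (k + 1) t) - √(p (k + 2) t)) ^ 2) atTop (𝓝 0) := by
    refine squeeze_zero hH0 hstep ?_
    have := hElim.sub (hElim.comp (tendsto_add_atTop_nat 1))
    rwa [sub_self] at this
  set M := (E 0 + D') / c' with hM
  have hMk : ∀ k, ∫ t, |t| * p (k + 1) t ≤ M := fun k => by
    rw [hM, le_div_iff₀ hc']
    linarith [hmomk k, hanti (Nat.zero_le k)]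
  set F := rexp (D + κ * (M / 2 + C)) / minZ W κ C M with hF_def
  have hF : ∀ k t, p (k + 2) t ≤ F * rexp (-(κ / 2) * |t|) := fun k t => by
    rw [hps (k + 1)]
    exact gibbs_le hK hW hκ (hd (k + 1)) (hMk k) t
  have hκ2 := half_pos hκ
  obtain ⟨φ, hφ, U, hU⟩ := exists_subseq_tendsto_linePot hK hκ2
    (q := fun k => p (k + 2)) (fun k => hd _) hF
  set P : ℝ → ℝ := fun t => rexp (W t - κ * U t) / ∫ s, rexp (W s - κ * U s) with hP_def
  have hP : ∀ t, Tendsto (fun k => p (φ k + 3) t) atTop (𝓝 (P t)) := fun t => by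
    have := tendsto_gibbs hK hW hκ (q := fun k => p (φ k + 2)) (fun k => hd _)
      (fun k => hMk (φ k + 1)) hU t
    simpa only [← hps] using this
  have hPm : Measurable P := measurable_of_tendsto_metrizable (fun k => (hd (φ k + 3)).meas)
    (tendsto_pi_nhds.2 hP)
  have hP0 : ∀ t, 0 ≤ P t := fun t => ge_of_tendsto' (hP t) fun k => (hd _).nonneg t
  have hPF : ∀ t, P t ≤ F * rexp (-(κ / 2) * |t|) := fun t =>
    le_of_tendsto' (hP t) fun k => hF (φ k + 1) t
  have hP1 : ∫ t, P t = 1 := by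
    have := tendsto_integral_of_dominated_convergence (fun t => F * rexp (-(κ / 2) * |t|))
      (fun k => (hd (φ k + 3)).meas.aestronglyMeasurable)
      ((integrable_exp_neg_mul_abs hκ2).const_mul F)
      (fun k => Eventually.of_forall fun t => by
        rw [Real.norm_of_nonneg ((hd _).nonneg t)]; exact hF (φ k + 1) t)
      (Eventually.of_forall hP)
    simp only [(hd _).mass] at this
    exact (tendsto_nhds_unique this tendsto_const_nhds)
  have hPd : IsDens P := isDens_of_le hPm hP0 hκ2 hPF hP1
  have hG : ∀ t, Tendsto (fun k => p (φ k + 4) t) atTop (𝓝 (gibbs K W κ P t)) := fun t => by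
    have := tendsto_gibbs hK hW hκ (q := fun k => p (φ k + 3)) (fun k => hd _)
      (fun k => hMk (φ k + 2)) (tendsto_linePot hK hκ2 (fun k => (hd _).meas)
        (fun k => (hd _).nonneg) (fun k => hF (φ k + 1)) hP) t
    rw [gibbs_eq hK hW hκ hPd]
    simpa only [← hps] using this
  have hGd := isDens_gibbs hK hW hκ hPd
  have hzero : ∫ t, (√(P t) - √(gibbs K W κ P t)) ^ 2 = 0 := by
    have h1 : Tendsto (fun k => ∫ t, (√(p (φ k + 3) t) - √(p (φ k + 4) t)) ^ 2) atTop (𝓝 0) :=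
      hH.comp ((tendsto_add_atTop_nat 2).comp hφ.tendsto_atTop)
    refine tendsto_nhds_unique (tendsto_integral_of_dominated_convergence
      (fun t => 2 * (F * rexp (-(κ / 2) * |t|)))
      (fun k => (integrable_sqrt_sub_sq (hd _) (hd _)).aestronglyMeasurable)
      (((integrable_exp_neg_mul_abs hκ2).const_mul F).const_mul 2)
      (fun k => Eventually.of_forall fun t => ?_) (Eventually.of_forall fun t => ?_)) h1
    · rw [Real.norm_of_nonneg (sq_nonneg _)]
      have e1 := Real.sq_sqrt ((hd (φ k + 3)).nonneg t)
      have e2 := Real.sq_sqrt ((hd (φ k + 4)).nonneg t)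
      have e3 := mul_nonneg (Real.sqrt_nonneg (p (φ k + 3) t)) (Real.sqrt_nonneg (p (φ k + 4) t))
      have e4 := hF (φ k + 1) t
      have e5 := hF (φ k + 2) t
      nlinarith
    · exact (((Real.continuous_sqrt.tendsto _).comp (hP t)).sub
        ((Real.continuous_sqrt.tendsto _).comp (hG t))).pow 2
  have hae : gibbs K W κ P =ᵐ[volume] P := by
    have h1 := (integral_eq_zero_iff_of_nonneg (fun t => sq_nonneg _)
      (integrable_sqrt_sub_sq hPd hGd)).1 hzero
    filter_upwards [h1] with t ht
    have h2 : √(P t) = √(gibbs K W κ P t) := by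
      simpa [sub_eq_zero] using ht
    rw [← Real.sq_sqrt (hGd.nonneg t), ← h2, Real.sq_sqrt (hP0 t)]
  refine ⟨gibbs K W κ P, logZ K W κ P, _, hGd, gibbs_le hK hW hκ hPd le_rfl, fun t => ?_⟩
  have : linePot K (gibbs K W κ P) t = linePot K P t :=
    integral_congr_ae (hae.mono fun s hs => by simp only [hs])
  rw [this, gibbs]

end

/-! ### Logarithmic potentials of radial functions -/

lemma isLogKernel_cylKernel {β : ℕ → ℝ} (hβ0 : ∀ j, 0 ≤ β j) (hβ : Summable β) :
    IsLogKernel (cylKernel β) (∑' j, β j + 1 / 2 * log 2) where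
  cont := continuous_cylKernel hβ0 hβ
  even := cylKernel_neg β
  lower τ := by
    have := half_abs_sub_le_cylKernel hβ0 hβ τ
    have := Real.log_pos one_lt_two
    linarith
  upper τ := by
    have := cylKernel_le hβ0 τ
    have : 0 ≤ ∑' j, β j := tsum_nonneg hβ0
    linarith
  condNeg _ hg hg1 hg0 := integral_cylKernel_nonpos hβ0 hβ hg hg1 hg0

/-- Product formula in polar coordinates: a function of the direction times a function of the
norm. -/
lemma integral_mul_fun_norm {V : Type*} [NormedAddCommGroup V] [InnerProductSpace ℝ V]
    [FiniteDimensional ℝ V] [MeasurableSpace V] [BorelSpace V] [Nontrivial V] {A : V → ℝ}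
    (hA : ∀ r : ℝ, 0 < r → ∀ x, A (r • x) = A x) (G : ℝ → ℝ) :
    (volume : Measure V).toSphere.real univ * ∫ y : V, A y * G ‖y‖ =
      (∫ θ, A θ.1 ∂(volume : Measure V).toSphere) * ∫ y : V, G ‖y‖ := by
  have key : ∀ (A' : V → ℝ), (∀ r : ℝ, 0 < r → ∀ x, A' (r • x) = A' x) →
      ∫ y : V, A' y * G ‖y‖ = (∫ θ, A' θ.1 ∂(volume : Measure V).toSphere) *
        ∫ r : Ioi (0 : ℝ), G r ∂.volumeIoiPow (Module.finrank ℝ V - 1) := by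
    intro A' hA'
    calc ∫ y : V, A' y * G ‖y‖
        = ∫ y : ({(0)}ᶜ : Set V), A' y.1 * G ‖y.1‖ ∂((volume : Measure V).comap (↑)) := by
          rw [integral_subtype_comap (measurableSet_singleton _).compl fun y => A' y * G ‖y‖,
            restrict_compl_singleton]
      _ = ∫ p, A' p.1.1 * G p.2 ∂(volume : Measure V).toSphere.prod
            (.volumeIoiPow (Module.finrank ℝ V - 1)) := by
          rw [← (volume : Measure V).measurePreserving_homeomorphUnitSphereProd.integral_comp
            (Homeomorph.measurableEmbedding _)]
          refine integral_congr_ae (Eventually.of_forall fun y => ?_)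
          have hy : 0 < ‖y.1‖ := norm_pos_iff.2 y.2
          simp [hA' _ (inv_pos.2 hy)]
      _ = _ := integral_prod_mul (fun θ : Metric.sphere (0 : V) 1 => A' θ.1)
            (fun r : Ioi (0 : ℝ) => G r)
  have h1 := key (fun _ => 1) (fun _ _ _ => rfl)
  simp only [one_mul, integral_const, smul_eq_mul, mul_one] at h1
  rw [key A hA, h1]
  ring

section
variable {ι : Type*} [Fintype ι]

/-- The average of `θ_i ^ (2k)` over the unit sphere. -/
noncomputable def sphereMoment (i : ι) (k : ℕ) : ℝ :=
  (∫ θ, (θ.1 i) ^ (2 * k) ∂(volume : Measure (EuclideanSpace ℝ ι)).toSphere) /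
    (volume : Measure (EuclideanSpace ℝ ι)).toSphere.real univ

lemma sphereMoment_nonneg (i : ι) (k : ℕ) : 0 ≤ sphereMoment i k := by
  refine div_nonneg (integral_nonneg fun θ => ?_) measureReal_nonneg
  beta_reduce
  rw [pow_mul]
  positivity

lemma toSphere_real_univ_pos [Nonempty ι] :
    0 < (volume : Measure (EuclideanSpace ℝ ι)).toSphere.real univ := by
  rw [measureReal_def, ENNReal.toReal_pos_iff]
  exact ⟨Measure.measure_univ_pos.2 (Measure.toSphere_ne_zero _), measure_lt_top _ _⟩

lemma integral_coord_div_norm_pow_mul [Nonempty ι] (i : ι) (k : ℕ) (G : ℝ → ℝ) :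
    ∫ y : EuclideanSpace ℝ ι, (y i / ‖y‖) ^ (2 * k) * G ‖y‖ =
      sphereMoment i k * ∫ y : EuclideanSpace ℝ ι, G ‖y‖ := by
  have h := integral_mul_fun_norm (V := EuclideanSpace ℝ ι)
    (A := fun y => (y i / ‖y‖) ^ (2 * k)) (fun r hr x => ?_) G
  · have h0 := toSphere_real_univ_pos (ι := ι)
    have e : ∀ θ : Metric.sphere (0 : EuclideanSpace ℝ ι) 1, ‖θ.1‖ = 1 := fun θ => by
      simp
    simp only [e, div_one] at h
    rw [sphereMoment, div_mul_eq_mul_div, ← h]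
    field_simp
  · beta_reduce
    rw [norm_smul, Real.norm_of_nonneg hr.le, PiLp.smul_apply, smul_eq_mul,
      mul_div_mul_left _ _ hr.ne']

lemma sq_add_sq_le_norm_sq {i j : ι} (hij : i ≠ j) (y : EuclideanSpace ℝ ι) :
    y i ^ 2 + y j ^ 2 ≤ ‖y‖ ^ 2 := by
  classical
  rw [EuclideanSpace.real_norm_sq_eq, ← Finset.sum_pair hij (f := fun k => y k ^ 2)]
  exact Finset.sum_le_univ_sum_of_nonneg fun k => sq_nonneg _

lemma integrableOn_log_coord (j : ι) :
    IntegrableOn (fun y : EuclideanSpace ℝ ι => log (y j)) {y | ‖y‖ ≤ 1} := by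
  classical
  have h1 : IntegrableOn Real.log (Icc (-1) 1) := by
    rw [integrableOn_Icc_iff_integrableOn_Ioc,
      ← intervalIntegrable_iff_integrableOn_Ioc_of_le (by norm_num)]
    exact intervalIntegral.intervalIntegrable_log'
  have h2 : IntegrableOn (fun _ : ℝ => (1 : ℝ)) (Icc (-1) 1) := by
    simp [integrableOn_const_iff]
  have h3 : Integrable (fun x : ι → ℝ => ∏ k, (Icc (-1 : ℝ) 1).indicator
      (if k = j then fun t => |log t| else fun _ => (1 : ℝ)) (x k)) := by
    refine Integrable.fintype_prod (f := fun k => (Icc (-1 : ℝ) 1).indicator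
      (if k = j then fun t => |log t| else fun _ => (1 : ℝ))) fun k => ?_
    rw [integrable_indicator_iff measurableSet_Icc]
    split_ifs
    · exact h1.abs
    · exact h2
  have h4 := (PiLp.volume_preserving_ofLp ι).integrable_comp_of_integrable h3
  have hm : MeasurableSet {y : EuclideanSpace ℝ ι | ‖y‖ ≤ 1} :=
    measurableSet_le (by fun_prop) (by fun_prop)
  refine Integrable.mono' (h4.integrableOn)
    (Measurable.aestronglyMeasurable (Real.measurable_log.comp (by fun_prop)))
    ((ae_restrict_mem hm).mono fun y (hy : ‖y‖ ≤ 1) => ?_)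
  have hk : ∀ k, y k ∈ Icc (-1 : ℝ) 1 := fun k =>
    _root_.abs_le.1 ((PiLp.norm_apply_le y k).trans hy)
  have e : ∏ k, (Icc (-1 : ℝ) 1).indicator
      (if k = j then fun t => |log t| else fun _ => (1 : ℝ)) (y k) = |log (y j)| := by
    rw [Finset.prod_eq_single j]
    · rw [indicator_of_mem (hk j), if_pos rfl]
    · intro k _ hkj
      rw [indicator_of_mem (hk k), if_neg hkj]
    · simp
  simp only [Function.comp]
  rw [Real.norm_eq_abs]
  exact e.ge

lemma ae_coord_ne_zero (j : ι) : ∀ᵐ y : EuclideanSpace ℝ ι, y j ≠ 0 := by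
  classical
  have h := Measure.addHaar_submodule (volume : Measure (EuclideanSpace ℝ ι))
    (LinearMap.ker (EuclideanSpace.proj j : EuclideanSpace ℝ ι →L[ℝ] ℝ).toLinearMap) ?_
  · rw [ae_iff]
    convert h using 2
    ext y
    simp
  · intro htop
    have : (EuclideanSpace.single j (1 : ℝ)) ∈
      LinearMap.ker (EuclideanSpace.proj j : EuclideanSpace ℝ ι →L[ℝ] ℝ).toLinearMap := by
        rw [htop]; trivial
    simp at this

/-- The reason is that `∑ k, θ_i ^ (2 (k + 1)) / (k + 1) = -log (1 - θ_i ^ 2) ≤ -2 log |θ_j|` is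
integrable over the sphere. -/
lemma summable_sphereMoment_div {i j : ι} (hij : i ≠ j) :
    Summable fun k : ℕ => sphereMoment i (k + 1) / (4 * (k + 1)) := by
  have : Nonempty ι := ⟨i⟩
  -- The radial test function is the indicator of the unit ball, where `2 log ‖y‖ ≤ 0`.
  set G : ℝ → ℝ := fun r => if r ≤ 1 then 1 else 0 with hG
  have hm : MeasurableSet {y : EuclideanSpace ℝ ι | ‖y‖ ≤ 1} :=
    measurableSet_le (by fun_prop) (by fun_prop)
  have hfin : (volume : Measure (EuclideanSpace ℝ ι)) {y | ‖y‖ ≤ 1} < ⊤ := by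
    have e : {y : EuclideanSpace ℝ ι | ‖y‖ ≤ 1} = Metric.closedBall 0 1 := by ext; simp
    rw [e]; exact measure_closedBall_lt_top
  have hGi : (fun y : EuclideanSpace ℝ ι => G ‖y‖) = {y | ‖y‖ ≤ 1}.indicator fun _ => 1 := by
    ext y; simp [hG, indicator_apply]
  have hGint : Integrable fun y : EuclideanSpace ℝ ι => G ‖y‖ := by
    rw [hGi, integrable_indicator_iff hm]
    simp [integrableOn_const_iff, hfin]
  have hZ : 0 < ∫ y : EuclideanSpace ℝ ι, G ‖y‖ := by
    rw [hGi, integral_indicator_const _ hm, smul_eq_mul, mul_one, measureReal_def, ENNReal.toReal_pos_iff]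
    refine ⟨?_, hfin⟩
    refine (Metric.measure_ball_pos volume (0 : EuclideanSpace ℝ ι) one_pos).trans_le
      (measure_mono fun y hy => ?_)
    simpa using (mem_ball_zero_iff.1 hy).le
  have hc1 : ∀ (k : ℕ) (y : EuclideanSpace ℝ ι), |(y i / ‖y‖) ^ (2 * k)| ≤ 1 := fun k y => by
    rw [abs_pow, abs_div, abs_norm]
    exact pow_le_one₀ (by positivity) (div_le_one_of_le₀ (PiLp.norm_apply_le y i) (norm_nonneg y))
  have hint : ∀ k : ℕ, Integrable fun y : EuclideanSpace ℝ ι =>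
      (y i / ‖y‖) ^ (2 * (k + 1)) * G ‖y‖ := fun k =>
    hGint.bdd_mul (c := 1) (Measurable.aestronglyMeasurable (by fun_prop))
      (Eventually.of_forall fun y => hc1 (k + 1) y)
  set L := ∫ y in {y : EuclideanSpace ℝ ι | ‖y‖ ≤ 1}, |log (y j)| with hL
  have hlog := (integrableOn_log_coord j).abs
  refine summable_of_sum_le (c := L / (∫ y : EuclideanSpace ℝ ι, G ‖y‖))
    (fun k => div_nonneg (sphereMoment_nonneg i _) (by positivity)) fun s => ?_
  rw [le_div_iff₀ hZ, Finset.sum_mul]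
  have e : ∀ k ∈ s, sphereMoment i (k + 1) / (4 * (k + 1)) * ∫ y : EuclideanSpace ℝ ι, G ‖y‖ =
      ∫ y : EuclideanSpace ℝ ι, 1 / (4 * (k + 1)) * ((y i / ‖y‖) ^ (2 * (k + 1)) * G ‖y‖) := by
    intro k _
    rw [integral_const_mul, integral_coord_div_norm_pow_mul]
    ring
  rw [Finset.sum_congr rfl e, ← integral_finsetSum _ fun k _ => (hint k).const_mul _, hL,
    ← integral_indicator hm]
  refine integral_mono_ae (integrable_finsetSum _ fun k _ => (hint k).const_mul _)
    ((integrable_indicator_iff hm).2 hlog) ?_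
  filter_upwards [ae_coord_ne_zero j] with y hy
  by_cases hy1 : ‖y‖ ≤ 1
  · rw [indicator_of_mem (by exact hy1)]
    simp only [hG, hy1, if_true, mul_one]
    have hy0 : 0 < ‖y‖ := by
      rw [norm_pos_iff]; rintro rfl; exact hy rfl
    have hyj : 0 < y j ^ 2 := by positivity
    set x := (y i / ‖y‖) ^ 2 with hx
    have hx1 : y j ^ 2 ≤ 1 - x := by
      rw [hx, div_pow, le_sub_iff_add_le', ← le_sub_iff_add_le, div_le_iff₀ (by positivity)]
      have := sq_add_sq_le_norm_sq hij y
      have h1 : y j ^ 2 * ‖y‖ ^ 2 ≤ y j ^ 2 := by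
        have : ‖y‖ ^ 2 ≤ 1 := pow_le_one₀ hy0.le hy1
        nlinarith
      linarith
    have hx0 : 0 ≤ x := sq_nonneg _
    have hs := Real.hasSum_pow_div_log_of_abs_lt_one (x := x)
      (by rw [abs_of_nonneg hx0]; linarith)
    have h1 := sum_le_hasSum s (fun k _ => by positivity) hs
    have h2 : ∑ k ∈ s, 1 / (4 * ((k : ℝ) + 1)) * (y i / ‖y‖) ^ (2 * (k + 1)) =
        1 / 4 * ∑ k ∈ s, x ^ (k + 1) / ((k : ℝ) + 1) := by
      rw [Finset.mul_sum]
      refine Finset.sum_congr rfl fun k _ => ?_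
      rw [hx, ← pow_mul]
      field_simp
    rw [h2]
    have h3 := Real.log_le_log hyj hx1
    rw [Real.log_pow, Nat.cast_ofNat] at h3
    have h4 := neg_le_abs (log (y j))
    have h5 := abs_nonneg (log (y j))
    linarith
  · rw [indicator_of_notMem (by exact hy1)]
    simp [hG, hy1]

end

section
variable {V : Type*} [NormedAddCommGroup V] [InnerProductSpace ℝ V]

/-- With `τ = log ‖x‖ - log ‖y‖` and `c` the cosine of the angle between `x` and `y`, this is the
logarithm of `‖x - y‖² ‖x + y‖² = (2 ‖x‖ ‖y‖ cosh τ)² (1 - c² / cosh² τ)`. -/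
lemma log_norm_sub_add_log_norm_add {x y : V} (hx : x ≠ 0) (hy : y ≠ 0) (h1 : x ≠ y)
    (h2 : x ≠ -y) :
    (inner ℝ x y / (‖x‖ * ‖y‖)) ^ 2 * (cosh (log ‖x‖ - log ‖y‖))⁻¹ ^ 2 < 1 ∧
      log ‖x - y‖ + log ‖x + y‖ = log ‖x‖ + log ‖y‖ + log (2 * cosh (log ‖x‖ - log ‖y‖)) +
        1 / 2 * log (1 - (inner ℝ x y / (‖x‖ * ‖y‖)) ^ 2 *
          (cosh (log ‖x‖ - log ‖y‖))⁻¹ ^ 2) := by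
  have hr : 0 < ‖x‖ := norm_pos_iff.2 hx
  have hs : 0 < ‖y‖ := norm_pos_iff.2 hy
  have ha : 0 < ‖x - y‖ := norm_pos_iff.2 (sub_ne_zero.2 h1)
  have hb : 0 < ‖x + y‖ := norm_pos_iff.2 fun h => h2 (eq_neg_of_add_eq_zero_left h)
  have hc := cosh_pos (log ‖x‖ - log ‖y‖)
  have hcosh : ‖x‖ * ‖y‖ * (2 * cosh (log ‖x‖ - log ‖y‖)) = ‖x‖ ^ 2 + ‖y‖ ^ 2 := by
    rw [Real.cosh_eq, neg_sub, Real.exp_sub, Real.exp_sub, Real.exp_log hr, Real.exp_log hs]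
    field_simp
  have hprod : (‖x - y‖ * ‖x + y‖) ^ 2 = (‖x‖ * ‖y‖ * (2 * cosh (log ‖x‖ - log ‖y‖))) ^ 2 *
      (1 - (inner ℝ x y / (‖x‖ * ‖y‖)) ^ 2 * (cosh (log ‖x‖ - log ‖y‖))⁻¹ ^ 2) := by
    have e : (‖x‖ * ‖y‖ * (2 * cosh (log ‖x‖ - log ‖y‖))) ^ 2 *
        (1 - (inner ℝ x y / (‖x‖ * ‖y‖)) ^ 2 * (cosh (log ‖x‖ - log ‖y‖))⁻¹ ^ 2) =
        (‖x‖ * ‖y‖ * (2 * cosh (log ‖x‖ - log ‖y‖))) ^ 2 - (2 * inner ℝ x y) ^ 2 := by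
      field_simp
    rw [e, hcosh, mul_pow, norm_sub_sq_real, norm_add_sq_real]
    ring
  have hpos : 0 < 1 - (inner ℝ x y / (‖x‖ * ‖y‖)) ^ 2 * (cosh (log ‖x‖ - log ‖y‖))⁻¹ ^ 2 := by
    have h : 0 < (‖x - y‖ * ‖x + y‖) ^ 2 := by positivity
    rw [hprod] at h
    exact pos_of_mul_pos_right h (sq_nonneg _)
  refine ⟨by linarith, ?_⟩
  have h := congrArg log hprod
  rw [Real.log_pow, log_mul ha.ne' hb.ne', log_mul (by positivity) hpos.ne', Real.log_pow,
    log_mul (by positivity) (by positivity), log_mul hr.ne' hs.ne'] at h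
  push_cast at h
  linarith

/-- Rotation invariance of the potentials of radial functions. -/
lemma integral_norm_sub_of_norm_eq [FiniteDimensional ℝ V] [MeasurableSpace V] [BorelSpace V]
    {x x' : V} (h : ‖x‖ = ‖x'‖) (H : ℝ → ℝ → ℝ) :
    ((Integrable fun y : V => H ‖x - y‖ ‖y‖) ↔ Integrable fun y : V => H ‖x' - y‖ ‖y‖) ∧
      ∫ y : V, H ‖x - y‖ ‖y‖ = ∫ y : V, H ‖x' - y‖ ‖y‖ := by
  let R := (ℝ ∙ (x - x'))ᗮ.reflection
  have hR : R x = x' := Submodule.reflection_sub h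
  have e : ∀ y, H ‖x - y‖ ‖y‖ = H ‖x' - R y‖ ‖R y‖ := fun y => by
    rw [← hR, ← map_sub, R.norm_map, R.norm_map]
  constructor
  · simp_rw [e]
    exact R.measurePreserving.integrable_comp_emb R.toHomeomorph.measurableEmbedding
      (g := fun y => H ‖x' - y‖ ‖y‖)
  · simp_rw [e]
    exact R.measurePreserving.integral_comp R.toHomeomorph.measurableEmbedding
      fun y => H ‖x' - y‖ ‖y‖

end

section
variable {ι : Type*} [Fintype ι]

/-- The coefficients of the cylindrical kernel in Euclidean space. -/
noncomputable def sphereCoeff (i : ι) (k : ℕ) : ℝ := sphereMoment i (k + 1) / (4 * (k + 1))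

lemma sphereCoeff_nonneg (i : ι) (k : ℕ) : 0 ≤ sphereCoeff i k :=
  div_nonneg (sphereMoment_nonneg i _) (by positivity)

lemma summable_sphereCoeff {i j : ι} (hij : i ≠ j) : Summable (sphereCoeff i) :=
  summable_sphereMoment_div hij

lemma integrable_cylinder_mul {ρ : ℝ → ℝ}
    (hρ : Integrable fun y : EuclideanSpace ℝ ι => ρ ‖y‖)
    (hlog : Integrable fun y : EuclideanSpace ℝ ι => log ‖y‖ * ρ ‖y‖) {k : ℝ → ℝ}
    (hk : Measurable k) {a b : ℝ} (hkb : ∀ τ, |k τ| ≤ a * |τ| + b) (ha : 0 ≤ a) (l : ℝ) :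
    Integrable fun y : EuclideanSpace ℝ ι => k (l - log ‖y‖) * ρ ‖y‖ := by
  refine ((hlog.norm.const_mul a).add (hρ.norm.const_mul (a * |l| + b))).mono'
    ((Measurable.aestronglyMeasurable (by fun_prop)).mul hρ.aestronglyMeasurable)
    (Eventually.of_forall fun y => ?_)
  simp only [Pi.add_apply, norm_mul, Real.norm_eq_abs]
  have h1 := hkb (l - log ‖y‖)
  have h2 := abs_sub l (log ‖y‖)
  calc |k (l - log ‖y‖)| * |ρ ‖y‖| ≤ (a * (|l| + |log ‖y‖|) + b) * |ρ ‖y‖| :=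
        mul_le_mul_of_nonneg_right (h1.trans (by gcongr)) (abs_nonneg _)
    _ = _ := by ring

/-- The logarithmic potential of a radial function in cylindrical coordinates. After averaging over
`±y`, `log (1 - c² / cosh² τ)` is expanded in powers of `c²` and integrated term by term over
spheres. -/
theorem integral_log_norm_sub_mul_fun_norm {i j : ι} (hij : i ≠ j) {ρ : ℝ → ℝ}
    (hρ0 : ∀ r, 0 ≤ ρ r) (hρ : Integrable fun y : EuclideanSpace ℝ ι => ρ ‖y‖)
    (hlog : Integrable fun y : EuclideanSpace ℝ ι => log ‖y‖ * ρ ‖y‖)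
    {x : EuclideanSpace ℝ ι} (hx : x ≠ 0)
    (hxi : Integrable fun y : EuclideanSpace ℝ ι => log ‖x - y‖ * ρ ‖y‖) :
    ∫ y, log ‖x - y‖ * ρ ‖y‖ = ∫ y : EuclideanSpace ℝ ι,
      ((log ‖x‖ + log ‖y‖) / 2 + cylKernel (sphereCoeff i) (log ‖x‖ - log ‖y‖)) * ρ ‖y‖ := by
  classical
  have : Nonempty ι := ⟨i⟩
  have : Nontrivial (EuclideanSpace ℝ ι) := nontrivial_of_ne _ _ hx
  wlog hx' : x = EuclideanSpace.single i ‖x‖ generalizing x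
  · have hn : ‖EuclideanSpace.single i ‖x‖‖ = ‖x‖ := by simp
    have h := integral_norm_sub_of_norm_eq hn.symm fun a b => log a * ρ b
    have h0 : EuclideanSpace.single i ‖x‖ ≠ 0 := by
      rw [← norm_pos_iff, hn]; exact norm_pos_iff.2 hx
    rw [h.2, this h0 (h.1.1 hxi) (by rw [hn]), hn]
  set r := ‖x‖ with hr_def
  have hr : 0 < r := norm_pos_iff.2 hx
  have hin : ∀ y : EuclideanSpace ℝ ι, inner ℝ x y / (r * ‖y‖) = y i / ‖y‖ := fun y => by
    rw [hx', EuclideanSpace.inner_single_left]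
    simp only [conj_trivial]
    rw [mul_div_mul_left _ _ hr.ne']
  have hβ0 := sphereCoeff_nonneg i
  have hβ := summable_sphereCoeff hij
  have hK := isLogKernel_cylKernel hβ0 hβ
  set G : ℕ → ℝ → ℝ := fun k s => (cosh (log r - log s))⁻¹ ^ (2 * (k + 1)) * ρ s with hG
  have hG0 : ∀ k s, 0 ≤ G k s := fun k s =>
    mul_nonneg (pow_nonneg (inv_nonneg.2 (cosh_pos _).le) _) (hρ0 s)
  have hGρ : ∀ k s, G k s ≤ ρ s := fun k s =>
    mul_le_of_le_one_left (hρ0 s) (inv_cosh_pow_le_one _ _)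
  have hcm : Measurable fun τ : ℝ => (cosh τ)⁻¹ :=
    (continuous_cosh.inv₀ fun τ => (cosh_pos τ).ne').measurable
  have hGi : ∀ k, Integrable fun y : EuclideanSpace ℝ ι => G k ‖y‖ := fun k =>
    integrable_cylinder_mul hρ hlog (k := fun τ => (cosh τ)⁻¹ ^ (2 * (k + 1))) (a := 0) (b := 1)
      (hcm.pow_const _) (fun τ => by
        rw [abs_of_nonneg (pow_nonneg (inv_nonneg.2 (cosh_pos _).le) _), zero_mul, zero_add]
        exact inv_cosh_pow_le_one _ _) le_rfl _
  set A : ℕ → EuclideanSpace ℝ ι → ℝ := fun k y =>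
    1 / (4 * (k + 1)) * ((y i / ‖y‖) ^ (2 * (k + 1)) * G k ‖y‖) with hA
  set B : ℕ → EuclideanSpace ℝ ι → ℝ := fun k y => sphereCoeff i k * G k ‖y‖ with hB
  have hAi : ∀ k, Integrable (A k) := fun k => by
    refine Integrable.const_mul ?_ _
    refine (hGi k).bdd_mul (c := 1) (Measurable.aestronglyMeasurable (by fun_prop))
      (Eventually.of_forall fun y => ?_)
    rw [norm_pow, norm_div, norm_norm]
    exact pow_le_one₀ (by positivity) (div_le_one_of_le₀ (PiLp.norm_apply_le y i) (norm_nonneg y))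
  have hBi : ∀ k, Integrable (B k) := fun k => (hGi k).const_mul _
  have hAB : ∀ k, ∫ y, A k y = ∫ y, B k y := fun k => by
    simp only [hA, hB, integral_const_mul, integral_coord_div_norm_pow_mul, sphereCoeff]
    ring
  have hA0 : ∀ k y, 0 ≤ A k y := fun k y => by
    simp only [hA]
    rw [pow_mul]
    exact mul_nonneg (by positivity) (mul_nonneg (by positivity) (hG0 k _))
  have hB0 : ∀ k y, 0 ≤ B k y := fun k y => mul_nonneg (hβ0 k) (hG0 k _)
  have hBs : Summable fun k => ∫ y, B k y := by
    refine (hβ.mul_right (∫ y : EuclideanSpace ℝ ι, ρ ‖y‖)).of_nonneg_of_le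
      (fun k => integral_nonneg (hB0 k)) fun k => ?_
    simp only [hB, integral_const_mul]
    exact mul_le_mul_of_nonneg_left (integral_mono (hGi k) hρ fun y => hGρ k _) (hβ0 k)
  have hsA := hasSum_integral_of_summable_integral_norm hAi (by
    simp only [Real.norm_of_nonneg (hA0 _ _), hAB]; exact hBs)
  have hsB := hasSum_integral_of_summable_integral_norm hBi (by
    simp only [Real.norm_of_nonneg (hB0 _ _)]; exact hBs)
  simp only [hAB] at hsA
  have hSum := hsA.unique hsB
  -- The integrand is averaged over `y` and `-y`, so that only even powers of the cosine occur.
  have hneg : (Integrable fun y => log ‖x + y‖ * ρ ‖y‖) ∧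
      ∫ y, log ‖x + y‖ * ρ ‖y‖ = ∫ y, log ‖x - y‖ * ρ ‖y‖ := by
    have h1 := hxi.comp_neg
    have h2 := integral_neg_eq_self (fun y => log ‖x - y‖ * ρ ‖y‖) volume
    simp only [sub_neg_eq_add, norm_neg] at h1 h2
    exact ⟨h1, h2⟩
  set M : EuclideanSpace ℝ ι → ℝ := fun y =>
    ((log r + log ‖y‖) / 2 + 1 / 2 * log (2 * cosh (log r - log ‖y‖))) * ρ ‖y‖ with hM
  have hMi : Integrable M := by
    have h1 := integrable_cylinder_mul hρ hlog
      (k := fun τ => log r - τ / 2 + 1 / 2 * log (2 * cosh τ)) (a := 1)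
      (b := |log r| + log 2) (by fun_prop) (fun τ => ?_) zero_le_one (log r)
    · refine h1.congr (Eventually.of_forall fun y => ?_)
      simp only [hM]
      ring
    · have h1 := log_two_mul_cosh_le τ
      have h2 := abs_le_log_two_mul_cosh τ
      have h3 := abs_nonneg τ
      have h4 := neg_abs_le τ
      have h5 := le_abs_self τ
      have h6 := le_abs_self (log r)
      have h7 := neg_abs_le (log r)
      have h8 := Real.log_pos one_lt_two
      rw [_root_.abs_le]
      constructor <;> linarith
  have hTi : Integrable fun y : EuclideanSpace ℝ ι => ((log r + log ‖y‖) / 2 +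
      cylKernel (sphereCoeff i) (log r - log ‖y‖)) * ρ ‖y‖ := by
    have h1 := integrable_cylinder_mul hρ hlog (k := cylKernel (sphereCoeff i))
      hK.cont.measurable hK.abs_le (by norm_num) (log r)
    have h2 := ((hρ.const_mul (log r / 2)).add (hlog.const_mul (1 / 2))).add h1
    refine h2.congr (Eventually.of_forall fun y => ?_)
    simp only [Pi.add_apply]
    ring
  have hBM : ∀ y, ∑' k, B k y = M y - ((log r + log ‖y‖) / 2 +
      cylKernel (sphereCoeff i) (log r - log ‖y‖)) * ρ ‖y‖ := fun y => by
    simp only [hB, hG, hM, cylKernel, ← mul_assoc]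
    rw [tsum_mul_right]
    ring
  have hAM : ∀ᵐ y, ∑' k, A k y =
      M y - 1 / 2 * (log ‖x - y‖ * ρ ‖y‖ + log ‖x + y‖ * ρ ‖y‖) := by
    have h0 : ∀ z : EuclideanSpace ℝ ι, ∀ᵐ y, y ≠ z := fun z => by
      simp [ae_iff, measure_singleton]
    filter_upwards [h0 0, h0 x, h0 (-x)] with y hy0 hyx hynx
    obtain ⟨h1, h2⟩ := log_norm_sub_add_log_norm_add hx hy0 hyx.symm
      (fun h => hynx (by rw [h, neg_neg]))
    rw [← hr_def, hin] at h1 h2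
    set u := (y i / ‖y‖) ^ 2 * (cosh (log r - log ‖y‖))⁻¹ ^ 2 with hu
    have hu0 : 0 ≤ u := by positivity
    have hs := Real.hasSum_pow_div_log_of_abs_lt_one (x := u) (by rwa [abs_of_nonneg hu0])
    have e : ∀ k : ℕ, A k y = 1 / 4 * ρ ‖y‖ * (u ^ (k + 1) / (k + 1)) := fun k => by
      simp only [hA, hG, hu]
      rw [mul_pow, ← pow_mul, ← pow_mul]
      field_simp
    simp_rw [e]
    rw [(hs.mul_left (1 / 4 * ρ ‖y‖)).tsum_eq]
    simp only [hM]
    rw [← add_mul, h2]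
    ring
  have hsum2 := integral_congr_ae hAM
  rw [hSum, integral_congr_ae (Eventually.of_forall hBM)] at hsum2
  have hs2 : Integrable fun y => log ‖x - y‖ * ρ ‖y‖ + log ‖x + y‖ * ρ ‖y‖ := hxi.add hneg.1
  rw [integral_sub hMi hTi, integral_sub hMi (hs2.const_mul _), integral_const_mul,
    integral_add hxi hneg.1, hneg.2] at hsum2
  linarith

end

/-! ### The weak equation for logarithmic potentials -/

lemma sphereArea_eq (n : ℕ) :
    sphereArea n = 2 * π ^ (((n : ℝ) + 1) / 2) / Gamma (((n : ℝ) + 1) / 2) := by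
  have hn : (0 : ℝ) < ((n : ℝ) + 1) / 2 := by positivity
  have hG := Real.Gamma_pos_of_pos hn
  rw [sphereArea, Measure.toSphere_real_apply_univ, measureReal_def, EuclideanSpace.volume_ball,
    ENNReal.toReal_mul, ENNReal.toReal_pow, ENNReal.toReal_ofReal zero_le_one, one_pow, one_mul,
    finrank_euclideanSpace, Fintype.card_fin, Nat.cast_add, Nat.cast_one,
    Real.Gamma_add_one hn.ne', ENNReal.toReal_ofReal (by positivity), ← Real.rpow_natCast,
    Real.sqrt_eq_rpow, ← Real.rpow_mul pi_pos.le]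
  have e : 1 / 2 * ((n + 1 : ℕ) : ℝ) = ((n : ℝ) + 1) / 2 := by push_cast; ring
  rw [e]
  field_simp

lemma sphereArea_pos (n : ℕ) : 0 < sphereArea n := by
  rw [sphereArea_eq]
  have : 0 < Gamma (((n : ℝ) + 1) / 2) := Real.Gamma_pos_of_pos (by positivity)
  positivity

lemma gammaConst_pos (n : ℕ) : 0 < gammaConst n := by
  have := sphereArea_pos n
  have := Nat.factorial_pos (n - 1)
  unfold gammaConst
  positivity

/-- Legendre's duplication formula identifies the constant of the fundamental solution. -/
lemma two_pi_pow_mul_eq_gammaConst {n : ℕ} (hn : 1 ≤ n) :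
    (2 * π) ^ n * (Gamma (n / 2) * π ^ (-(n / 2) : ℝ) / 2) = gammaConst n := by
  have h := Real.Gamma_mul_Gamma_add_half ((n : ℝ) / 2)
  have hG : 0 < Gamma (((n : ℝ) + 1) / 2) := Real.Gamma_pos_of_pos (by positivity)
  obtain ⟨m, rfl⟩ : ∃ m, n = m + 1 := ⟨n - 1, by omega⟩
  have e1 : ((m + 1 : ℕ) : ℝ) / 2 + 1 / 2 = (((m + 1 : ℕ) : ℝ) + 1) / 2 := by ring
  have e2 : 2 * (((m + 1 : ℕ) : ℝ) / 2) = m + 1 := by push_cast; ring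
  rw [e1, e2, Real.Gamma_nat_eq_factorial] at h
  have e3 : (2 : ℝ) ^ (1 - ((m : ℝ) + 1)) = (2 ^ m)⁻¹ := by
    rw [show (1 : ℝ) - (m + 1) = -(m : ℝ) by ring, Real.rpow_neg two_pos.le, Real.rpow_natCast]
  have e4 : π ^ ((((m + 1 : ℕ) : ℝ) + 1) / 2) = π ^ (((m + 1 : ℕ) : ℝ) / 2) * √π := by
    rw [Real.sqrt_eq_rpow, ← Real.rpow_add pi_pos]
    congr 1; ring
  have e5 : π ^ (m + 1) = π ^ (((m + 1 : ℕ) : ℝ) / 2) * π ^ (((m + 1 : ℕ) : ℝ) / 2) := by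
    rw [← Real.rpow_add pi_pos, ← Real.rpow_natCast]
    congr 1; ring
  rw [e3] at h
  rw [gammaConst, sphereArea_eq, e4, Real.rpow_neg pi_pos.le, mul_pow, e5, Nat.add_sub_cancel]
  have hp : 0 < π ^ (((m + 1 : ℕ) : ℝ) / 2) := Real.rpow_pos_of_pos pi_pos _
  set Q := π ^ (((m + 1 : ℕ) : ℝ) / 2)
  set G1 := Gamma (((m + 1 : ℕ) : ℝ) / 2)
  set G2 := Gamma ((((m + 1 : ℕ) : ℝ) + 1) / 2)
  field_simp
  field_simp at h
  rw [pow_succ]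
  linear_combination 2 * h

lemma negLaplacianHalfPow_eq {n : ℕ} (φ : 𝓢(EuclideanSpace ℝ (Fin n), ℂ))
    (x : EuclideanSpace ℝ (Fin n)) :
    negLaplacianHalfPow n φ x = (((2 * π) ^ n : ℝ) : ℂ) *
      𝓕⁻ (fun ξ => ((‖ξ‖ ^ n : ℝ) : ℂ) * 𝓕 (φ : EuclideanSpace ℝ (Fin n) → ℂ) ξ) x := by
  rw [negLaplacianHalfPow, Real.fourierInv_eq', Real.fourierInv_eq', ← integral_const_mul]
  congr 1
  ext ξ
  rw [mul_pow]
  push_cast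
  simp only [smul_eq_mul]
  ring

section
variable {V : Type*} [NormedAddCommGroup V] [InnerProductSpace ℝ V] [FiniteDimensional ℝ V]
  [MeasurableSpace V] [BorelSpace V]

/-- The integral `∫ log ((1 + |y|) / |x - y|) f y dy`. -/
noncomputable def logPot (f : V → ℝ) (x : V) : ℝ := ∫ y, log ((1 + ‖y‖) / ‖x - y‖) * f y

lemma integrable_logPot_mul (hd : 2 ≤ Module.finrank ℝ V) {w : V → ℂ} {f : V → ℝ} {B : ℝ}
    (hwm : AEStronglyMeasurable w) (hwB : ∀ x, ‖w x‖ ≤ B)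
    (hw : Integrable w) (hw1 : Integrable fun x => ((‖x‖ : ℝ) : ℂ) * w x)
    (hf : Integrable f) (hf1 : Integrable fun y => log (1 + ‖y‖) * f y) :
    Integrable fun x => ((logPot f x : ℝ) : ℂ) * w x := by
  refine (integrable_log_kernel_mul hd hwm hwB hw hw1 hf hf1).integral_prod_left.congr
    (Eventually.of_forall fun x => ?_)
  simp only
  rw [integral_mul_const, integral_complex_ofReal, logPot]

/-- Fubini's theorem reduces the equation for the logarithmic potential of `f` to the fundamental
solution. -/
lemma integral_logPot_mul_fourierInv_norm_pow (hd : 3 ≤ Module.finrank ℝ V) {f : V → ℝ}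
    (hf : Integrable f) (hf1 : Integrable fun y => log (1 + ‖y‖) * f y) (φ : 𝓢(V, ℂ)) :
    (Integrable fun x => ((logPot f x : ℝ) : ℂ) *
      𝓕⁻ (fun ξ => ((‖ξ‖ ^ (Module.finrank ℝ V) : ℝ) : ℂ) * 𝓕 (φ : V → ℂ) ξ) x) ∧
    ∫ x, ((logPot f x : ℝ) : ℂ) *
      𝓕⁻ (fun ξ => ((‖ξ‖ ^ (Module.finrank ℝ V) : ℝ) : ℂ) * 𝓕 (φ : V → ℂ) ξ) x =
    ((Gamma (Module.finrank ℝ V / 2) * π ^ (-(Module.finrank ℝ V / 2) : ℝ) / 2 : ℝ) : ℂ) *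
      ∫ y, (f y : ℂ) * φ y := by
  have hd2 : 2 ≤ Module.finrank ℝ V := by omega
  have : Nontrivial V := Module.finrank_pos_iff.1 (show 0 < Module.finrank ℝ V by omega)
  have hfund := integral_neg_log_mul_fourierInv_norm_pow hd φ
  have hc := (continuous_fourierInv_norm_pow φ (Module.finrank ℝ V)).aestronglyMeasurable
    (μ := volume)
  obtain ⟨hi, -, hi1⟩ := integrable_of_integrable_weight hc
    (integrable_weight_mul_fourierInv_norm_pow hd φ)
  have h0 := (integral_fourierInv_norm_pow_eq_zero hd φ).1
  have hB : ∀ x, ‖𝓕⁻ (fun ξ => ((‖ξ‖ ^ (Module.finrank ℝ V) : ℝ) : ℂ) * 𝓕 (φ : V → ℂ) ξ) x‖ ≤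
      ∫ ξ, ‖((‖ξ‖ ^ (Module.finrank ℝ V) : ℝ) : ℂ) * 𝓕 (φ : V → ℂ) ξ‖ := fun x =>
    VectorFourier.norm_fourierIntegral_le_integral_norm _ _ _ _ x
  set ψ := 𝓕⁻ (fun ξ => ((‖ξ‖ ^ (Module.finrank ℝ V) : ℝ) : ℂ) * 𝓕 (φ : V → ℂ) ξ)
  refine ⟨integrable_logPot_mul hd2 hc hB hi hi1 hf hf1, ?_⟩
  have hprod := integrable_log_kernel_mul hd2 hc hB hi hi1 hf hf1
  calc ∫ x, ((logPot f x : ℝ) : ℂ) * ψ x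
      = ∫ x, (∫ y, ((log ((1 + ‖y‖) / ‖x - y‖) * f y : ℝ) : ℂ) * ψ x) := by
        congr 1
        ext x
        rw [integral_mul_const, integral_complex_ofReal, logPot]
    _ = ∫ y, (∫ x, ((log ((1 + ‖y‖) / ‖x - y‖) * f y : ℝ) : ℂ) * ψ x) :=
        integral_integral_swap hprod
    _ = _ := by
        rw [← integral_const_mul]
        congr 1
        ext y
        have e : ∀ᵐ x : V, ((log ((1 + ‖y‖) / ‖x - y‖) * f y : ℝ) : ℂ) * ψ x =
            (f y : ℂ) * (((log (1 + ‖y‖) : ℝ) : ℂ) * ψ x + ((-log ‖x - y‖ : ℝ) : ℂ) * ψ x) := by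
          have hne : ∀ᵐ x : V, x ≠ y := by simp [ae_iff, measure_singleton]
          filter_upwards [hne] with x hx
          rw [log_div (by positivity) (norm_ne_zero_iff.2 (sub_ne_zero.2 hx))]
          push_cast
          ring
        have hl : Integrable fun x => ((-log ‖x - y‖ : ℝ) : ℂ) * ψ x := by
          refine (integrable_log_norm_sub_mul hd2 hc hB hi hi1 y).neg.congr
            (Eventually.of_forall fun x => ?_)
          simp
        rw [integral_congr_ae e, integral_const_mul, integral_add (hi.const_mul _) hl,
          integral_const_mul, h0, hfund y]
        ring

/-- The defining integral of the logarithmic potential converges at every point if the density is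
bounded away from the origin and has a finite logarithmic moment. -/
lemma integrable_log_kernel_mul_of_bounded (hd : 2 ≤ Module.finrank ℝ V) {f : V → ℝ}
    (hf : Integrable f) (hf0 : Integrable fun y => log ‖y‖ * f y)
    (hf1 : Integrable fun y => log (1 + ‖y‖) * f y)
    (hb : ∀ r : ℝ, 0 < r → ∃ B, ∀ y, r ≤ ‖y‖ → |f y| ≤ B) (x : V) :
    (Integrable fun y => log ((1 + ‖y‖) / ‖x - y‖) * f y) ∧
      (Integrable fun y => log ‖x - y‖ * f y) ∧
      logPot f x = (∫ y, log (1 + ‖y‖) * f y) - ∫ y, log ‖x - y‖ * f y := by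
  have : Nontrivial V := Module.finrank_pos_iff.1 (show 0 < Module.finrank ℝ V by omega)
  have hne : ∀ᵐ y : V, y ≠ x := by simp [ae_iff, measure_singleton]
  have e : ∀ᵐ y, log ((1 + ‖y‖) / ‖x - y‖) * f y =
      log (1 + ‖y‖) * f y - log ‖x - y‖ * f y := by
    filter_upwards [hne] with y hy
    rw [log_div (by positivity) (norm_ne_zero_iff.2 (sub_ne_zero.2 hy.symm))]
    ring
  have h1 : Integrable fun y => log ((1 + ‖y‖) / ‖x - y‖) * f y := by
    rcases eq_or_ne x 0 with rfl | hx
    · simp only [zero_sub, norm_neg] at e ⊢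
      exact (hf1.sub hf0).congr (e.mono fun y hy => hy.symm)
    · have hr : 0 < ‖x‖ / 2 := half_pos (norm_pos_iff.2 hx)
      obtain ⟨B, hB⟩ := hb _ hr
      have i1 : Integrable fun y => (log (1 + ‖x‖) + log⁺ (‖x‖ / 2)⁻¹) * |f y| :=
        hf.abs.const_mul _
      have i2 : Integrable fun y => B * log⁺ ‖y - x‖⁻¹ :=
        ((integrable_posLog_norm_inv hd).comp_sub_right x).const_mul B
      refine ((i1.add hf1.abs).add i2).mono'
        ((Measurable.aestronglyMeasurable (by fun_prop)).mul hf.aestronglyMeasurable)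
        (Eventually.of_forall fun y => ?_)
      simp only [Pi.add_apply]
      have hly : 0 ≤ log (1 + ‖y‖) := log_nonneg (by linarith [norm_nonneg y])
      rw [norm_mul, Real.norm_eq_abs, Real.norm_eq_abs, abs_mul (log (1 + ‖y‖)),
        abs_of_nonneg hly, norm_sub_rev y x]
      have hk := mul_le_mul_of_nonneg_right (abs_log_kernel_le x y) (abs_nonneg (f y))
      have hB0 : 0 ≤ B := (abs_nonneg _).trans (hB x (by linarith))
      have hp0 : 0 ≤ log⁺ (‖x‖ / 2)⁻¹ := posLog_nonneg
      have hp1 : 0 ≤ log⁺ ‖x - y‖⁻¹ := posLog_nonneg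
      have hlast : log⁺ ‖x - y‖⁻¹ * |f y| ≤ log⁺ (‖x‖ / 2)⁻¹ * |f y| + B * log⁺ ‖x - y‖⁻¹ := by
        rcases le_total (‖x‖ / 2) ‖y‖ with h | h
        · have := mul_le_mul_of_nonneg_left (hB y h) hp1
          have := mul_nonneg hp0 (abs_nonneg (f y))
          linarith
        · have h2 : ‖x‖ / 2 ≤ ‖x - y‖ := by
            have := norm_sub_norm_le x y
            linarith
          have h3 : log⁺ ‖x - y‖⁻¹ ≤ log⁺ (‖x‖ / 2)⁻¹ :=
            posLog_le_posLog (by positivity) (inv_anti₀ hr h2)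
          have := mul_le_mul_of_nonneg_right h3 (abs_nonneg (f y))
          have := mul_nonneg hB0 hp1
          linarith
      linarith
  have h2 : Integrable fun y => log ‖x - y‖ * f y := by
    refine (hf1.sub h1).congr (e.mono fun y hy => ?_)
    simp only [Pi.sub_apply, hy]
    ring
  exact ⟨h1, h2, by rw [logPot, integral_congr_ae e, integral_sub hf1 h2]⟩

/-- `(1 + |x|) ^ 2` is integrable against `(1 + |x| ^ (2 d))⁻¹` in dimension `d ≥ 3`. -/
lemma integrable_weight_mul_inv_one_add_norm_pow (hd : 3 ≤ Module.finrank ℝ V) :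
    Integrable fun x : V => (1 + ‖x‖) ^ 2 * (1 + ‖x‖ ^ (2 * Module.finrank ℝ V))⁻¹ := by
  set d := Module.finrank ℝ V with hd_def
  have h := (integrable_one_add_norm (E := V) (μ := volume) (r := ((2 * d - 2 : ℕ) : ℝ))
    (by rw [← hd_def]; exact_mod_cast (by omega : d < 2 * d - 2))).const_mul (2 ^ (2 * d - 1))
  refine h.mono' (Measurable.aestronglyMeasurable (by fun_prop)) (Eventually.of_forall fun x => ?_)
  have hx := norm_nonneg x
  rw [Real.norm_of_nonneg (by positivity), Real.rpow_neg (by positivity), Real.rpow_natCast,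
    ← div_eq_mul_inv, ← div_eq_mul_inv, div_le_div_iff₀ (by positivity) (by positivity),
    ← pow_add, show 2 + (2 * d - 2) = 2 * d by omega]
  have := add_pow_le zero_le_one hx (2 * d)
  rwa [one_pow] at this

end

/-- Logarithmic potentials and multiples of `|x| ^ 2` belong to `L_{n/2}`. -/
lemma memL_logPot_sub {n : ℕ} (hn : 3 ≤ n) {f : EuclideanSpace ℝ (Fin n) → ℝ} (hf : Integrable f)
    (hf1 : Integrable fun y => log (1 + ‖y‖) * f y) (a b c : ℝ) :
    MemL ((n : ℝ) / 2) fun x => a * logPot f x - b * ‖x‖ ^ 2 + c := by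
  have hfr : Module.finrank ℝ (EuclideanSpace ℝ (Fin n)) = n := by simp
  have hw := integrable_weight_mul_inv_one_add_norm_pow (V := EuclideanSpace ℝ (Fin n))
    (by rw [hfr]; exact hn)
  rw [hfr] at hw
  set w : EuclideanSpace ℝ (Fin n) → ℝ := fun x => (1 + ‖x‖ ^ (2 * n))⁻¹ with hw_def
  have hwc : Measurable fun x => ((w x : ℝ) : ℂ) := by fun_prop
  have hw1 : ∀ x, ‖((w x : ℝ) : ℂ)‖ ≤ 1 := fun x => by
    rw [Complex.norm_real, Real.norm_of_nonneg (by positivity)]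
    exact inv_le_one_of_one_le₀ (by linarith [pow_nonneg (norm_nonneg x) (2 * n)])
  obtain ⟨i0, i2, i1⟩ := integrable_of_integrable_weight hwc.aestronglyMeasurable
    ((hw.ofReal (𝕜 := ℂ)).congr (Eventually.of_forall fun x => by simp [hw_def]))
  have i3 := integrable_logPot_mul (by rw [hfr]; omega) hwc.aestronglyMeasurable hw1 i0 i1 hf hf1
  have hu : Integrable fun x => (a * logPot f x - b * ‖x‖ ^ 2 + c) * w x := by
    refine (((i3.const_mul (a : ℂ)).sub (i2.const_mul (b : ℂ))).add (i0.const_mul (c : ℂ))).re.congr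
      (Eventually.of_forall fun x => ?_)
    simp only [Pi.add_apply, Pi.sub_apply, ← Complex.ofReal_mul, ← Complex.ofReal_sub,
      ← Complex.ofReal_add, RCLike.re_to_complex, Complex.ofReal_re]
    ring
  constructor
  · refine (hu.locallyIntegrable.mul_continuous
      (g := fun x => 1 + ‖x‖ ^ (2 * n)) (by fun_prop)).congr (Eventually.of_forall fun x => ?_)
    simp only [hw_def]
    field_simp
  · refine hu.abs.congr (Eventually.of_forall fun x => ?_)
    have e : (n : ℝ) + 2 * (n / 2) = ((2 * n : ℕ) : ℝ) := by push_cast; ring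
    simp only
    rw [e, Real.rpow_natCast, abs_mul, abs_of_nonneg (a := w x) (by positivity), div_eq_mul_inv]

/-- The terms `-b |x|² + c` do not contribute, because `(-Δ)^{n/2} φ` is orthogonal to them. -/
theorem isWeakSolution_logPot {n : ℕ} (hn : 3 ≤ n) {f : EuclideanSpace ℝ (Fin n) → ℝ}
    (hf : Integrable f) (hf1 : Integrable fun y => log (1 + ‖y‖) * f y) (b c : ℝ) :
    IsWeakSolution n f fun x => 1 / gammaConst n * logPot f x - b * ‖x‖ ^ 2 + c := by
  have hfr : Module.finrank ℝ (EuclideanSpace ℝ (Fin n)) = n := by simp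
  have hmem := memL_logPot_sub hn hf hf1 (1 / gammaConst n) b c
  have key : ∀ φ : 𝓢(EuclideanSpace ℝ (Fin n), ℂ),
      ∫ x, ((1 / gammaConst n * logPot f x - b * ‖x‖ ^ 2 + c : ℝ) : ℂ) *
        negLaplacianHalfPow n φ x = ∫ x, (f x : ℂ) * φ x := by
    intro φ
    have h3 : 3 ≤ Module.finrank ℝ (EuclideanSpace ℝ (Fin n)) := by rw [hfr]; exact hn
    obtain ⟨hi, -⟩ := integral_logPot_mul_fourierInv_norm_pow h3 hf hf1 φ
    have hv := (integral_logPot_mul_fourierInv_norm_pow h3 hf hf1 φ).2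
    obtain ⟨z0, z2⟩ := integral_fourierInv_norm_pow_eq_zero h3 φ
    obtain ⟨i0, i2, -⟩ := integrable_of_integrable_weight
      (continuous_fourierInv_norm_pow φ _).aestronglyMeasurable
      (integrable_weight_mul_fourierInv_norm_pow h3 φ)
    simp_rw [negLaplacianHalfPow_eq]
    simp only [hfr] at hi hv z0 z2 i0 i2
    set ψ := 𝓕⁻ (fun ξ => ((‖ξ‖ ^ n : ℝ) : ℂ) * 𝓕 (φ : EuclideanSpace ℝ (Fin n) → ℂ) ξ)
    have e : ∀ x, ((1 / gammaConst n * logPot f x - b * ‖x‖ ^ 2 + c : ℝ) : ℂ) *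
        ((((2 * π) ^ n : ℝ) : ℂ) * ψ x) = (((2 * π) ^ n : ℝ) : ℂ) *
        (((1 / gammaConst n : ℝ) : ℂ) * (((logPot f x : ℝ) : ℂ) * ψ x) -
          (b : ℂ) * (((‖x‖ ^ 2 : ℝ) : ℂ) * ψ x) + (c : ℂ) * ψ x) := fun x => by
      push_cast
      ring
    simp_rw [e]
    have j1 : Integrable fun x => ((1 / gammaConst n : ℝ) : ℂ) * (((logPot f x : ℝ) : ℂ) * ψ x) -
        (b : ℂ) * (((‖x‖ ^ 2 : ℝ) : ℂ) * ψ x) := (hi.const_mul _).sub (i2.const_mul _)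
    rw [integral_const_mul, integral_add j1 (i0.const_mul _),
      integral_sub (hi.const_mul _) (i2.const_mul _), integral_const_mul, integral_const_mul,
      integral_const_mul, z0, z2, hv, mul_zero, sub_zero, mul_zero, add_zero, ← mul_assoc,
      ← mul_assoc, ← Complex.ofReal_mul, ← Complex.ofReal_mul]
    have hγ := gammaConst_pos n
    have e2 : (2 * π) ^ n * (1 / gammaConst n) * (Gamma (n / 2) * π ^ (-(n / 2) : ℝ) / 2) = 1 := by
      rw [mul_right_comm, two_pi_pow_mul_eq_gammaConst (by omega)]
      field_simp
    rw [e2, Complex.ofReal_one, one_mul]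
  exact ⟨fun _ => ⟨hmem.1, fun φ _ => key φ⟩, fun _ => ⟨hmem, key⟩⟩

/-! ### From the line to Euclidean space -/

/-- Polar coordinates with logarithmic radius. -/
lemma integral_comp_log_norm {V : Type*} [NormedAddCommGroup V] [InnerProductSpace ℝ V]
    [FiniteDimensional ℝ V] [MeasurableSpace V] [BorelSpace V] [Nontrivial V] (H : ℝ → ℝ) :
    ((Integrable fun y : V => H (log ‖y‖)) ↔
      Integrable fun t : ℝ => rexp (Module.finrank ℝ V * t) * H t) ∧
    ∫ y : V, H (log ‖y‖) = (volume : Measure V).toSphere.real univ *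
      ∫ t, rexp (Module.finrank ℝ V * t) * H t := by
  have hd : 0 < Module.finrank ℝ V := Module.finrank_pos
  have himg : rexp '' univ = Ioi 0 := by rw [image_univ, Real.range_exp]
  have hder : ∀ t ∈ univ, HasDerivWithinAt rexp (rexp t) univ t := fun t _ =>
    (Real.hasDerivAt_exp t).hasDerivWithinAt
  have e : ∀ t : ℝ, |rexp t| • (rexp t ^ (Module.finrank ℝ V - 1) • H (log (rexp t))) =
      rexp (Module.finrank ℝ V * t) * H t := fun t => by
    rw [Real.log_exp, abs_of_pos (Real.exp_pos t), smul_eq_mul, smul_eq_mul, ← mul_assoc,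
      ← pow_succ', Nat.sub_add_cancel hd, ← Real.exp_nat_mul]
  constructor
  · rw [integrable_fun_norm_addHaar volume (f := fun r => H (log r)), ← himg,
      integrableOn_image_iff_integrableOn_abs_deriv_smul MeasurableSet.univ hder
        Real.exp_injective.injOn, integrableOn_univ]
    simp_rw [e]
  · rw [integral_fun_norm_addHaar volume (fun r => H (log r)), ← himg,
      integral_image_eq_integral_abs_deriv_smul MeasurableSet.univ hder
        Real.exp_injective.injOn, setIntegral_univ, Measure.toSphere_real_apply_univ]
    simp_rw [e]
    rw [nsmul_eq_mul, smul_eq_mul, mul_assoc]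

lemma log_one_add_le_abs_log_add {r : ℝ} (hr : 0 ≤ r) : log (1 + r) ≤ |log r| + log 2 := by
  have h2 := Real.log_pos one_lt_two
  rcases le_total r 1 with h | h
  · have := Real.log_le_log (by linarith) (show 1 + r ≤ 2 by linarith)
    linarith [abs_nonneg (log r)]
  · have h1 := Real.log_le_log (by linarith) (show 1 + r ≤ r * 2 by linarith)
    rw [Real.log_mul (by linarith) two_ne_zero] at h1
    linarith [le_abs_self (log r)]

/-- A solution of the mean-field equation on the line, with the field
`n (1 + α - Λ / (2 γ)) t - n η e^{2t}`, is the cylindrical form of a solution in `ℝ^n`. -/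
theorem exists_isSolution {n : ℕ} (hn : 3 ≤ n) {α Λ η c D : ℝ} (hΛ : 0 < Λ)
    (hW : IsField (fun t => n * (1 + α - Λ / (2 * gammaConst n)) * t - n * η * rexp (2 * t)) c D)
    (h : 0 < c ∨ ∀ t, (fun t => n * (1 + α - Λ / (2 * gammaConst n)) * t -
      n * η * rexp (2 * t)) (-t) = (fun t => n * (1 + α - Λ / (2 * gammaConst n)) * t -
      n * η * rexp (2 * t)) t) :
    ∃ u : EuclideanSpace ℝ (Fin n) → ℝ, IsRadial u ∧ IsSolution α Λ u ∧
      ∃ c₀ : ℝ, IsPotentialPlus α u (fun x => -(η * ‖x‖ ^ 2) + c₀) := by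
  set W : ℝ → ℝ := fun t =>
    n * (1 + α - Λ / (2 * gammaConst n)) * t - n * η * rexp (2 * t) with hWdef
  have hfr : Module.finrank ℝ (EuclideanSpace ℝ (Fin n)) = n := by simp
  have : Nontrivial (EuclideanSpace ℝ (Fin n)) :=
    Module.finrank_pos_iff.1 (show 0 < Module.finrank ℝ (EuclideanSpace ℝ (Fin n)) by omega)
  have hn0 : (0 : ℝ) < n := by positivity
  have hγ := gammaConst_pos n
  set γ := gammaConst n
  have hij : (⟨0, by omega⟩ : Fin n) ≠ ⟨1, by omega⟩ := by simp
  have hK := isLogKernel_cylKernel (sphereCoeff_nonneg (⟨0, by omega⟩ : Fin n))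
    (summable_sphereCoeff hij)
  set K := cylKernel (sphereCoeff (⟨0, by omega⟩ : Fin n)) with hKdef
  set κ := n * Λ / γ with hκdef
  have hκ : 0 < κ := by positivity
  obtain ⟨p, A, F, hp, hpF, hpeq⟩ := exists_gibbs_fixed hK hW hκ h
  have hS : 0 < (volume : Measure (EuclideanSpace ℝ (Fin n))).toSphere.real univ := by
    have : Nonempty (Fin n) := ⟨⟨0, by omega⟩⟩
    exact toSphere_real_univ_pos
  have hpolar := fun H => integral_comp_log_norm (V := EuclideanSpace ℝ (Fin n)) H
  rw [hfr] at hpolar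
  set S := (volume : Measure (EuclideanSpace ℝ (Fin n))).toSphere.real univ
  -- The density `f x = H (log ‖x‖)` has mass `Λ`. Its value at the origin, where `log 0 = 0`, is
  -- irrelevant.
  set H : ℝ → ℝ := fun t => Λ / S * (rexp (-(n * t)) * p t) with hH
  have hH0 : ∀ t, 0 ≤ H t := fun t => by
    have := hp.nonneg t
    positivity
  have hexpH : ∀ g : ℝ → ℝ, (fun t => rexp (n * t) * (g t * H t)) =
      fun t => Λ / S * (g t * p t) := fun g => by
    ext t
    have : rexp (n * t) * rexp (-(n * t)) = 1 := by rw [← Real.exp_add]; simp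
    simp only [hH]
    linear_combination (Λ / S * (g t * p t)) * this
  have hint : ∀ g : ℝ → ℝ, (Integrable fun t => g t * p t) →
      (Integrable fun y : EuclideanSpace ℝ (Fin n) => g (log ‖y‖) * H (log ‖y‖)) ∧
      ∫ y : EuclideanSpace ℝ (Fin n), g (log ‖y‖) * H (log ‖y‖) = Λ * ∫ t, g t * p t := by
    intro g hg
    obtain ⟨h1, h2⟩ := hpolar fun t => g t * H t
    rw [hexpH] at h1 h2
    refine ⟨h1.2 (hg.const_mul _), ?_⟩
    rw [h2, integral_const_mul]
    field_simp
  set f : EuclideanSpace ℝ (Fin n) → ℝ := fun y => H (log ‖y‖) with hf_def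
  have hf := hint (fun _ => 1) (by simpa using hp.int)
  simp only [one_mul, hp.mass, mul_one] at hf
  have hmom : Integrable fun t => t * p t := by
    refine hp.mom.mono (Measurable.aestronglyMeasurable (by have := hp.meas; fun_prop))
      (Eventually.of_forall fun t => ?_)
    rw [norm_mul, norm_mul, Real.norm_eq_abs |t|, abs_abs, Real.norm_eq_abs t]
  have hf0 := (hint (fun t => t) hmom).1
  have hf1 : Integrable fun y => log (1 + ‖y‖) * f y := by
    refine (((hint (fun t => |t|) hp.mom).1).add (hf.1.const_mul (log 2))).mono'
      ((Measurable.aestronglyMeasurable (by fun_prop)).mul hf.1.aestronglyMeasurable)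
      (Eventually.of_forall fun y => ?_)
    have hy := norm_nonneg y
    rw [norm_mul, Real.norm_of_nonneg (log_nonneg (by linarith)), Real.norm_of_nonneg (hH0 _),
      Pi.add_apply, ← add_mul]
    exact mul_le_mul_of_nonneg_right (log_one_add_le_abs_log_add hy) (hH0 _)
  have hb : ∀ r : ℝ, 0 < r → ∃ B, ∀ y, r ≤ ‖y‖ → |f y| ≤ B := by
    intro r hr
    have hF0 : 0 ≤ F := by
      have := (hp.nonneg 0).trans (hpF 0)
      simpa using this
    refine ⟨Λ / S * (rexp (-(n * log r)) * F), fun y hy => ?_⟩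
    rw [abs_of_nonneg (hH0 _)]
    have h1 := Real.log_le_log hr hy
    have h2 : p (log ‖y‖) ≤ F := (hpF _).trans (mul_le_of_le_one_right hF0
      (Real.exp_le_one_iff.2 (by nlinarith [abs_nonneg (log ‖y‖)])))
    have h3 : rexp (-(n * log ‖y‖)) ≤ rexp (-(n * log r)) :=
      Real.exp_le_exp.2 (by nlinarith)
    exact mul_le_mul_of_nonneg_left (mul_le_mul h3 h2 (hp.nonneg _) (Real.exp_pos _).le)
      (by positivity)
  have hker := integrable_log_kernel_mul_of_bounded (by rw [hfr]; omega) hf.1 hf0 hf1 hb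
  set m := ∫ t, t * p t
  have hpot : ∀ x : EuclideanSpace ℝ (Fin n), x ≠ 0 → ∫ y, log ‖x - y‖ * f y =
      Λ * (log ‖x‖ / 2 + m / 2 + linePot K p (log ‖x‖)) := by
    intro x hx
    rw [integral_log_norm_sub_mul_fun_norm hij (ρ := fun r => H (log r)) (fun r => hH0 _) hf.1 hf0
      hx (hker x).2.1]
    have i1 : Integrable fun s => log ‖x‖ / 2 * p s + 1 / 2 * (s * p s) :=
      (hp.int.const_mul _).add (hmom.const_mul _)
    have i2 := hK.integrable_shift hp.int hp.mom (log ‖x‖)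
    have e : ∀ s, ((log ‖x‖ + s) / 2 + K (log ‖x‖ - s)) * p s =
        (log ‖x‖ / 2 * p s + 1 / 2 * (s * p s)) + K (log ‖x‖ - s) * p s := fun s => by ring
    have h1 := (hint (fun s => (log ‖x‖ + s) / 2 + K (log ‖x‖ - s)) (by
      simp_rw [e]; exact i1.add i2)).2
    rw [h1]
    simp_rw [e]
    rw [integral_add i1 i2, integral_add (hp.int.const_mul _) (hmom.const_mul _),
      integral_const_mul, integral_const_mul, hp.mass, linePot]
    ring
  set N := ∫ y, log (1 + ‖y‖) * f y
  -- The constant for which the prefactors of `|x|^{nα} e^{nu}` and `f` agree.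
  set c₀ := (log (Λ / S) - A) / n - (N - Λ * (m / 2)) / γ with hc₀
  set u : EuclideanSpace ℝ (Fin n) → ℝ := fun x => 1 / γ * logPot f x - η * ‖x‖ ^ 2 + c₀ with hu
  have hdens : ∀ x, x ≠ 0 → density α u x = f x := by
    intro x hx
    have hx0 := norm_pos_iff.2 hx
    have e1 : ‖x‖ ^ 2 = rexp (2 * log ‖x‖) := by
      rw [mul_comm, Real.exp_mul, Real.exp_log hx0, Real.rpow_two]
    have e2 : Λ / S = rexp (log (Λ / S)) := (Real.exp_log (by positivity)).symm
    have e3 : f x = rexp (log (Λ / S)) * (rexp (-(n * log ‖x‖)) * p (log ‖x‖)) := by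
      rw [← e2]
    rw [e3, density, hpeq, Real.rpow_def_of_pos hx0, ← Real.exp_add, ← Real.exp_add,
      ← Real.exp_add]
    have e4 : logPot f x = N - Λ * (log ‖x‖ / 2 + m / 2 + linePot K p (log ‖x‖)) := by
      rw [← hpot x hx]
      exact (hker x).2.2
    congr 1
    simp only [hu, e4, e1, hWdef, hc₀, hκdef]
    field_simp
    ring
  have hae : ∀ᵐ x, density α u x = f x := by
    have : ∀ᵐ x : EuclideanSpace ℝ (Fin n), x ≠ 0 := by simp [ae_iff, measure_singleton]
    exact this.mono hdens
  have hweak := isWeakSolution_logPot hn hf.1 hf1 η c₀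
  have hrhs : ∀ φ : 𝓢(EuclideanSpace ℝ (Fin n), ℂ),
      ∫ x, (density α u x : ℂ) * φ x = ∫ x, (f x : ℂ) * φ x := fun φ =>
    integral_congr_ae (hae.mono fun x hx => by simp only [hx])
  refine ⟨u, fun x y hxy => ?_, ⟨hf.1.congr (hae.mono fun x hx => hx.symm), ?_, ?_⟩, c₀,
    fun x => ⟨(hker x).1.congr (hae.mono fun y hy => ?_), ?_⟩⟩
  · have := (integral_norm_sub_of_norm_eq hxy fun a b => log ((1 + b) / a) * H (log b)).2
    simp only [hu, logPot, hf_def]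
    rw [this, hxy]
  · rw [integral_congr_ae hae]
    exact hf.2
  · refine ⟨fun he => ⟨(hweak.1 he).1, fun φ hφ => ?_⟩, fun ho => ⟨(hweak.2 ho).1, fun φ => ?_⟩⟩
    · rw [hrhs]
      exact (hweak.1 he).2 φ hφ
    · rw [hrhs]
      exact (hweak.2 ho).2 φ
  · rw [potentialIntegrand, hy]
  · have : potential α u x = 1 / γ * logPot f x := by
      rw [potential, logPot]
      congr 1
      exact integral_congr_ae (hae.mono fun y hy => by simp only [potentialIntegrand, hy])
    rw [this]
    simp only [hu]
    ring

/-- The confining field. The quadratic lower bound for `exp (2 t)` absorbs `2 a t` for `t ≥ 0`. -/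
lemma isField_sub_exp {a b : ℝ} (ha : 0 < a) (hb : 1 ≤ b) :
    IsField (fun t => a * t - b * rexp (2 * t)) a (a ^ 2) where
  meas := by fun_prop
  nonneg := ha.le
  le t := by
    have he := Real.exp_pos (2 * t)
    rcases le_total t 0 with ht | ht
    · rw [abs_of_nonpos ht]
      nlinarith [sq_nonneg a]
    · rw [abs_of_nonneg ht]
      have h1 := Real.quadratic_le_exp_of_nonneg (show 0 ≤ 2 * t by linarith)
      nlinarith [sq_nonneg (a - t)]

end QCurv

theorem theorem1p2 (n : ℕ) (hn : 3 ≤ n) (α : ℝ) (hα : -1 < α) :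
    (∀ Λ : ℝ, 0 < Λ → Λ < QCurv.Lambda1 n * (1 + α) →
      ∃ u : EuclideanSpace ℝ (Fin n) → ℝ, QCurv.IsRadial u ∧ QCurv.IsSolution α Λ u ∧
        ∃ c : ℝ, QCurv.IsPotentialPlus α u (fun x => -‖x‖ ^ 2 + c)) ∧
    (∃ u : EuclideanSpace ℝ (Fin n) → ℝ, QCurv.IsRadial u ∧
      QCurv.IsNormalSolution α (QCurv.Lambda1 n * (1 + α)) u) := by
  have hγ := QCurv.gammaConst_pos n
  have hΛ1 : QCurv.Lambda1 n = 2 * QCurv.gammaConst n := by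
    rw [QCurv.Lambda1, QCurv.gammaConst]; ring
  have hn1 : (1 : ℝ) ≤ n := by exact_mod_cast (by omega : 1 ≤ n)
  rw [hΛ1]
  constructor
  · intro Λ h0 h1
    have ha : 0 < n * (1 + α - Λ / (2 * QCurv.gammaConst n)) := by
      have : Λ / (2 * QCurv.gammaConst n) < 1 + α := by
        rw [div_lt_iff₀ (by positivity)]; linarith
      exact mul_pos (by linarith) (by linarith)
    obtain ⟨u, hr, hs, c, hc⟩ := QCurv.exists_isSolution (α := α) (η := 1) hn h0
      (by simpa only [mul_one] using QCurv.isField_sub_exp ha hn1) (Or.inl ha)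
    refine ⟨u, hr, hs, c, ?_⟩
    simpa only [one_mul] using hc
  · have hz : 1 + α - 2 * QCurv.gammaConst n * (1 + α) / (2 * QCurv.gammaConst n) = 0 := by
      field_simp
      ring
    obtain ⟨u, hr, hs, c, hc⟩ := QCurv.exists_isSolution (α := α) (η := 0) (c := 0) (D := 0)
      (Λ := 2 * QCurv.gammaConst n * (1 + α)) hn (mul_pos (by positivity) (by linarith))
      ⟨by fun_prop, le_rfl, fun t => by rw [hz]; simp⟩
      (Or.inr fun t => by simp only [hz]; simp)
    refine ⟨u, hr, hs, c, ?_⟩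
    simpa only [zero_mul, neg_zero, zero_add] using hc
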